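/- **Theorem (Hydrodynamic limits).** *Model.* Fix $d\in\mathbb N_0$, $\gamma\in(0,1)$ and measurable, Lebesgue-a.e. continuous functions $B_0:\mathbb R^d\times\mathbb R^d\to[0,1]$ and $B:\{0,1\}\times\mathbb R^d\times\mathbb R^d\to[0,1]$. For a process $x$ write $x[t]=(x(0),\dots,x(t))$. On one probability space let $(\xi_i(t))_{i\in\mathbb N,\,t\in\mathbb N_0}$ be i.i.d. absolutely continuous random vectors in $\mathbb R^d$. For each $n\in\mathbb N$ let $Z^n=(Z^n_i(t))_{1\le i\le n,\,t\in\mathbb N_0}$ be $\mathbb R^d$-valued and $A^n=(A^n_{ij}(t))_{1\le i,j\le n,\,t\in\mathbb N_0}$ be $\{0,1\}$-valued, with $A^n(t)$ symmetric, $A^n_{ii}(t)=1$ and $$Z^n_i(t+1)=(1-\gamma)Z^n_i(t)+\gamma\,\frac{\sum_{j}A^n_{ij}(t)Z^n_j(t)}{\sum_{j}A^n_{ij}(t)}+\xi_i(t).$$ Put $\mathcal F^{A,n}_0=\sigma(Z^n(0))$ and $\mathcal F^{A,n}_t=\sigma(Z^n[t],A^n[t-1])$ for $t>0$. Given $\mathcal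 F^{A,n}_t$ the variables $A^n_{ij}(t)$, $i<j$, are mutually conditionally independent, and for all $i\ne j$ the conditional probability that $A^n_{ij}(t)=1$ is $B_0(Z^n_i(0),Z^n_j(0))$ if $t=0$ and $B(A^n_{ij}(t-1),Z^n_i(t),Z^n_j(t))$ if $t>0$. For every $t\in\mathbb N_0$, $(\xi_i(t))_{i}$ is independent of $\bigvee_n\sigma(Z^n[t],A^n[t])$. *Initial conditions.* For each $n$, $Z^n_1(0),\dots,Z^n_n(0)$ are exchangeable, and there is an absolutely continuous probability measure $\mu_0$ on $\mathbb R^d$ such that for every $k$, $(Z^n_1(0),\dots,Z^n_k(0))\Rightarrow\mu_0^{\otimes k}$ as $n\to\infty$. *Bounds.* For all $C\in\mathbb R$, $\limsup_n\mathbb E\,e^{C|Z^n_1(0)|}<\infty$ and $\mathbb E\,e^{C|\xi_1(0)|}<\infty$. Moreover one of the following holds: (i) for some $C_b>0$, $\inf_{z_1,z_2}B_0(z_1,z_2)e^{C_b|z_1-z_2|}>0$ and $\inf_{a,z_1,z_2}B(a,z_1,z_2)e^{C_b|z_1-z_2|}>0$; (ii) for some $C_b>0$, $B_0(z_1,z_2)=B(a,z_1,z_2)=0$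 whenever $|z_1-z_2|>C_b$; and for all $a,z$, $B_0(z,z)>0$, $B(a,z,z)>0$, and $(z,z)$, $(a,z,z)$ are continuity points of $B_0$, $B$. *Limiting mean-field process.* Let $k\ge2$ and let $(Z^{(i)},A^{(ij)})_{1\le i,j\le k}$ be a limiting mean-field process: $Z^{(1)}(0),\dots,Z^{(k)}(0)$ are i.i.d. with law $\mu_0$, and $$Z^{(i)}(s+1)=(1-\gamma)Z^{(i)}(s)+\gamma\,\frac{\int z'(s)\,B_s(Z^{(i)}[s],z')\,\mu_s(dz')}{\int B_s(Z^{(i)}[s],z')\,\mu_s(dz')}+\xi^{(i)}(s)\quad\text{a.s.},\qquad \mu_s=\mathrm{Law}(Z^{(i)}[s]),$$ where $B_0$ is as above, $B_s(z_1[s],z_2[s])=p\,B(1,z_1(s),z_2(s))+(1-p)\,B(0,z_1(s),z_2(s))$ with $p=B_{s-1}(z_1[s-1],z_2[s-1])$ for $s>0$, the $\xi^{(i)}(s)$ are i.i.d. with the law of $\xi_1(0)$, and for each $s$ the family $(\xi^{(i)}(s))_i$ is independent of $\sigma(Z^{(1:k)}[s],A^{(1:k,1:k)}[s])$. The matrices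 $A(s)=(A^{(ij)}(s))_{i,j}$ are $\{0,1\}$-valued, symmetric, with unit diagonal, and given $\sigma(Z^{(1:k)}[s],A[s-1])$ (given $\sigma(Z^{(1:k)}(0))$ if $s=0$) the variables $A^{(ij)}(s)$, $i<j$, are mutually conditionally independent, with conditional probability of $A^{(ij)}(s)=1$ equal, for all $i\neq j$, to $B(A^{(ij)}(s-1),Z^{(i)}(s),Z^{(j)}(s))$ if $s>0$ and $B_0(Z^{(i)}(0),Z^{(j)}(0))$ if $s=0$. *Conclusion.* Let $t\in\mathbb N_0$, let $\mu_t=\mathrm{Law}(Z^{(1)}[t])$, and give spaces of probability measures the topology of weak convergence. Then, as $n\to\infty$, $$\frac1n\sum_{i=1}^n\delta_{Z^n_i[t]}\to\mu_t\quad\text{in probability.}$$ Moreover, for every $1\le i\le k$ and all random $Z',A'$ such that $(Z^{(i)}[t],Z',A')$ has the same law as $(Z^{(1)}[t],Z^{(2)}[t],A^{(12)}[t])$, $$\Big(Z^n_i[t],\ \frac1n\sum_{j=1}^n\delta_{(Z^n_i[t],\,Z^n_j[t],\,A^n_{ij}[t])}\Big)\Rightarrow\Big(Z^{(i)}[t],\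 \mathrm{Law}\big(Z^{(i)}[t],Z',A'\,\big|\,Z^{(i)}[t]\big)\Big)$$ in distribution. -/

import Mathlib

open MeasureTheory ProbabilityTheory Filter Topology
open scoped ENNReal

noncomputable section

/-- The opinion space `ℝ^d` with its Euclidean norm. -/
abbrev Opinion (d : ℕ) : Type := EuclideanSpace ℝ (Fin d)

/-- Trajectories over the times `0, 1, …, t`. -/
abbrev Traj (X : Type*) (t : ℕ) : Type _ := Fin (t + 1) → X

instance {X : Type*} [MeasurableSpace X] [StandardBorelSpace X] (t : ℕ) :
    StandardBorelSpace (Traj X t) := StandardBorelSpace.pi_countable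

instance {X : Type*} [TopologicalSpace X] [SecondCountableTopology X] [MeasurableSpace X]
    [BorelSpace X] (t : ℕ) : BorelSpace (Traj X t) := Pi.borelSpace

/-- The trajectory `x[t] = (x(0), …, x(t))` of a process `x`. -/
def traj {Ω X : Type*} (x : ℕ → Ω → X) (t : ℕ) (ω : Ω) : Traj X t := fun s => x s ω

/-- The space of the trajectories `(Z_i[t], Z_j[t], A_ij[t])`. -/
abbrev PairTraj (d t : ℕ) : Type := Traj (Opinion d) t × Traj (Opinion d) t × Traj Bool t

instance (d t : ℕ) : OpensMeasurableSpace (PairTraj d t) := Prod.opensMeasurableSpace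

/-- The value in `{0, 1} ⊆ ℝ` of an edge indicator. -/
def edgeVal (a : Bool) : ℝ := if a then 1 else 0

/-- `B₀ : ℝ^d × ℝ^d → [0,1]` and `B : {0,1} × ℝ^d × ℝ^d → [0,1]` are measurable and continuous
Lebesgue-almost everywhere. -/
structure IsInteraction {d : ℕ} (B₀ : Opinion d → Opinion d → ℝ)
    (B : Bool → Opinion d → Opinion d → ℝ) : Prop where
  init_mem : ∀ x y, B₀ x y ∈ Set.Icc (0 : ℝ) 1
  mem : ∀ a x y, B a x y ∈ Set.Icc (0 : ℝ) 1
  init_measurable : Measurable fun p : Opinion d × Opinion d => B₀ p.1 p.2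
  measurable : ∀ a, Measurable fun p : Opinion d × Opinion d => B a p.1 p.2
  init_continuous : ∀ᵐ p ∂(volume : Measure (Opinion d × Opinion d)),
    ContinuousAt (fun q : Opinion d × Opinion d => B₀ q.1 q.2) p
  continuous : ∀ a, ∀ᵐ p ∂(volume : Measure (Opinion d × Opinion d)),
    ContinuousAt (fun q : Opinion d × Opinion d => B a q.1 q.2) p

/-! ### Histories and the random network -/

section Network

variable {Ω ι : Type*} {d : ℕ}

/-- `σ(Z(s) : s ≤ t)`. -/
abbrev nodeHistory (Z : ι → ℕ → Ω → Opinion d) (t : ℕ) : MeasurableSpace Ω :=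
  ⨆ i, ⨆ s, ⨆ _ : s ≤ t, MeasurableSpace.comap (Z i s) inferInstance

/-- `σ(A(s) : s < t)`, trivial for `t = 0`. -/
abbrev edgeHistory (A : ι → ι → ℕ → Ω → Bool) (t : ℕ) : MeasurableSpace Ω :=
  ⨆ i, ⨆ j, ⨆ s, ⨆ _ : s < t, MeasurableSpace.comap (A i j s) inferInstance

/-- What is known just before the edges at time `t` are drawn:
`σ(Z[t], A[t-1])` for `t > 0` and `σ(Z(0))` for `t = 0`. -/
abbrev preEdgeHistory (Z : ι → ℕ → Ω → Opinion d) (A : ι → ι → ℕ → Ω → Bool) (t : ℕ) :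
    MeasurableSpace Ω :=
  nodeHistory Z t ⊔ edgeHistory A t

/-- `σ(Z[t], A[t])`. -/
abbrev fullHistory (Z : ι → ℕ → Ω → Opinion d) (A : ι → ι → ℕ → Ω → Bool) (t : ℕ) :
    MeasurableSpace Ω :=
  nodeHistory Z t ⊔ edgeHistory A (t + 1)

/-- The probability of the edge `ij` at time `t`: `B₀(Z_i(0), Z_j(0))` for `t = 0` and
`B(A_ij(t-1), Z_i(t), Z_j(t))` for `t > 0`. -/
def edgeProb (B₀ : Opinion d → Opinion d → ℝ) (B : Bool → Opinion d → Opinion d → ℝ)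
    (Z : ι → ℕ → Ω → Opinion d) (A : ι → ι → ℕ → Ω → Bool) (i j : ι) : ℕ → Ω → ℝ
  | 0, ω => B₀ (Z i 0 ω) (Z j 0 ω)
  | t + 1, ω => B (A i j t ω) (Z i (t + 1) ω) (Z j (t + 1) ω)

/-- Mutual conditional independence of a family of random elements given a sub-σ-algebra `m`
(on an arbitrary probability space). -/
def CondIndepFamily [MeasurableSpace Ω] (P : Measure Ω) (m : MeasurableSpace Ω)
    {κ β : Type*} [MeasurableSpace β] (X : κ → Ω → β) : Prop :=
  ∀ (S : Finset κ) (u : κ → Set β), (∀ e ∈ S, MeasurableSet (u e)) →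
    P⟦⋂ e ∈ S, X e ⁻¹' u e | m⟧ =ᵐ[P] ∏ e ∈ S, P⟦X e ⁻¹' u e | m⟧

/-- The random network `A` driven by the opinions `Z`: at each time the matrix is symmetric with
unit diagonal, and, given the past and the present opinions, the edges `i < j` are mutually
conditionally independent Bernoulli variables with parameters `edgeProb`. -/
structure IsNetwork [LinearOrder ι] [MeasurableSpace Ω] (P : Measure Ω)
    (B₀ : Opinion d → Opinion d → ℝ) (B : Bool → Opinion d → Opinion d → ℝ)
    (Z : ι → ℕ → Ω → Opinion d) (A : ι → ι → ℕ → Ω → Bool) : Prop where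
  measurable : ∀ i j t, Measurable (A i j t)
  symm : ∀ i j t, ∀ᵐ ω ∂P, A i j t ω = A j i t ω
  diag : ∀ i t, ∀ᵐ ω ∂P, A i i t ω = true
  prob : ∀ i j, i ≠ j → ∀ t,
    P⟦A i j t ⁻¹' {true} | preEdgeHistory Z A t⟧ =ᵐ[P] edgeProb B₀ B Z A i j t
  condIndep : ∀ t, CondIndepFamily P (preEdgeHistory Z A t)
    (fun (e : {p : ι × ι // p.1 < p.2}) ω => A e.1.1 e.1.2 t ω)

/-- `L_i(t)`: the mean opinion at time `t` of the neighbours of `i` (which include `i`). -/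
def neighbourMean [Fintype ι] (Z : ι → ℕ → Ω → Opinion d) (A : ι → ι → ℕ → Ω → Bool)
    (i : ι) (t : ℕ) (ω : Ω) : Opinion d :=
  (∑ j, edgeVal (A i j t ω))⁻¹ • ∑ j, edgeVal (A i j t ω) • Z j t ω

end Network

/-! ### The `n`-agent systems -/

section Particles

variable {Ω : Type*} [MeasurableSpace Ω] {d : ℕ}

/-- The `n`-agent systems `(Z^n, A^n)`, `n ∈ ℕ`, driven by the common noise `ξ`. Agents are
numbered from `0`, and the agents of the `n`-th system are the elements of `Fin n`. -/
structure IsParticleSystem (P : Measure Ω) (γ : ℝ)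
    (B₀ : Opinion d → Opinion d → ℝ) (B : Bool → Opinion d → Opinion d → ℝ)
    (ξ : ℕ → ℕ → Ω → Opinion d) (Z : (n : ℕ) → Fin n → ℕ → Ω → Opinion d)
    (A : (n : ℕ) → Fin n → Fin n → ℕ → Ω → Bool) : Prop where
  measurable_noise : ∀ i t, Measurable (ξ i t)
  measurable_opinion : ∀ n i t, Measurable (Z n i t)
  opinion_step : ∀ n i t, ∀ᵐ ω ∂P, Z n i (t + 1) ω =
    (1 - γ) • Z n i t ω + γ • neighbourMean (Z n) (A n) i t ω + ξ i t ω
  network : ∀ n, IsNetwork P B₀ B (Z n) (A n)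
  noise_indep : iIndepFun (fun (p : ℕ × ℕ) ω => ξ p.1 p.2 ω) P
  noise_identDistrib : ∀ i t, IdentDistrib (ξ i t) (ξ 0 0) P P
  noise_ac : P.map (ξ 0 0) ≪ volume
  noise_indep_past : ∀ t, Indep (⨆ i, MeasurableSpace.comap (ξ i t) inferInstance)
    (⨆ n, fullHistory (Z n) (A n) t) P

/-- The initial opinions of the `n`-agent systems are exchangeable, and for every `k` the initial
opinions of the first `k` agents converge in distribution, as `n → ∞`, to `k` independent vectors
with the absolutely continuous law `μ₀`. -/
structure IsInitial (P : Measure Ω) [IsProbabilityMeasure P]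
    (Z₀ : (n : ℕ) → Fin n → Ω → Opinion d)
    (μ₀ : Measure (Opinion d)) [IsProbabilityMeasure μ₀] : Prop where
  exchangeable : ∀ n (σ : Equiv.Perm (Fin n)),
    IdentDistrib (fun ω i => Z₀ n (σ i) ω) (fun ω i => Z₀ n i ω) P P
  ac : μ₀ ≪ volume
  tendsto : ∀ k : ℕ, TendstoInDistribution
    (fun (m : ℕ) ω (i : Fin k) => Z₀ (m + k) (Fin.castLE (Nat.le_add_left k m) i) ω) atTop
    (id : (Fin k → Opinion d) → (Fin k → Opinion d)) (fun _ => P) (Measure.pi fun _ => μ₀)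

/-- Interactions decay at most exponentially. -/
def ExpDecay (B₀ : Opinion d → Opinion d → ℝ) (B : Bool → Opinion d → Opinion d → ℝ) : Prop :=
  ∃ C > 0, (0 < ⨅ p : Opinion d × Opinion d, B₀ p.1 p.2 * Real.exp (C * ‖p.1 - p.2‖)) ∧
    0 < ⨅ p : Bool × Opinion d × Opinion d,
      B p.1 p.2.1 p.2.2 * Real.exp (C * ‖p.2.1 - p.2.2‖)

/-- Interactions have finite range, and are positive and continuous on the diagonal. -/
def FiniteRange (B₀ : Opinion d → Opinion d → ℝ) (B : Bool → Opinion d → Opinion d → ℝ) : Prop :=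
  (∃ C > 0, ∀ a x y, C < ‖x - y‖ → B₀ x y = 0 ∧ B a x y = 0) ∧
  ∀ a z, 0 < B₀ z z ∧ 0 < B a z z ∧
    ContinuousAt (fun q : Opinion d × Opinion d => B₀ q.1 q.2) (z, z) ∧
    ContinuousAt (fun q : Opinion d × Opinion d => B a q.1 q.2) (z, z)

/-- The bounds that make the opinions uniformly integrable. -/
structure HasBounds (P : Measure Ω)
    (B₀ : Opinion d → Opinion d → ℝ) (B : Bool → Opinion d → Opinion d → ℝ)
    (ξ : ℕ → ℕ → Ω → Opinion d) (Z₀ : (n : ℕ) → Fin n → Ω → Opinion d) : Prop where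
  init : ∀ C : ℝ,
    limsup (fun m : ℕ => ∫⁻ ω, ENNReal.ofReal (Real.exp (C * ‖Z₀ (m + 1) 0 ω‖)) ∂P) atTop < ⊤
  noise : ∀ C : ℝ, ∫⁻ ω, ENNReal.ofReal (Real.exp (C * ‖ξ 0 0 ω‖)) ∂P < ⊤
  interaction : ExpDecay B₀ B ∨ FiniteRange B₀ B

end Particles

/-! ### The limiting mean-field process -/

section Limit

variable {d : ℕ}

/-- `B̂(p, x, y) = p B(1, x, y) + (1 - p) B(0, x, y)`. -/
def mixedProb (B : Bool → Opinion d → Opinion d → ℝ) (p : ℝ) (x y : Opinion d) : ℝ :=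
  p * B true x y + (1 - p) * B false x y

/-- The functions `B_s(z₁[s], z₂[s])`: `B₀(z₁(0), z₂(0))` for `s = 0` and
`B̂(B_{s-1}(z₁[s-1], z₂[s-1]), z₁(s), z₂(s))` for `s > 0`. -/
def linkFn (B₀ : Opinion d → Opinion d → ℝ) (B : Bool → Opinion d → Opinion d → ℝ) :
    (s : ℕ) → Traj (Opinion d) s → Traj (Opinion d) s → ℝ
  | 0, z₁, z₂ => B₀ (z₁ 0) (z₂ 0)
  | s + 1, z₁, z₂ => mixedProb B
      (linkFn B₀ B s (fun r => z₁ r.castSucc) (fun r => z₂ r.castSucc))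
      (z₁ (Fin.last (s + 1))) (z₂ (Fin.last (s + 1)))

/-- For `(Z, Z')` with law `μ ⊗ μ`, the value at `Z = z` of
`E[Z'(s) B_s(Z[s], Z'[s]) | Z[s]] / E[B_s(Z[s], Z'[s]) | Z[s]]`. Since `Z` and `Z'` are
independent, these conditional expectations are integrals over `Z'` with `z` frozen. -/
def limitMean (B₀ : Opinion d → Opinion d → ℝ) (B : Bool → Opinion d → Opinion d → ℝ)
    (s : ℕ) (μ : Measure (Traj (Opinion d) s)) (z : Traj (Opinion d) s) : Opinion d :=
  (∫ z', linkFn B₀ B s z z' ∂μ)⁻¹ • ∫ z', linkFn B₀ B s z z' • z' (Fin.last s) ∂μ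

/-- `(Z, A)` is a limiting mean-field process of `k` agents, with initial law `μ₀` and with noise
`ξ` of law `ν`. The step is a McKean–Vlasov equation: its drift involves the law of the trajectory
of the solution itself. -/
structure IsLimitProcess {Ω : Type*} [MeasurableSpace Ω] (P : Measure Ω) (γ : ℝ)
    (B₀ : Opinion d → Opinion d → ℝ) (B : Bool → Opinion d → Opinion d → ℝ)
    (μ₀ ν : Measure (Opinion d)) {k : ℕ} (ξ Z : Fin k → ℕ → Ω → Opinion d)
    (A : Fin k → Fin k → ℕ → Ω → Bool) : Prop where
  measurable_noise : ∀ i s, Measurable (ξ i s)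
  measurable_opinion : ∀ i s, Measurable (Z i s)
  init_indep : iIndepFun (fun i => Z i 0) P
  init_law : ∀ i, P.map (Z i 0) = μ₀
  noise_indep : iIndepFun (fun (p : Fin k × ℕ) ω => ξ p.1 p.2 ω) P
  noise_law : ∀ i s, P.map (ξ i s) = ν
  noise_indep_past : ∀ s, Indep (⨆ i, MeasurableSpace.comap (ξ i s) inferInstance)
    (fullHistory Z A s) P
  opinion_step : ∀ i s, ∀ᵐ ω ∂P, Z i (s + 1) ω =
    (1 - γ) • Z i s ω
      + γ • limitMean B₀ B s (P.map (traj (Z i) s)) (traj (Z i) s ω) + ξ i s ω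
  network : IsNetwork P B₀ B Z A

end Limit

/-! ### Empirical measures, conditional laws and modes of convergence -/

section Convergence

/-- The empirical measure `(1/n) ∑ⱼ δ_{x_j}` of `n ≥ 1` points. -/
def empirical {S : Type*} [MeasurableSpace S] {n : ℕ} [NeZero n] (x : Fin n → S) :
    ProbabilityMeasure S :=
  ⟨(n : ℝ≥0∞)⁻¹ • ∑ j, Measure.dirac (x j), ⟨by
    simp [ENNReal.inv_mul_cancel (Nat.cast_ne_zero.mpr (NeZero.ne n)) (ENNReal.natCast_ne_top n)]⟩⟩

/-- The law of a random element. -/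
def law {Ω S : Type*} [MeasurableSpace Ω] [MeasurableSpace S] (P : Measure Ω)
    [IsProbabilityMeasure P] (X : Ω → S) (hX : Measurable X) : ProbabilityMeasure S :=
  ⟨P.map X, Measure.isProbabilityMeasure_map hX.aemeasurable⟩

theorem measurable_traj {Ω X : Type*} [MeasurableSpace Ω] [MeasurableSpace X] {x : ℕ → Ω → X}
    (hx : ∀ s, Measurable (x s)) (t : ℕ) : Measurable (traj x t) :=
  measurable_pi_lambda _ fun s => hx s

/-- The random measure `Law(Y | X)`: the regular conditional law of `Y` given `X`, evaluated
at `X`. -/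
def condLaw {Ω S T : Type*} [MeasurableSpace Ω] [MeasurableSpace S] [MeasurableSpace T]
    [StandardBorelSpace T] [Nonempty T] (P : Measure Ω) [IsFiniteMeasure P]
    (Y : Ω → T) (X : Ω → S) (ω : Ω) : ProbabilityMeasure T :=
  ⟨condDistrib Y X P (X ω), inferInstance⟩

/-- Convergence in probability to a constant `c` in a topological space. -/
def TendstoInProbConst {Ω S : Type*} [MeasurableSpace Ω] [TopologicalSpace S] (P : Measure Ω)
    (X : ℕ → Ω → S) (c : S) : Prop :=
  ∀ U ∈ 𝓝 c, Tendsto (fun n => P {ω | X n ω ∉ U}) atTop (𝓝 0)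

/-- Convergence in distribution of random elements of a topological space that carries its Borel
σ-algebra. -/
def TendstoInLaw {Ω Ω' S : Type*} [MeasurableSpace Ω] [MeasurableSpace Ω'] [TopologicalSpace S]
    (P : Measure Ω) [IsProbabilityMeasure P] (P' : Measure Ω') [IsProbabilityMeasure P']
    (X : ℕ → Ω → S) (Y : Ω' → S) : Prop :=
  letI : MeasurableSpace S := borel S
  haveI : BorelSpace S := ⟨rfl⟩
  TendstoInDistribution X atTop Y (fun _ => P) P'

end Convergence

end

/-! The proof is propagation of chaos by induction on time. The explicit candidates for the limit
are `limLaw`, the law of one limiting trajectory, and `edgeLaw`, the probability of an edge path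
given the trajectories of its end points. The induction statement `Chaos` says that any fixed number
of distinct agents have asymptotically independent trajectories with law `limLaw`, and that their
edge paths become independent given the trajectories, with law `edgeLaw`. The test functions need
only be bounded and almost everywhere continuous for the limit; this is what allows `B₀` and `B` to
be discontinuous. The statement covers arbitrary sequences of agents, so exchangeability enters only
at time 0.

Law of large numbers (`Chaos.tendsto_lln`). Fix an agent i and average a function of the pairs (i,
j) over j, centred by its limiting conditional mean `pairMean` given the trajectory of i. The square
of the average is a double sum over (j, l). For distinct i, j, l chaos for three agents makes the
expected inner product vanish in the limit, because j and l are conditionally independent given i;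
the remaining pairs are of order n out of n². Hence averages over neighbourhoods are close to
deterministic functions of the agent's own trajectory.

Induction step. The neighbourhood mean is a quotient of two such averages. The denominator has an
almost surely positive limit, since interactions are positive near the diagonal and almost every
point lies in the support of its law (`ae_pairMean_lastEdge_pos`). The numerator is unbounded and is
treated by truncation, using exponential moments that are uniform in the agents (`momentBound`).
Therefore the neighbourhood mean may be replaced by `limitMean` of the agent's trajectory
(`Chaos.tendsto_neighbourMean`). After this replacement the new opinions are functions of the old
trajectories and of fresh independent noise, so chaos at time t gives convergence for Lipschitz test
functions (`tendsto_integral_lipschitz_succ`). New edges are integrated out given the past, which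
turns them into Bernoulli factors in the trajectories. These factors are almost everywhere
continuous because initial law and noise are absolutely continuous (`chaos_succ`).

Moments. By Jensen, an exponential moment of the neighbourhood mean is bounded by the sum of all
exponentials divided by the degree. A conditional second moment argument replaces the degree by its
conditional mean, which the exponential decay bounds from below. With finite range, neighbours are
simply at bounded distance.

Conclusion. The same induction, with equalities for limits, identifies the law of the limiting
process (`hasLimitLaw`) and hence its conditional law (`HasLimitLaw.condDistrib_ae_eq`). The law of
large numbers gives the convergence of the empirical measure, and shows that the neighbourhood
empirical measure is close in probability to an almost everywhere continuous function of the agent's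
trajectory; that trajectory converges in law by chaos, and a Slutsky argument finishes
(`Chaos.tendsto_integral_neighbourhood`). -/

set_option linter.unusedSectionVars false

/-! ### Weak convergence and almost everywhere continuous test functions -/

section WeakConvergence

variable {X : Type*} [PseudoMetricSpace X]

/-- The largest `L`-Lipschitz minorant of a bounded function. -/
noncomputable def lipMinorant (G : X → ℝ) (L : ℕ) (x : X) : ℝ := ⨅ y, (G y + L * dist x y)

theorem lipMinorant_bddBelow {G : X → ℝ} {M : ℝ} (hG : ∀ x, |G x| ≤ M) (L : ℕ) (x : X) :
    BddBelow (Set.range fun y => G y + L * dist x y) :=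
  ⟨-M, by
    rintro _ ⟨y, rfl⟩
    have := neg_le_of_abs_le (hG y)
    have : 0 ≤ (L : ℝ) * dist x y := by positivity
    simp only
    linarith⟩

theorem lipMinorant_le {G : X → ℝ} {M : ℝ} (hG : ∀ x, |G x| ≤ M) (L : ℕ) (x : X) :
    lipMinorant G L x ≤ G x := by
  have := ciInf_le (lipMinorant_bddBelow hG L x) x
  simpa [lipMinorant] using this

theorem neg_le_lipMinorant {G : X → ℝ} {M : ℝ} (hG : ∀ x, |G x| ≤ M) (L : ℕ) (x : X) :
    -M ≤ lipMinorant G L x := by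
  have : Nonempty X := ⟨x⟩
  refine le_ciInf fun y => ?_
  have := neg_le_of_abs_le (hG y)
  have : 0 ≤ (L : ℝ) * dist x y := by positivity
  linarith

theorem abs_lipMinorant_le {G : X → ℝ} {M : ℝ} (hG : ∀ x, |G x| ≤ M) (L : ℕ) (x : X) :
    |lipMinorant G L x| ≤ M :=
  abs_le.2 ⟨neg_le_lipMinorant hG L x, (lipMinorant_le hG L x).trans (le_of_abs_le (hG x))⟩

theorem lipschitzWith_lipMinorant {G : X → ℝ} {M : ℝ} (hG : ∀ x, |G x| ≤ M) (L : ℕ) :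
    LipschitzWith (L : NNReal) (lipMinorant G L) := by
  refine LipschitzWith.of_le_add_mul _ fun x x' => ?_
  have : Nonempty X := ⟨x⟩
  rw [← sub_le_iff_le_add]
  refine le_ciInf fun y => ?_
  rw [sub_le_iff_le_add]
  refine (ciInf_le (lipMinorant_bddBelow hG L x) y).trans ?_
  have h1 : (L : ℝ) * dist x y ≤ L * (dist x x' + dist x' y) := by
    gcongr; exact dist_triangle x x' y
  have h2 : ((L : NNReal) : ℝ) = (L : ℝ) := by simp
  rw [h2]
  linarith

/-- Near x the competitors in the infimum have values close to `G x`; at distance at least δ the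
penalty exceeds the total oscillation 2M as soon as L δ ≥ 2M. -/
theorem tendsto_lipMinorant {G : X → ℝ} {M : ℝ} (hG : ∀ x, |G x| ≤ M) {x : X}
    (hx : ContinuousAt G x) : Tendsto (fun L => lipMinorant G L x) atTop (𝓝 (G x)) := by
  rw [Metric.tendsto_atTop]
  intro ε hε
  obtain ⟨δ, hδ, h⟩ := Metric.continuousAt_iff.1 hx (ε / 2) (by positivity)
  obtain ⟨N, hN⟩ := exists_nat_ge (2 * M / δ)
  refine ⟨N, fun L hL => ?_⟩
  have hle := lipMinorant_le hG L x
  have : Nonempty X := ⟨x⟩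
  have hge : G x - ε / 2 ≤ lipMinorant G L x := by
    refine le_ciInf fun y => ?_
    by_cases hy : dist y x < δ
    · have h1 := h hy
      rw [Real.dist_eq, abs_lt] at h1
      have : 0 ≤ (L : ℝ) * dist x y := by positivity
      linarith [h1.1]
    · push Not at hy
      have h1 := neg_le_of_abs_le (hG y)
      have h2 := le_of_abs_le (hG x)
      have h3 : 2 * M ≤ L * dist x y := by
        rw [div_le_iff₀ hδ] at hN
        refine hN.trans ?_
        rw [dist_comm]
        have : (N : ℝ) ≤ L := by exact_mod_cast hL
        gcongr
      linarith
  rw [Real.dist_eq, abs_lt]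
  constructor <;> linarith

variable [MeasurableSpace X] [OpensMeasurableSpace X] {Ω : Type*} [MeasurableSpace Ω]

/-- A portmanteau theorem with weights. Lipschitz minorants increase to `G` at its continuity
points, so dominated convergence gives a lower bound for the limit, and `-G` gives the upper bound.
The weights `w` are not assumed to converge on their own. In the induction they are indicators of
edge paths, and `v` is the limiting probability of those paths given the trajectories. -/
theorem tendsto_integral_mul_of_lipschitz {P : Measure Ω} [IsProbabilityMeasure P]
    {m : Measure X} [IsProbabilityMeasure m] {x : ℕ → Ω → X} (hx : ∀ n, Measurable (x n))
    {w : ℕ → Ω → ℝ} (hw : ∀ n, Measurable (w n)) (hw01 : ∀ n ω, w n ω ∈ Set.Icc (0 : ℝ) 1)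
    {v : X → ℝ} (hv : Measurable v) (hv01 : ∀ y, v y ∈ Set.Icc (0 : ℝ) 1)
    (h : ∀ (f : X → ℝ) (M : ℝ), (∀ y, |f y| ≤ M) → ∀ K, LipschitzWith K f →
      Tendsto (fun n => ∫ ω, f (x n ω) * w n ω ∂P) atTop (𝓝 (∫ y, f y * v y ∂m)))
    {G : X → ℝ} (hG : Measurable G) {M : ℝ} (hGb : ∀ y, |G y| ≤ M)
    (hGc : ∀ᵐ y ∂m, ContinuousAt G y) :
    Tendsto (fun n => ∫ ω, G (x n ω) * w n ω ∂P) atTop (𝓝 (∫ y, G y * v y ∂m)) := by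
  have bound : ∀ {a b c : ℝ}, |a| ≤ c → b ∈ Set.Icc (0 : ℝ) 1 → ‖a * b‖ ≤ c := by
    intro a b c ha hb
    rw [norm_mul, Real.norm_eq_abs, Real.norm_eq_abs, abs_of_nonneg hb.1]
    nlinarith [abs_nonneg a, hb.1, hb.2]
  have key : ∀ H : X → ℝ, Measurable H → (∀ y, |H y| ≤ M) → (∀ᵐ y ∂m, ContinuousAt H y) →
      ∀ ε > 0, ∀ᶠ n in atTop, ∫ y, H y * v y ∂m - ε < ∫ ω, H (x n ω) * w n ω ∂P := by
    intro H hH hHb hHc ε hε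
    have h1 : Tendsto (fun L => ∫ y, lipMinorant H L y * v y ∂m) atTop
        (𝓝 (∫ y, H y * v y ∂m)) := by
      refine tendsto_integral_of_dominated_convergence (fun _ => M) (fun L => ?_)
        (integrable_const _) (fun L => ?_) ?_
      · exact ((lipschitzWith_lipMinorant hHb L).continuous.measurable.mul hv).aestronglyMeasurable
      · exact ae_of_all _ fun y => bound (abs_lipMinorant_le hHb L y) (hv01 y)
      · filter_upwards [hHc] with y hy
        exact (tendsto_lipMinorant hHb hy).mul_const _
    obtain ⟨L, hL⟩ := (h1.eventually (lt_mem_nhds (sub_lt_self _ (half_pos hε)))).exists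
    have h2 := h _ M (abs_lipMinorant_le hHb L) _ (lipschitzWith_lipMinorant hHb L)
    filter_upwards [h2.eventually (lt_mem_nhds (sub_lt_self _ (half_pos hε)))] with n hn
    have h3 : ∫ ω, lipMinorant H L (x n ω) * w n ω ∂P ≤ ∫ ω, H (x n ω) * w n ω ∂P := by
      refine integral_mono ?_ ?_ fun ω => ?_
      · exact Integrable.of_bound (((lipschitzWith_lipMinorant hHb L).continuous.measurable.comp
          (hx n)).mul (hw n)).aestronglyMeasurable M
          (ae_of_all _ fun ω => bound (abs_lipMinorant_le hHb L _) (hw01 n ω))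
      · exact Integrable.of_bound ((hH.comp (hx n)).mul (hw n)).aestronglyMeasurable M
          (ae_of_all _ fun ω => bound (hHb _) (hw01 n ω))
      · exact mul_le_mul_of_nonneg_right (lipMinorant_le hHb L _) (hw01 n ω).1
    linarith
  rw [Metric.tendsto_atTop']
  intro ε hε
  have k1 := key G hG hGb hGc ε hε
  -- The lower bound for the negative function is the upper bound for `G`.
  have k2 := key (fun y => -G y) hG.neg (by simpa using hGb)
    (hGc.mono fun y hy => hy.neg) ε hε
  simp only [neg_mul, integral_neg] at k2
  obtain ⟨N, hN⟩ := eventually_atTop.1 (k1.and k2)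
  refine ⟨N, fun n hn => ?_⟩
  obtain ⟨h1, h2⟩ := hN n hn.le
  rw [Real.dist_eq, abs_lt]
  constructor <;> linarith

end WeakConvergence

/-! ### Averages over pairs -/

/-- Convergence along every sequence of indices is automatically uniform: if uniformity fails,
picking a bad pair whenever there is one yields a sequence that contradicts the hypothesis. -/
theorem eventually_forall_distinct_lt {a : (m : ℕ) → Fin (m + 1) → Fin (m + 1) → ℝ}
    (i : (m : ℕ) → Fin (m + 1))
    (h : ∀ j l : (m : ℕ) → Fin (m + 1), (∀ᶠ m in atTop, i m ≠ j m ∧ i m ≠ l m ∧ j m ≠ l m) →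
      Tendsto (fun m => a m (j m) (l m)) atTop (𝓝 0)) {ε : ℝ} (hε : 0 < ε) :
    ∀ᶠ m in atTop, ∀ j l, i m ≠ j → i m ≠ l → j ≠ l → |a m j l| < ε := by
  classical
  by_contra hcon
  rw [not_eventually] at hcon
  -- When there is no bad pair the sequence must still consist of distinct indices, which exist
  -- among m + 1 ≥ 3 agents.
  have hex : ∀ m, 2 ≤ m → ∃ p : Fin (m + 1) × Fin (m + 1),
      i m ≠ p.1 ∧ i m ≠ p.2 ∧ p.1 ≠ p.2 := by
    intro m hm
    have h1 : ({i m} : Finset (Fin (m + 1))).card < (Finset.univ : Finset (Fin (m + 1))).card := by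
      simp; omega
    obtain ⟨j, -, hj⟩ := Finset.exists_mem_notMem_of_card_lt_card h1
    have h2 : ({i m, j} : Finset (Fin (m + 1))).card <
        (Finset.univ : Finset (Fin (m + 1))).card := by
      refine (Finset.card_le_two).trans_lt ?_
      simp; omega
    obtain ⟨l, -, hl⟩ := Finset.exists_mem_notMem_of_card_lt_card h2
    simp only [Finset.mem_singleton, Finset.mem_insert, not_or] at hj hl
    exact ⟨(j, l), Ne.symm hj, Ne.symm hl.1, Ne.symm hl.2⟩
  have hch : ∀ m, ∃ p : Fin (m + 1) × Fin (m + 1),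
      (2 ≤ m → i m ≠ p.1 ∧ i m ≠ p.2 ∧ p.1 ≠ p.2) ∧
      ((¬ ∀ j l, i m ≠ j → i m ≠ l → j ≠ l → |a m j l| < ε) → ε ≤ |a m p.1 p.2|) := by
    intro m
    by_cases hb : ∀ j l, i m ≠ j → i m ≠ l → j ≠ l → |a m j l| < ε
    · by_cases hm : 2 ≤ m
      · obtain ⟨p, hp⟩ := hex m hm
        exact ⟨p, fun _ => hp, fun h => absurd hb h⟩
      · exact ⟨(0, 0), fun h => absurd h hm, fun h => absurd hb h⟩
    · push Not at hb
      obtain ⟨j, l, h1, h2, h3, h4⟩ := hb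
      exact ⟨(j, l), fun _ => ⟨h1, h2, h3⟩, fun _ => h4⟩
  choose p hp1 hp2 using hch
  have ht := h (fun m => (p m).1) (fun m => (p m).2)
    (eventually_atTop.2 ⟨2, fun m hm => hp1 m hm⟩)
  have hev : ∀ᶠ m in atTop, |a m (p m).1 (p m).2| < ε := by
    have := (tendsto_zero_iff_abs_tendsto_zero _).1 ht
    exact this.eventually (gt_mem_nhds hε)
  obtain ⟨m, hm1, hm2⟩ := (hcon.and_eventually hev).exists
  exact absurd hm2 (not_lt.2 (hp2 m hm1))

/-- All but at most 3(m + 1) of the (m + 1)² pairs are distinct from `i m` and from each other.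
Those are uniformly small, and the others contribute at most 3C/(m + 1) to the average. -/
theorem tendsto_pair_average {a : (m : ℕ) → Fin (m + 1) → Fin (m + 1) → ℝ} {C : ℝ}
    (hC : ∀ m j l, |a m j l| ≤ C) (i : (m : ℕ) → Fin (m + 1))
    (h : ∀ j l : (m : ℕ) → Fin (m + 1), (∀ᶠ m in atTop, i m ≠ j m ∧ i m ≠ l m ∧ j m ≠ l m) →
      Tendsto (fun m => a m (j m) (l m)) atTop (𝓝 0)) :
    Tendsto (fun m : ℕ => (((m : ℝ) + 1) ^ 2)⁻¹ * ∑ j, ∑ l, a m j l) atTop (𝓝 0) := by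
  classical
  have hC0 : 0 ≤ C := (abs_nonneg _).trans (hC 0 0 0)
  rw [tendsto_zero_iff_abs_tendsto_zero, Metric.tendsto_atTop']
  intro ε hε
  obtain ⟨N, hN⟩ := eventually_atTop.1 (eventually_forall_distinct_lt i h (half_pos hε))
  obtain ⟨N', hN'⟩ := exists_nat_gt (3 * C / (ε / 2))
  refine ⟨max N N', fun m hm => ?_⟩
  have hb := hN m ((le_max_left _ _).trans hm.le)
  have hm' : (3 * C / (ε / 2)) < (m : ℝ) + 1 := by
    have : (N' : ℝ) ≤ m := by exact_mod_cast (le_max_right _ _).trans hm.le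
    linarith
  have hterm : ∀ j l, |a m j l| ≤ ε / 2 + ((if j = i m then C else 0) +
      (if l = i m then C else 0) + if j = l then C else 0) := by
    intro j l
    have hcj := hC m j l
    by_cases h1 : j = i m
    · simp only [h1, if_true] at hcj ⊢
      split_ifs <;> linarith
    by_cases h2 : l = i m
    · simp only [h2, if_true] at hcj ⊢
      split_ifs <;> linarith
    by_cases h3 : j = l
    · simp only [h3, if_true] at hcj ⊢
      split_ifs <;> linarith
    have := hb j l (Ne.symm h1) (Ne.symm h2) h3
    simp only [h1, h2, h3, if_false]
    linarith
  have hsum : |∑ j, ∑ l, a m j l| ≤ ((m : ℝ) + 1) ^ 2 * (ε / 2) + 3 * C * (m + 1) := by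
    calc |∑ j, ∑ l, a m j l| ≤ ∑ j, ∑ l, |a m j l| :=
          (Finset.abs_sum_le_sum_abs _ _).trans
            (Finset.sum_le_sum fun j _ => Finset.abs_sum_le_sum_abs _ _)
      _ ≤ ∑ j, ∑ l, (ε / 2 + ((if j = i m then C else 0) +
            (if l = i m then C else 0) + if j = l then C else 0)) :=
          Finset.sum_le_sum fun j _ => Finset.sum_le_sum fun l _ => hterm j l
      _ = _ := by
          simp only [Finset.sum_add_distrib, Finset.sum_const, Finset.card_univ, Fintype.card_fin,
            nsmul_eq_mul, Finset.sum_ite_eq, Finset.sum_ite_eq', Finset.mem_univ, if_true,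
            Finset.sum_const, Nat.cast_add, Nat.cast_one]
          rw [← Finset.mul_sum, Finset.sum_ite_eq']
          simp only [Finset.mem_univ, if_true]
          ring
  have hpos : (0 : ℝ) < (m : ℝ) + 1 := by positivity
  rw [Real.dist_eq, sub_zero, Function.comp_apply, abs_abs, abs_mul, abs_of_pos (by positivity), inv_mul_lt_iff₀
    (by positivity)]
  refine hsum.trans_lt ?_
  rw [div_lt_iff₀ (by positivity)] at hm'
  nlinarith

/-! ### Integrals over independent factors and partial integrals -/

theorem integral_indep_prod {Ω X Y : Type*} [MeasurableSpace Ω] [MeasurableSpace X]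
    [MeasurableSpace Y] {P : Measure Ω} [IsProbabilityMeasure P] {W : Ω → X} {ξ : Ω → Y}
    (hW : Measurable W) (hξ : Measurable ξ) (hind : IndepFun W ξ P) {F : X × Y → ℝ}
    (hF : Measurable F) {M : ℝ} (hM : ∀ p, |F p| ≤ M) :
    ∫ ω, F (W ω, ξ ω) ∂P = ∫ ω, ∫ y, F (W ω, y) ∂(P.map ξ) ∂P := by
  have := Measure.isProbabilityMeasure_map hW.aemeasurable (μ := P)
  have := Measure.isProbabilityMeasure_map hξ.aemeasurable (μ := P)
  have h1 := (indepFun_iff_map_prod_eq_prod_map_map hW.aemeasurable hξ.aemeasurable).1 hind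
  have h2 : ∫ ω, F (W ω, ξ ω) ∂P = ∫ p, F p ∂(P.map fun ω => (W ω, ξ ω)) :=
    (integral_map (hW.prodMk hξ).aemeasurable hF.aestronglyMeasurable).symm
  rw [h2, h1, integral_prod _ (Integrable.of_bound hF.aestronglyMeasurable M
    (ae_of_all _ fun p => by simpa using hM p)), integral_map hW.aemeasurable]
  exact (StronglyMeasurable.integral_prod_right' hF.stronglyMeasurable).aestronglyMeasurable

/-- By Fubini, for almost every x the integrand is continuous at (x, y) for almost every y;
dominated convergence then moves the limit inside. This keeps almost everywhere continuity stable
under partial integration. -/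
theorem ae_continuousAt_integral {X Y H : Type*} [TopologicalSpace X] [TopologicalSpace Y]
    [FirstCountableTopology X]
    [MeasurableSpace X] [MeasurableSpace Y] [NormedAddCommGroup H] [NormedSpace ℝ H]
    [MeasurableSpace H] [BorelSpace H] [SecondCountableTopology H]
    {μ : Measure X} {ν : Measure Y} [SFinite μ] [SFinite ν] {F : X → Y → H}
    (hF : Measurable (Function.uncurry F)) {b : Y → ℝ} (hb : Integrable b ν)
    (hFb : ∀ x y, ‖F x y‖ ≤ b y)
    (hFc : ∀ᵐ p ∂(μ.prod ν), ContinuousAt (Function.uncurry F) p) :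
    ∀ᵐ x ∂μ, ContinuousAt (fun x => ∫ y, F x y ∂ν) x := by
  filter_upwards [Measure.ae_ae_of_ae_prod hFc] with x hx
  refine continuousAt_of_dominated (Eventually.of_forall fun x' => ?_)
    (Eventually.of_forall fun x' => ae_of_all _ fun y => hFb x' y) hb ?_
  · exact (hF.comp measurable_prodMk_left).aestronglyMeasurable
  · filter_upwards [hx] with y hy
    exact ContinuousAt.comp (f := fun x' => (x', y)) (x := x) hy
      (continuousAt_id.prodMk continuousAt_const)

theorem measurable_integral_left {X Y H : Type*} [MeasurableSpace X] [MeasurableSpace Y]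
    [NormedAddCommGroup H] [NormedSpace ℝ H]
    [MeasurableSpace H] [BorelSpace H] [SecondCountableTopology H] {ν : Measure Y} [SFinite ν]
    {F : X → Y → H} (hF : Measurable (Function.uncurry F)) :
    Measurable fun x => ∫ y, F x y ∂ν :=
  (hF.stronglyMeasurable.integral_prod_right).measurable

/-! ### The law of an edge path given the trajectories of its end points -/

/-- The Bernoulli weight of `b`. -/
def ber (p : ℝ) (b : Bool) : ℝ := if b then p else 1 - p

theorem ber_mem {p : ℝ} (hp : p ∈ Set.Icc (0 : ℝ) 1) (b : Bool) : ber p b ∈ Set.Icc (0 : ℝ) 1 := by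
  cases b <;> simp_all [ber]

theorem continuous_ber (b : Bool) : Continuous fun p => ber p b := by
  cases b <;> simp only [ber, if_true, if_false, Bool.false_eq_true] <;> fun_prop

theorem sum_ber (p : ℝ) : ∑ b, ber p b = 1 := by simp [ber]

theorem sum_snoc {X M : Type*} [Fintype X] [DecidableEq X] [AddCommMonoid M] (t : ℕ)
    (F : Traj X (t + 1) → M) :
    ∑ a, F a = ∑ a : Traj X t, ∑ b, F (Fin.snoc (α := fun _ => X) a b) := by
  rw [← Fintype.sum_equiv (Fin.snocEquiv fun _ : Fin (t + 2) => X)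
    (fun p => F (Fin.snoc (α := fun _ => X) p.2 p.1)) F (fun p => rfl), Fintype.sum_prod_type,
    Finset.sum_comm]

section EdgeLaw

variable {d : ℕ} {B₀ : Opinion d → Opinion d → ℝ} {B : Bool → Opinion d → Opinion d → ℝ}

/-- The probability of the edge path `a` between two agents with trajectories `z` and `z'`. -/
def edgeLaw (B₀ : Opinion d → Opinion d → ℝ) (B : Bool → Opinion d → Opinion d → ℝ) :
    (t : ℕ) → Traj (Opinion d) t → Traj (Opinion d) t → Traj Bool t → ℝ
  | 0, z, z', a => ber (B₀ (z 0) (z' 0)) (a 0)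
  | t + 1, z, z', a =>
      edgeLaw B₀ B t (fun r => z r.castSucc) (fun r => z' r.castSucc) (fun r => a r.castSucc) *
        ber (B (a (Fin.last t).castSucc) (z (Fin.last (t + 1))) (z' (Fin.last (t + 1))))
          (a (Fin.last (t + 1)))

theorem edgeLaw_mem (hB : IsInteraction B₀ B) (t : ℕ) (z z' : Traj (Opinion d) t)
    (a : Traj Bool t) : edgeLaw B₀ B t z z' a ∈ Set.Icc (0 : ℝ) 1 := by
  induction t with
  | zero => exact ber_mem (hB.init_mem _ _) _
  | succ t ih =>
    have h1 := ih (fun r => z r.castSucc) (fun r => z' r.castSucc) (fun r => a r.castSucc)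
    have h2 := ber_mem (hB.mem (a (Fin.last t).castSucc) (z (Fin.last (t + 1)))
      (z' (Fin.last (t + 1)))) (a (Fin.last (t + 1)))
    exact ⟨mul_nonneg h1.1 h2.1, mul_le_one₀ h1.2 h2.1 h2.2⟩

theorem edgeLaw_snoc (t : ℕ) (z z' : Traj (Opinion d) (t + 1)) (a : Traj Bool t) (b : Bool) :
    edgeLaw B₀ B (t + 1) z z' (Fin.snoc (α := fun _ => Bool) a b) =
      edgeLaw B₀ B t (fun r => z r.castSucc) (fun r => z' r.castSucc) a *
        ber (B (a (Fin.last t)) (z (Fin.last (t + 1))) (z' (Fin.last (t + 1)))) b := by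
  simp only [edgeLaw, Fin.snoc_castSucc, Fin.snoc_last]

theorem sum_edgeLaw (t : ℕ) (z z' : Traj (Opinion d) t) :
    ∑ a, edgeLaw B₀ B t z z' a = 1 := by
  induction t with
  | zero =>
    rw [← (Equiv.funUnique (Fin 1) Bool).symm.sum_comp]
    exact sum_ber _
  | succ t ih =>
    rw [sum_snoc]
    simp only [edgeLaw_snoc, ← Finset.mul_sum, sum_ber, mul_one, ih]

/-- The link function is the marginal of the edge path law at its last time. The two recursions
agree because a function of a Boolean is affine in its indicator, so averaging `B` over the previous
edge gives exactly `mixedProb`. -/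
theorem sum_edgeVal_mul_edgeLaw (t : ℕ) (z z' : Traj (Opinion d) t) :
    ∑ a, edgeVal (a (Fin.last t)) * edgeLaw B₀ B t z z' a = linkFn B₀ B t z z' := by
  induction t with
  | zero =>
    rw [← (Equiv.funUnique (Fin 1) Bool).symm.sum_comp]
    simp [edgeVal, edgeLaw, ber, linkFn]
  | succ t ih =>
    rw [sum_snoc, linkFn, ← ih, mixedProb]
    have h1 := sum_edgeLaw (B₀ := B₀) (B := B) t (fun r => z r.castSucc) (fun r => z' r.castSucc)
    have h2 : ∀ a : Traj Bool t,
        B (a (Fin.last t)) (z (Fin.last (t + 1))) (z' (Fin.last (t + 1))) =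
        edgeVal (a (Fin.last t)) * B true (z (Fin.last (t + 1))) (z' (Fin.last (t + 1))) +
        (1 - edgeVal (a (Fin.last t))) *
          B false (z (Fin.last (t + 1))) (z' (Fin.last (t + 1))) := by
      intro a
      cases a (Fin.last t) <;> simp [edgeVal]
    have h3 : 1 - ∑ a : Traj Bool t, edgeVal (a (Fin.last t)) *
        edgeLaw B₀ B t (fun r => z r.castSucc) (fun r => z' r.castSucc) a =
        ∑ a : Traj Bool t, (1 - edgeVal (a (Fin.last t))) *
        edgeLaw B₀ B t (fun r => z r.castSucc) (fun r => z' r.castSucc) a := by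
      simp only [sub_mul, one_mul, Finset.sum_sub_distrib, h1]
    rw [h3, Finset.sum_mul, Finset.sum_mul, ← Finset.sum_add_distrib]
    refine Finset.sum_congr rfl fun a _ => ?_
    simp only [edgeLaw_snoc, Fin.snoc_last, Fintype.sum_bool]
    have e1 : edgeVal true = 1 := rfl
    have e0 : edgeVal false = 0 := rfl
    rw [e1, e0, one_mul, zero_mul, add_zero, h2 a]
    simp only [ber, if_true]
    ring

theorem linkFn_mem (hB : IsInteraction B₀ B) (t : ℕ) (z z' : Traj (Opinion d) t) :
    linkFn B₀ B t z z' ∈ Set.Icc (0 : ℝ) 1 := by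
  have h0 : ∀ a : Traj Bool t, 0 ≤ edgeVal (a (Fin.last t)) ∧ edgeVal (a (Fin.last t)) ≤ 1 := by
    intro a; cases a (Fin.last t) <;> simp [edgeVal]
  rw [← sum_edgeVal_mul_edgeLaw]
  refine ⟨Finset.sum_nonneg fun a _ => mul_nonneg (h0 a).1 (edgeLaw_mem hB _ _ _ _).1, ?_⟩
  rw [← sum_edgeLaw (B₀ := B₀) (B := B) t z z']
  exact Finset.sum_le_sum fun a _ => mul_le_of_le_one_left (edgeLaw_mem hB _ _ _ _).1 (h0 a).2

theorem measurable_edgeLaw (hB : IsInteraction B₀ B) (t : ℕ) (a : Traj Bool t) :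
    Measurable fun p : Traj (Opinion d) t × Traj (Opinion d) t =>
      edgeLaw B₀ B t p.1 p.2 a := by
  induction t with
  | zero =>
    have h := hB.init_measurable.comp (by fun_prop : Measurable fun p :
      Traj (Opinion d) 0 × Traj (Opinion d) 0 => (p.1 0, p.2 0))
    exact (continuous_ber _).measurable.comp h
  | succ t ih =>
    refine ((ih fun r => a r.castSucc).comp (g := fun p :
      Traj (Opinion d) t × Traj (Opinion d) t => edgeLaw B₀ B t p.1 p.2 _)
      (f := fun p : Traj (Opinion d) (t + 1) × Traj (Opinion d) (t + 1) =>
        ((fun r => p.1 r.castSucc : Traj (Opinion d) t),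
          (fun r => p.2 r.castSucc : Traj (Opinion d) t))) (by fun_prop)).mul ?_
    have h := (hB.measurable (a (Fin.last t).castSucc)).comp (by fun_prop : Measurable fun p :
      Traj (Opinion d) (t + 1) × Traj (Opinion d) (t + 1) =>
        (p.1 (Fin.last (t + 1)), p.2 (Fin.last (t + 1))))
    exact (continuous_ber _).measurable.comp h

theorem measurable_linkFn (hB : IsInteraction B₀ B) (t : ℕ) :
    Measurable fun p : Traj (Opinion d) t × Traj (Opinion d) t => linkFn B₀ B t p.1 p.2 := by
  simp only [← sum_edgeVal_mul_edgeLaw]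
  exact Finset.measurable_sum _ fun a _ => (measurable_edgeLaw hB t a).const_mul _

theorem measurable_limitMean (hB : IsInteraction B₀ B) (t : ℕ)
    (μ : Measure (Traj (Opinion d) t)) [SFinite μ] : Measurable (limitMean B₀ B t μ) := by
  refine (measurable_integral_left (measurable_linkFn hB t)).inv.smul
    (measurable_integral_left
      (F := fun z z' : Traj (Opinion d) t => linkFn B₀ B t z z' • z' (Fin.last t)) ?_)
  exact (measurable_linkFn hB t).smul ((measurable_pi_apply (Fin.last t)).comp measurable_snd)

/-! ### The law of the limiting trajectory -/

/-- One step of the limiting dynamics, with trajectory law `μ`. -/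
noncomputable def limStep (γ : ℝ) (B₀ : Opinion d → Opinion d → ℝ)
    (B : Bool → Opinion d → Opinion d → ℝ) (t : ℕ) (μ : Measure (Traj (Opinion d) t))
    (p : Traj (Opinion d) t × Opinion d) : Traj (Opinion d) (t + 1) :=
  Fin.snoc (α := fun _ => Opinion d) p.1
    ((1 - γ) • p.1 (Fin.last t) + γ • limitMean B₀ B t μ p.1 + p.2)

/-- The law of the limiting trajectory up to time `t`. -/
noncomputable def limLaw (γ : ℝ) (B₀ : Opinion d → Opinion d → ℝ)
    (B : Bool → Opinion d → Opinion d → ℝ) (μ₀ ν : Measure (Opinion d)) :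
    (t : ℕ) → Measure (Traj (Opinion d) t)
  | 0 => μ₀.map fun x _ => x
  | t + 1 => ((limLaw γ B₀ B μ₀ ν t).prod ν).map
      (limStep γ B₀ B t (limLaw γ B₀ B μ₀ ν t))

theorem measurable_snoc {X : Type*} [MeasurableSpace X] (t : ℕ) :
    Measurable fun p : Traj X t × X => (Fin.snoc (α := fun _ => X) p.1 p.2 : Traj X (t + 1)) := by
  refine measurable_pi_lambda _ fun i => ?_
  refine Fin.lastCases ?_ (fun j => ?_) i
  · simpa only [Fin.snoc_last] using measurable_snd
  · simp only [Fin.snoc_castSucc]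
    exact (measurable_pi_apply j).comp measurable_fst

theorem measurable_limStep (γ : ℝ) (hB : IsInteraction B₀ B) (t : ℕ)
    (μ : Measure (Traj (Opinion d) t)) [SFinite μ] : Measurable (limStep γ B₀ B t μ) := by
  refine (measurable_snoc t).comp (measurable_fst.prodMk ?_)
  have h := measurable_limitMean hB t μ
  fun_prop

variable {γ : ℝ} {μ₀ ν : Measure (Opinion d)} [IsProbabilityMeasure μ₀] [IsProbabilityMeasure ν]

theorem isProbabilityMeasure_limLaw (hB : IsInteraction B₀ B) (t : ℕ) :
    IsProbabilityMeasure (limLaw γ B₀ B μ₀ ν t) := by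
  induction t with
  | zero => exact Measure.isProbabilityMeasure_map (by fun_prop)
  | succ t ih => exact Measure.isProbabilityMeasure_map (measurable_limStep γ hB t _).aemeasurable

/-- Consistency of the laws in time: a step only appends a coordinate. It carries null sets at time
t over to time t + 1. -/
theorem measurePreserving_init (hB : IsInteraction B₀ B) (t : ℕ) :
    MeasurePreserving (fun (z : Traj (Opinion d) (t + 1)) (r : Fin (t + 1)) => z r.castSucc)
      (limLaw γ B₀ B μ₀ ν (t + 1)) (limLaw γ B₀ B μ₀ ν t) := by
  have := isProbabilityMeasure_limLaw (γ := γ) (μ₀ := μ₀) (ν := ν) hB t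
  refine ⟨by fun_prop, ?_⟩
  rw [limLaw, Measure.map_map (by fun_prop) (measurable_limStep γ hB t _)]
  convert! (measurePreserving_fst (μ := limLaw γ B₀ B μ₀ ν t) (ν := ν)).map_eq using 2
  ext p : 1
  exact Fin.init_snoc (α := fun _ => Opinion d) _ _

/-- Given the past, the new opinion is a translate of the noise, and Lebesgue measure is translation
invariant. -/
theorem map_last_limLaw_ac (hB : IsInteraction B₀ B) (hμ₀ : μ₀ ≪ volume) (hν : ν ≪ volume)
    (t : ℕ) : (limLaw γ B₀ B μ₀ ν t).map (fun z => z (Fin.last t)) ≪ volume := by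
  cases t with
  | zero =>
    rw [limLaw, Measure.map_map (by fun_prop) (by fun_prop)]
    simpa [Function.comp_def] using hμ₀
  | succ t =>
    have := isProbabilityMeasure_limLaw (γ := γ) (μ₀ := μ₀) (ν := ν) hB t
    rw [limLaw, Measure.map_map (by fun_prop) (measurable_limStep γ hB t _)]
    have hm := measurable_limitMean hB t (limLaw γ B₀ B μ₀ ν t)
    have hfun : (fun z : Traj (Opinion d) (t + 1) => z (Fin.last (t + 1))) ∘
        limStep γ B₀ B t (limLaw γ B₀ B μ₀ ν t) = fun p =>
        (1 - γ) • p.1 (Fin.last t) + γ • limitMean B₀ B t (limLaw γ B₀ B μ₀ ν t) p.1 + p.2 := by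
      ext1 p
      simp [limStep, Fin.snoc_last]
    rw [hfun]
    refine Measure.AbsolutelyContinuous.mk fun s hs h0 => ?_
    rw [Measure.map_apply (by fun_prop) hs, Measure.prod_apply (by
      exact (by fun_prop : Measurable fun p : Traj (Opinion d) t × Opinion d =>
        (1 - γ) • p.1 (Fin.last t) + γ • limitMean B₀ B t (limLaw γ B₀ B μ₀ ν t) p.1 + p.2) hs)]
    refine lintegral_eq_zero_of_ae_eq_zero (ae_of_all _ fun z => hν ?_)
    have := measure_preimage_add (volume : Measure (Opinion d))
      ((1 - γ) • z (Fin.last t) + γ • limitMean B₀ B t (limLaw γ B₀ B μ₀ ν t) z) s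
    rw [h0] at this
    exact this

/-- Two independent limiting opinions do not charge Lebesgue null sets of pairs, in particular not
the discontinuities of the interaction. -/
theorem quasiMeasurePreserving_last_pair (hB : IsInteraction B₀ B) (hμ₀ : μ₀ ≪ volume)
    (hν : ν ≪ volume) (t : ℕ) :
    Measure.QuasiMeasurePreserving
      (fun p : Traj (Opinion d) t × Traj (Opinion d) t => (p.1 (Fin.last t), p.2 (Fin.last t)))
      ((limLaw γ B₀ B μ₀ ν t).prod (limLaw γ B₀ B μ₀ ν t)) volume := by
  have := isProbabilityMeasure_limLaw (γ := γ) (μ₀ := μ₀) (ν := ν) hB t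
  have h : Measure.QuasiMeasurePreserving (fun z : Traj (Opinion d) t => z (Fin.last t))
      (limLaw γ B₀ B μ₀ ν t) volume := ⟨by fun_prop, map_last_limLaw_ac hB hμ₀ hν t⟩
  refine ⟨by fun_prop, ?_⟩
  have hm := Measure.map_prod_map (limLaw γ B₀ B μ₀ ν t) (limLaw γ B₀ B μ₀ ν t)
    h.measurable h.measurable
  change Measure.map (Prod.map (fun z : Traj (Opinion d) t => z (Fin.last t))
    (fun z : Traj (Opinion d) t => z (Fin.last t))) _ ≪ _
  rw [← hm]
  exact h.absolutelyContinuous.prod h.absolutelyContinuous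

theorem ae_continuousAt_B (hB : IsInteraction B₀ B) (hμ₀ : μ₀ ≪ volume) (hν : ν ≪ volume) (t : ℕ)
    (a : Bool) : ∀ᵐ p ∂(limLaw γ B₀ B μ₀ ν t).prod (limLaw γ B₀ B μ₀ ν t),
      ContinuousAt (fun q : Opinion d × Opinion d => B a q.1 q.2)
        (p.1 (Fin.last t), p.2 (Fin.last t)) :=
  (quasiMeasurePreserving_last_pair hB hμ₀ hν t).ae (hB.continuous a)

theorem ae_continuousAt_edgeLaw (hB : IsInteraction B₀ B) (hμ₀ : μ₀ ≪ volume) (hν : ν ≪ volume)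
    (t : ℕ) (a : Traj Bool t) : ∀ᵐ p ∂(limLaw γ B₀ B μ₀ ν t).prod (limLaw γ B₀ B μ₀ ν t),
      ContinuousAt (fun q : Traj (Opinion d) t × Traj (Opinion d) t =>
        edgeLaw B₀ B t q.1 q.2 a) p := by
  induction t with
  | zero =>
    filter_upwards [(quasiMeasurePreserving_last_pair hB hμ₀ hν 0).ae hB.init_continuous] with p hp
    exact (continuous_ber _).continuousAt.comp (ContinuousAt.comp (f := fun q :
      Traj (Opinion d) 0 × Traj (Opinion d) 0 => (q.1 0, q.2 0)) (x := p) hp (by fun_prop))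
  | succ t ih =>
    have := isProbabilityMeasure_limLaw (γ := γ) (μ₀ := μ₀) (ν := ν) hB t
    have := isProbabilityMeasure_limLaw (γ := γ) (μ₀ := μ₀) (ν := ν) hB (t + 1)
    have hmp := measurePreserving_init (γ := γ) (μ₀ := μ₀) (ν := ν) hB t
    filter_upwards [ae_continuousAt_B hB hμ₀ hν (t + 1) (a (Fin.last t).castSucc),
      (hmp.prod hmp).quasiMeasurePreserving.ae (ih fun r => a r.castSucc)] with p h1 h2
    refine ContinuousAt.mul (ContinuousAt.comp (f := fun q :
      Traj (Opinion d) (t + 1) × Traj (Opinion d) (t + 1) =>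
        ((fun r => q.1 r.castSucc : Traj (Opinion d) t),
          (fun r => q.2 r.castSucc : Traj (Opinion d) t))) (x := p) h2 (by fun_prop)) ?_
    exact (continuous_ber _).continuousAt.comp (ContinuousAt.comp (f := fun q :
      Traj (Opinion d) (t + 1) × Traj (Opinion d) (t + 1) =>
        (q.1 (Fin.last (t + 1)), q.2 (Fin.last (t + 1)))) (x := p) h1 (by fun_prop))

/-! ### Independent copies -/

theorem measurePreserving_eval_pair {X : Type*} [MeasurableSpace X] {κ : Type*} [Fintype κ]
    (μ : Measure X) [IsProbabilityMeasure μ] {i j : κ} (hij : i ≠ j) :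
    MeasurePreserving (fun z : κ → X => (z i, z j)) (Measure.pi fun _ => μ) (μ.prod μ) := by
  refine ⟨by fun_prop, ?_⟩
  have h := (iIndepFun_pi (μ := fun _ : κ => μ) (X := fun _ x => x)
    (fun _ => aemeasurable_id)).indepFun hij
  rw [(indepFun_iff_map_prod_eq_prod_map_map (measurable_pi_apply i).aemeasurable
    (measurable_pi_apply j).aemeasurable).1 h]
  congr 1
  · exact (measurePreserving_eval (fun _ : κ => μ) i).map_eq
  · exact (measurePreserving_eval (fun _ : κ => μ) j).map_eq

/-- Stepping k independent copies is one joint step with product noise: regroup a product of pairs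
as a pair of products. -/
theorem pi_limLaw_succ (hB : IsInteraction B₀ B) (t k : ℕ) :
    Measure.pi (fun _ : Fin k => limLaw γ B₀ B μ₀ ν (t + 1)) =
      ((Measure.pi fun _ : Fin k => limLaw γ B₀ B μ₀ ν t).prod (Measure.pi fun _ => ν)).map
        (fun p i => limStep γ B₀ B t (limLaw γ B₀ B μ₀ ν t) (p.1 i, p.2 i)) := by
  have := isProbabilityMeasure_limLaw (γ := γ) (μ₀ := μ₀) (ν := ν) hB t
  have := isProbabilityMeasure_limLaw (γ := γ) (μ₀ := μ₀) (ν := ν) hB (t + 1)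
  have hs := measurable_limStep γ hB t (limLaw γ B₀ B μ₀ ν t)
  have h1 := (measurePreserving_arrowProdEquivProdArrow (Traj (Opinion d) t) (Opinion d) (Fin k)
    (fun _ => limLaw γ B₀ B μ₀ ν t) (fun _ => ν)).map_eq
  rw [← h1, Measure.map_map (by fun_prop) (by fun_prop)]
  have h2 := Measure.pi_map_pi (μ := fun _ : Fin k => (limLaw γ B₀ B μ₀ ν t).prod ν)
    (f := fun _ => limStep γ B₀ B t (limLaw γ B₀ B μ₀ ν t))
    (hμ := fun _ => (inferInstance : SigmaFinite (limLaw γ B₀ B μ₀ ν (t + 1))))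
    (fun _ => hs.aemeasurable)
  rw [limLaw, ← h2]
  rfl

end EdgeLaw

/-! ### Edges given the past -/

/-- The pairs `{p e, q e}` are proper and pairwise distinct. -/
structure IsSimpleFamily {κ ι : Type*} (p q : κ → ι) : Prop where
  ne : ∀ e, p e ≠ q e
  straight : ∀ e e', e ≠ e' → ¬(p e = p e' ∧ q e = q e')
  crossed : ∀ e e', e ≠ e' → ¬(p e = q e' ∧ q e = p e')

theorem IsSimpleFamily.comp_injective {κ ι ι' : Type*} {p q : κ → ι} (h : IsSimpleFamily p q)
    {J : ι → ι'} (hJ : Function.Injective J) : IsSimpleFamily (J ∘ p) (J ∘ q) where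
  ne e he := h.ne e (hJ he)
  straight e e' hne he := h.straight e e' hne ⟨hJ he.1, hJ he.2⟩
  crossed e e' hne he := h.crossed e e' hne ⟨hJ he.1, hJ he.2⟩

/-- The indicator of `a = b`. -/
def same {X : Type*} [DecidableEq X] (a b : X) : ℝ := if a = b then 1 else 0

theorem same_mem {X : Type*} [DecidableEq X] (a b : X) : same a b ∈ Set.Icc (0 : ℝ) 1 := by
  unfold same; split_ifs <;> simp

theorem prod_mem_Icc {κ : Type*} [Fintype κ] {f : κ → ℝ} (h : ∀ e, f e ∈ Set.Icc (0 : ℝ) 1) :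
    ∏ e, f e ∈ Set.Icc (0 : ℝ) 1 :=
  ⟨Finset.prod_nonneg fun e _ => (h e).1,
    Finset.prod_le_one (fun e _ => (h e).1) fun e _ => (h e).2⟩

theorem abs_mul_le_of_mem_Icc {a b c : ℝ} (ha : |a| ≤ c) (hb : b ∈ Set.Icc (0 : ℝ) 1) :
    |a * b| ≤ c := by
  rw [abs_mul, abs_of_nonneg hb.1]
  nlinarith [abs_nonneg a, hb.1, hb.2]

theorem measurable_same {Ω X : Type*} {m : MeasurableSpace Ω} [DecidableEq X] [MeasurableSpace X]
    [MeasurableSingletonClass X] {f : Ω → X} (hf : Measurable f) (a : X) :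
    Measurable fun ω => same (f ω) a :=
  Measurable.ite (hf (measurableSet_singleton a)) measurable_const measurable_const

section Network

variable {Ω ι : Type*} {d : ℕ}
  {B₀ : Opinion d → Opinion d → ℝ} {B : Bool → Opinion d → Opinion d → ℝ}
  {Z : ι → ℕ → Ω → Opinion d} {A : ι → ι → ℕ → Ω → Bool}

theorem measurable_nodeHistory (Z : ι → ℕ → Ω → Opinion d) {s t : ℕ} (h : s ≤ t) (i : ι) :
    Measurable[nodeHistory Z t] (Z i s) :=
  Measurable.mono (comap_measurable (Z i s))
    (le_iSup_of_le i (le_iSup_of_le s (le_iSup_of_le h le_rfl))) le_rfl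

theorem measurable_edgeHistory (A : ι → ι → ℕ → Ω → Bool) {s t : ℕ} (h : s < t) (i j : ι) :
    Measurable[edgeHistory A t] (A i j s) :=
  Measurable.mono (comap_measurable (A i j s))
    (le_iSup_of_le i (le_iSup_of_le j (le_iSup_of_le s (le_iSup_of_le h le_rfl)))) le_rfl

theorem measurable_pre_node (Z : ι → ℕ → Ω → Opinion d) (A : ι → ι → ℕ → Ω → Bool) {s t : ℕ}
    (h : s ≤ t) (i : ι) : Measurable[preEdgeHistory Z A t] (Z i s) :=
  (measurable_nodeHistory Z h i).mono le_sup_left le_rfl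

theorem measurable_pre_edge (Z : ι → ℕ → Ω → Opinion d) (A : ι → ι → ℕ → Ω → Bool) {s t : ℕ}
    (h : s < t) (i j : ι) : Measurable[preEdgeHistory Z A t] (A i j s) :=
  (measurable_edgeHistory A h i j).mono le_sup_right le_rfl

theorem measurable_pre_traj (Z : ι → ℕ → Ω → Opinion d) (A : ι → ι → ℕ → Ω → Bool) (t : ℕ)
    (i : ι) : Measurable[preEdgeHistory Z A t] (traj (Z i) t) := by
  let _ : MeasurableSpace Ω := preEdgeHistory Z A t
  exact measurable_pi_lambda _ fun s => measurable_pre_node Z A (Nat.lt_succ_iff.1 s.2) i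

theorem measurable_pre_edgeTraj (Z : ι → ℕ → Ω → Opinion d) (A : ι → ι → ℕ → Ω → Bool) (t : ℕ)
    (i j : ι) : Measurable[preEdgeHistory Z A (t + 1)] (traj (A i j) t) := by
  let _ : MeasurableSpace Ω := preEdgeHistory Z A (t + 1)
  exact measurable_pi_lambda _ fun s => measurable_pre_edge Z A s.2 i j

theorem measurable_full_traj (Z : ι → ℕ → Ω → Opinion d) (A : ι → ι → ℕ → Ω → Bool) (t : ℕ)
    (i : ι) : Measurable[fullHistory Z A t] (traj (Z i) t) := by
  let _ : MeasurableSpace Ω := fullHistory Z A t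
  exact measurable_pi_lambda _ fun s =>
    (measurable_nodeHistory Z (Nat.lt_succ_iff.1 s.2) i).mono le_sup_left le_rfl

theorem measurable_full_edgeTraj (Z : ι → ℕ → Ω → Opinion d) (A : ι → ι → ℕ → Ω → Bool) (t : ℕ)
    (i j : ι) : Measurable[fullHistory Z A t] (traj (A i j) t) := by
  let _ : MeasurableSpace Ω := fullHistory Z A t
  exact measurable_pi_lambda _ fun s => (measurable_edgeHistory A s.2 i j).mono le_sup_right le_rfl

theorem edgeProb_mem (hB : IsInteraction B₀ B) (i j : ι) (t : ℕ) (ω : Ω) :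
    edgeProb B₀ B Z A i j t ω ∈ Set.Icc (0 : ℝ) 1 := by
  cases t with
  | zero => exact hB.init_mem _ _
  | succ t => exact hB.mem _ _ _

theorem measurable_edgeProb (hB : IsInteraction B₀ B) (i j : ι) (t : ℕ) :
    Measurable[preEdgeHistory Z A t] (edgeProb B₀ B Z A i j t) := by
  let _ : MeasurableSpace Ω := preEdgeHistory Z A t
  cases t with
  | zero =>
    exact hB.init_measurable.comp ((measurable_pre_node Z A le_rfl i).prodMk
      (measurable_pre_node Z A le_rfl j))
  | succ t =>
    have hall : Measurable fun p : Bool × Opinion d × Opinion d => B p.1 p.2.1 p.2.2 :=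
      measurable_from_prod_countable_right fun a => hB.measurable a
    exact hall.comp ((measurable_pre_edge Z A (Nat.lt_succ_self t) i j).prodMk
      ((measurable_pre_node Z A le_rfl i).prodMk (measurable_pre_node Z A le_rfl j)))

variable [MeasurableSpace Ω]

theorem nodeHistory_le (hZ : ∀ i t, Measurable (Z i t)) (t : ℕ) :
    nodeHistory Z t ≤ (inferInstance : MeasurableSpace Ω) :=
  iSup_le fun i => iSup_le fun s => iSup_le fun _ => (hZ i s).comap_le

theorem edgeHistory_le (hA : ∀ i j t, Measurable (A i j t)) (t : ℕ) :
    edgeHistory A t ≤ (inferInstance : MeasurableSpace Ω) :=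
  iSup_le fun i => iSup_le fun j => iSup_le fun s => iSup_le fun _ => (hA i j s).comap_le

theorem preEdgeHistory_le (hZ : ∀ i t, Measurable (Z i t)) (hA : ∀ i j t, Measurable (A i j t))
    (t : ℕ) : preEdgeHistory Z A t ≤ (inferInstance : MeasurableSpace Ω) :=
  sup_le (nodeHistory_le hZ t) (edgeHistory_le hA t)

variable {P : Measure Ω} [IsProbabilityMeasure P] [LinearOrder ι]

theorem condExp_edge (hN : IsNetwork P B₀ B Z A) (hZ : ∀ i t, Measurable (Z i t)) {i j : ι}
    (hij : i ≠ j) (t : ℕ) (b : Bool) :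
    P⟦A i j t ⁻¹' {b} | preEdgeHistory Z A t⟧ =ᵐ[P]
      fun ω => ber (edgeProb B₀ B Z A i j t ω) b := by
  have htrue := hN.prob i j hij t
  cases b with
  | true => simpa [ber] using htrue
  | false =>
    have hm : MeasurableSet (A i j t ⁻¹' {true}) := hN.measurable i j t (measurableSet_singleton _)
    have h1 : (A i j t ⁻¹' {false}).indicator (fun _ => (1 : ℝ)) =
        (fun _ => (1 : ℝ)) - (A i j t ⁻¹' {true}).indicator (fun _ => (1 : ℝ)) := by
      ext ω
      cases h : A i j t ω <;> simp [Set.indicator, h]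
    have h2 := condExp_sub (μ := P) (integrable_const (1 : ℝ))
      ((integrable_const (1 : ℝ)).indicator hm) (preEdgeHistory Z A t)
    rw [h1]
    filter_upwards [h2, htrue] with ω h2 h3
    rw [h2, Pi.sub_apply, h3, condExp_const (preEdgeHistory_le hZ hN.measurable t)]
    simp [ber]

/-- This is the only place where mutual conditional independence of the edges is used. It is given
for ordered pairs i < j. A simple family of edges is oriented into such pairs without collisions,
the conditional probability of the joint event factorises, and `F`, being known before the edges are
drawn, is pulled out of the conditional expectation. -/
theorem integral_mul_prod_edge (hN : IsNetwork P B₀ B Z A) (hZ : ∀ i t, Measurable (Z i t))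
    {κ : Type*} [Fintype κ] {p q : κ → ι} (hpq : IsSimpleFamily p q) (u : κ → Bool) (t : ℕ)
    {F : Ω → ℝ} (hF : Measurable[preEdgeHistory Z A t] F) {M : ℝ} (hM : ∀ ω, |F ω| ≤ M) :
    ∫ ω, F ω * ∏ e, same (A (p e) (q e) t ω) (u e) ∂P =
      ∫ ω, F ω * ∏ e, ber (edgeProb B₀ B Z A (p e) (q e) t ω) (u e) ∂P := by
  classical
  have hle := preEdgeHistory_le hZ hN.measurable t
  -- Orient every edge increasingly; symmetry of the matrix makes the orientation immaterial almost
  -- surely.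
  have hs : ∀ e, ∃ x : {x : ι × ι // x.1 < x.2},
      (x.1 = (p e, q e) ∨ x.1 = (q e, p e)) := by
    intro e
    rcases lt_or_gt_of_ne (hpq.ne e) with h | h
    · exact ⟨⟨(p e, q e), h⟩, Or.inl rfl⟩
    · exact ⟨⟨(q e, p e), h⟩, Or.inr rfl⟩
  choose s hs using hs
  have hinj : Function.Injective s := by
    intro e e' hee
    by_contra hne
    have h1 := hs e
    have h2 := hs e'
    rw [hee] at h1
    rcases h1 with h1 | h1 <;> rcases h2 with h2 | h2 <;>
      simp only [h1, Prod.mk.injEq] at h2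
    · exact hpq.straight e e' hne h2
    · exact hpq.crossed e e' hne h2
    · exact hpq.crossed e e' hne ⟨h2.2, h2.1⟩
    · exact hpq.straight e e' hne ⟨h2.2, h2.1⟩
  have hsA : ∀ e, ∀ᵐ ω ∂P, A (s e).1.1 (s e).1.2 t ω = A (p e) (q e) t ω := by
    intro e
    rcases hs e with h | h
    · simp [h]
    · simpa [h] using hN.symm (q e) (p e) t
  -- The sets are indexed by ordered pairs rather than by e; quantifying over the preimages of x
  -- avoids choosing an inverse of `s`, and injectivity reduces them to singletons.
  have hc := hN.condIndep t (Finset.univ.image s) (fun x => {b | ∀ e, s e = x → b = u e})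
    (fun _ _ => .of_discrete)
  rw [Finset.prod_image fun e _ e' _ h => hinj h] at hc
  have hset : ∀ e, {b | ∀ e', s e' = s e → b = u e'} = {u e} := by
    intro e
    ext b
    simp only [Set.mem_ofPred_eq, Set.mem_singleton_iff]
    exact ⟨fun h => h e rfl, fun h e' he' => by rw [hinj he']; exact h⟩
  simp only [hset] at hc
  have hprod : (∏ e, P⟦(fun ω => A (s e).1.1 (s e).1.2 t ω) ⁻¹' {u e} | preEdgeHistory Z A t⟧) =ᵐ[P]
      fun ω => ∏ e, ber (edgeProb B₀ B Z A (p e) (q e) t ω) (u e) := by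
    have : ∀ e, P⟦(fun ω => A (s e).1.1 (s e).1.2 t ω) ⁻¹' {u e} | preEdgeHistory Z A t⟧ =ᵐ[P]
        fun ω => ber (edgeProb B₀ B Z A (p e) (q e) t ω) (u e) := by
      intro e
      refine (condExp_congr_ae ?_).trans (condExp_edge hN hZ (hpq.ne e) t (u e))
      filter_upwards [hsA e] with ω hω
      simp [Set.indicator, hω]
    filter_upwards [ae_all_iff.2 this] with ω hω
    rw [Finset.prod_apply]
    exact Finset.prod_congr rfl fun e _ => hω e
  have hind : (⋂ x ∈ Finset.univ.image s, (fun ω => A x.1.1 x.1.2 t ω) ⁻¹'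
      {b | ∀ e, s e = x → b = u e}).indicator (fun _ => (1 : ℝ)) =ᵐ[P]
      fun ω => ∏ e, same (A (p e) (q e) t ω) (u e) := by
    filter_upwards [ae_all_iff.2 hsA] with ω hω
    by_cases hall : ∀ e, A (p e) (q e) t ω = u e
    · rw [Set.indicator_of_mem]
      · simp [same, hall]
      · simp only [Set.mem_iInter, Finset.mem_image, Finset.mem_univ, true_and, Set.mem_preimage,
          Set.mem_ofPred_eq]
        rintro _ ⟨e, rfl⟩ e' he'
        rw [hinj he', hω e, hall e]
    · push Not at hall
      obtain ⟨e, he⟩ := hall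
      rw [Set.indicator_of_notMem]
      · exact (Finset.prod_eq_zero (Finset.mem_univ e) (by simp [same, he])).symm
      · intro hmem
        simp only [Set.mem_iInter, Finset.mem_image, Finset.mem_univ, true_and, Set.mem_preimage,
          Set.mem_ofPred_eq] at hmem
        exact he ((hω e).symm.trans (hmem (s e) ⟨e, rfl⟩ e rfl))
  have hcond : P[fun ω => ∏ e, same (A (p e) (q e) t ω) (u e) | preEdgeHistory Z A t] =ᵐ[P]
      fun ω => ∏ e, ber (edgeProb B₀ B Z A (p e) (q e) t ω) (u e) :=
    (condExp_congr_ae hind).symm.trans (hc.trans hprod)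
  have hmeas : Measurable fun ω => ∏ e, same (A (p e) (q e) t ω) (u e) :=
    Finset.measurable_prod _ fun e _ => measurable_same (hN.measurable _ _ _) _
  have hint : Integrable (fun ω => ∏ e, same (A (p e) (q e) t ω) (u e)) P :=
    Integrable.of_bound hmeas.aestronglyMeasurable 1 (ae_of_all _ fun ω => by
      have := prod_mem_Icc fun e => same_mem (A (p e) (q e) t ω) (u e)
      rw [Real.norm_eq_abs, abs_of_nonneg this.1]
      exact this.2)
  have hFint : Integrable (fun ω => F ω * ∏ e, same (A (p e) (q e) t ω) (u e)) P :=
    Integrable.of_bound ((hF.mono hle le_rfl).mul hmeas).aestronglyMeasurable M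
      (ae_of_all _ fun ω => abs_mul_le_of_mem_Icc (hM ω)
        (prod_mem_Icc fun e => same_mem (A (p e) (q e) t ω) (u e)))
  have hpull := condExp_mul_of_stronglyMeasurable_left (m := preEdgeHistory Z A t) (μ := P)
    hF.stronglyMeasurable hFint hint
  rw [← integral_condExp hle (f := fun ω => F ω * ∏ e, same (A (p e) (q e) t ω) (u e))]
  refine integral_congr_ae ?_
  filter_upwards [hpull, hcond] with ω h1 h2
  exact h1.trans (by rw [Pi.mul_apply, h2])

end Network

/-! ### Exponential moments -/

section DegreeBounds

variable {Ω ι : Type*} {d : ℕ} [MeasurableSpace Ω] {P : Measure Ω} [IsProbabilityMeasure P]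
  [LinearOrder ι]
  {B₀ : Opinion d → Opinion d → ℝ} {B : Bool → Opinion d → Opinion d → ℝ}
  {Z : ι → ℕ → Ω → Opinion d} {A : ι → ι → ℕ → Ω → Bool}

theorem edgeVal_eq_same (b : Bool) : edgeVal b = same b true := rfl

theorem edgeVal_mem (b : Bool) : edgeVal b ∈ Set.Icc (0 : ℝ) 1 := same_mem b true

theorem measurable_edgeVal {m : MeasurableSpace Ω} {f : Ω → Bool} (hf : Measurable f) :
    Measurable fun ω => edgeVal (f ω) := measurable_same hf true

theorem integral_mul_edgeVal (hN : IsNetwork P B₀ B Z A) (hZ : ∀ i t, Measurable (Z i t)) {i j : ι}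
    (hij : i ≠ j) (t : ℕ) {F : Ω → ℝ} (hF : Measurable[preEdgeHistory Z A t] F) {M : ℝ}
    (hM : ∀ ω, |F ω| ≤ M) :
    ∫ ω, F ω * edgeVal (A i j t ω) ∂P = ∫ ω, F ω * edgeProb B₀ B Z A i j t ω ∂P := by
  have h := integral_mul_prod_edge hN hZ (κ := Fin 1) (p := fun _ => i) (q := fun _ => j)
    ⟨fun _ => hij, fun e e' h => absurd (Subsingleton.elim e e') h,
      fun e e' h => absurd (Subsingleton.elim e e') h⟩ (fun _ => true) t hF hM
  simpa [edgeVal_eq_same, ber] using h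

theorem integral_mul_edgeVal_mul_edgeVal (hN : IsNetwork P B₀ B Z A)
    (hZ : ∀ i t, Measurable (Z i t)) {i j l : ι} (hij : i ≠ j) (hil : i ≠ l) (hjl : j ≠ l) (t : ℕ)
    {F : Ω → ℝ} (hF : Measurable[preEdgeHistory Z A t] F) {M : ℝ} (hM : ∀ ω, |F ω| ≤ M) :
    ∫ ω, F ω * (edgeVal (A i j t ω) * edgeVal (A i l t ω)) ∂P =
      ∫ ω, F ω * (edgeProb B₀ B Z A i j t ω * edgeProb B₀ B Z A i l t ω) ∂P := by
  have h := integral_mul_prod_edge hN hZ (κ := Fin 2) (p := fun _ => i) (q := ![j, l])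
    ⟨fun e => by fin_cases e <;> simp [hij, hil],
      fun e e' h => by fin_cases e <;> fin_cases e' <;> simp_all [Ne.symm hjl],
      fun e e' h => by fin_cases e <;> fin_cases e' <;> simp_all [Ne.symm hij]⟩
    (fun _ => true) t hF hM
  simpa [edgeVal_eq_same, ber, Fin.prod_univ_two] using h

theorem integrable_bounded {f : Ω → ℝ} (hf : Measurable f) {M : ℝ} (hM : ∀ ω, |f ω| ≤ M) :
    Integrable f P :=
  Integrable.of_bound hf.aestronglyMeasurable M (ae_of_all _ hM)

/-- Given the past, different edges at i are uncorrelated, and a Bernoulli variable with parameter p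
has variance p - p² ≤ p. -/
theorem integral_mul_centered (hB : IsInteraction B₀ B) (hN : IsNetwork P B₀ B Z A)
    (hZ : ∀ i t, Measurable (Z i t)) {i j l : ι} (hij : i ≠ j) (hil : i ≠ l) (t : ℕ)
    {F : Ω → ℝ} (hF : Measurable[preEdgeHistory Z A t] F) (hF0 : ∀ ω, 0 ≤ F ω)
    {M : ℝ} (hM : ∀ ω, F ω ≤ M) :
    ∫ ω, F ω * ((edgeVal (A i j t ω) - edgeProb B₀ B Z A i j t ω) *
        (edgeVal (A i l t ω) - edgeProb B₀ B Z A i l t ω)) ∂P ≤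
      if j = l then ∫ ω, F ω * edgeProb B₀ B Z A i j t ω ∂P else 0 := by
  have hle := preEdgeHistory_le hZ hN.measurable t
  have hp : ∀ j, Measurable[preEdgeHistory Z A t] (edgeProb B₀ B Z A i j t) :=
    fun j => measurable_edgeProb hB i j t
  have hp' := fun j => (hp j).mono hle le_rfl
  have hI : ∀ j, Measurable fun ω => edgeVal (A i j t ω) :=
    fun j => measurable_edgeVal (hN.measurable i j t)
  have hF' := hF.mono hle le_rfl
  have hFM : ∀ ω, |F ω| ≤ M := fun ω => by rw [abs_of_nonneg (hF0 ω)]; exact hM ω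
  have hpm := fun j ω => edgeProb_mem (Z := Z) (A := A) hB i j t ω
  have hIm := fun j ω => edgeVal_mem (A i j t ω)
  have b1 : ∀ {g : Ω → ℝ}, (∀ ω, g ω ∈ Set.Icc (0 : ℝ) 1) → ∀ ω, |F ω * g ω| ≤ M :=
    fun hg ω => abs_mul_le_of_mem_Icc (hFM ω) (hg ω)
  have e1 : ∀ j', i ≠ j' → ∀ l', ∫ ω, F ω * edgeProb B₀ B Z A i l' t ω * edgeVal (A i j' t ω) ∂P =
      ∫ ω, F ω * edgeProb B₀ B Z A i l' t ω * edgeProb B₀ B Z A i j' t ω ∂P := fun j' hj' l' =>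
    integral_mul_edgeVal hN hZ hj' t (hF.mul (hp l')) (b1 (hpm l'))
  have i1 : ∀ j' l', Integrable (fun ω =>
      F ω * edgeProb B₀ B Z A i l' t ω * edgeVal (A i j' t ω)) P := fun j' l' =>
    integrable_bounded ((hF'.mul (hp' l')).mul (hI j'))
      fun ω => abs_mul_le_of_mem_Icc (b1 (hpm l') ω) (hIm j' ω)
  have i2 : ∀ j' l', Integrable (fun ω =>
      F ω * edgeProb B₀ B Z A i l' t ω * edgeProb B₀ B Z A i j' t ω) P := fun j' l' =>
    integrable_bounded ((hF'.mul (hp' l')).mul (hp' j'))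
      fun ω => abs_mul_le_of_mem_Icc (b1 (hpm l') ω) (hpm j' ω)
  by_cases hjl : j = l
  · subst hjl
    rw [if_pos rfl]
    have e2 := integral_mul_edgeVal hN hZ hij t hF hFM
    have i3 : Integrable (fun ω => F ω * edgeVal (A i j t ω)) P :=
      integrable_bounded (hF'.mul (hI j)) (b1 (hIm j))
    have hcalc : ∀ ω, F ω * ((edgeVal (A i j t ω) - edgeProb B₀ B Z A i j t ω) *
        (edgeVal (A i j t ω) - edgeProb B₀ B Z A i j t ω)) =
        F ω * edgeVal (A i j t ω) -
          (2 * (F ω * edgeProb B₀ B Z A i j t ω * edgeVal (A i j t ω)) -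
          F ω * edgeProb B₀ B Z A i j t ω * edgeProb B₀ B Z A i j t ω) := by
      intro ω
      have : edgeVal (A i j t ω) * edgeVal (A i j t ω) = edgeVal (A i j t ω) := by
        cases A i j t ω <;> simp [edgeVal]
      linear_combination F ω * this
    simp only [hcalc]
    have i4 : Integrable (fun ω => 2 * (F ω * edgeProb B₀ B Z A i j t ω * edgeVal (A i j t ω)) -
        F ω * edgeProb B₀ B Z A i j t ω * edgeProb B₀ B Z A i j t ω) P :=
      ((i1 j j).const_mul 2).sub (i2 j j)
    rw [integral_sub i3 i4,
      integral_sub ((i1 j j).const_mul 2) (i2 j j), integral_const_mul, e1 j hij j, e2]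
    have : 0 ≤ ∫ ω, F ω * edgeProb B₀ B Z A i j t ω * edgeProb B₀ B Z A i j t ω ∂P :=
      integral_nonneg fun ω => mul_nonneg (mul_nonneg (hF0 ω) (hpm j ω).1) (hpm j ω).1
    linarith
  · rw [if_neg hjl]
    have e2 := integral_mul_edgeVal_mul_edgeVal hN hZ hij hil hjl t hF hFM
    have i3 : Integrable (fun ω => F ω * (edgeVal (A i j t ω) * edgeVal (A i l t ω))) P :=
      integrable_bounded (hF'.mul ((hI j).mul (hI l))) (b1 fun ω =>
        ⟨mul_nonneg (hIm j ω).1 (hIm l ω).1, mul_le_one₀ (hIm j ω).2 (hIm l ω).1 (hIm l ω).2⟩)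
    have hcalc : ∀ ω, F ω * ((edgeVal (A i j t ω) - edgeProb B₀ B Z A i j t ω) *
        (edgeVal (A i l t ω) - edgeProb B₀ B Z A i l t ω)) =
        F ω * (edgeVal (A i j t ω) * edgeVal (A i l t ω)) -
          (F ω * edgeProb B₀ B Z A i l t ω * edgeVal (A i j t ω) +
          (F ω * edgeProb B₀ B Z A i j t ω * edgeVal (A i l t ω) -
          F ω * edgeProb B₀ B Z A i l t ω * edgeProb B₀ B Z A i j t ω)) := by
      intro ω; ring
    simp only [hcalc]
    have i4 : Integrable (fun ω => F ω * edgeProb B₀ B Z A i j t ω * edgeVal (A i l t ω) -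
        F ω * edgeProb B₀ B Z A i l t ω * edgeProb B₀ B Z A i j t ω) P := (i1 l j).sub (i2 j l)
    have i5 : Integrable (fun ω => F ω * edgeProb B₀ B Z A i l t ω * edgeVal (A i j t ω) +
        (F ω * edgeProb B₀ B Z A i j t ω * edgeVal (A i l t ω) -
        F ω * edgeProb B₀ B Z A i l t ω * edgeProb B₀ B Z A i j t ω)) P := (i1 j l).add i4
    rw [integral_sub i3 i5, integral_add (i1 j l) i4, integral_sub (i1 l j) (i2 j l),
      e1 j hij l, e1 l hil j, e2]
    have e3 : ∫ ω, F ω * (edgeProb B₀ B Z A i j t ω * edgeProb B₀ B Z A i l t ω) ∂P =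
        ∫ ω, F ω * edgeProb B₀ B Z A i l t ω * edgeProb B₀ B Z A i j t ω ∂P := by
      congr 1; ext ω; ring
    have e4 : ∫ ω, F ω * edgeProb B₀ B Z A i j t ω * edgeProb B₀ B Z A i l t ω ∂P =
        ∫ ω, F ω * edgeProb B₀ B Z A i l t ω * edgeProb B₀ B Z A i j t ω ∂P := by
      congr 1; ext ω; ring
    rw [e3, e4]
    linarith

variable [Fintype ι]

/-- The degree of `i` at time `t`. -/
def degree (A : ι → ι → ℕ → Ω → Bool) (i : ι) (t : ℕ) (ω : Ω) : ℝ := ∑ j, edgeVal (A i j t ω)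

/-- The expected degree of `i` at time `t` given the past. -/
def meanDegree (B₀ : Opinion d → Opinion d → ℝ) (B : Bool → Opinion d → Opinion d → ℝ)
    (Z : ι → ℕ → Ω → Opinion d) (A : ι → ι → ℕ → Ω → Bool) (i : ι) (t : ℕ) (ω : Ω) : ℝ :=
  1 + ∑ j ∈ Finset.univ.erase i, edgeProb B₀ B Z A i j t ω

theorem one_le_meanDegree (hB : IsInteraction B₀ B) (i : ι) (t : ℕ) (ω : Ω) :
    1 ≤ meanDegree B₀ B Z A i t ω :=
  le_add_of_nonneg_right (Finset.sum_nonneg fun j _ => (edgeProb_mem hB i j t ω).1)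

theorem measurable_meanDegree (hB : IsInteraction B₀ B) (i : ι) (t : ℕ) :
    Measurable[preEdgeHistory Z A t] (meanDegree B₀ B Z A i t) := by
  let _ : MeasurableSpace Ω := preEdgeHistory Z A t
  exact measurable_const.add (Finset.measurable_sum _ fun j _ => measurable_edgeProb hB i j t)

theorem measurable_degree (hA : ∀ i j t, Measurable (A i j t)) (i : ι) (t : ℕ) :
    Measurable (degree A i t) :=
  Finset.measurable_sum _ fun j _ => measurable_edgeVal (hA i j t)

theorem degree_eq (hN : IsNetwork P B₀ B Z A) (i : ι) (t : ℕ) :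
    ∀ᵐ ω ∂P, degree A i t ω = 1 + ∑ j ∈ Finset.univ.erase i, edgeVal (A i j t ω) := by
  filter_upwards [hN.diag i t] with ω hω
  rw [degree, ← Finset.add_sum_erase _ _ (Finset.mem_univ i), hω]
  rfl

theorem one_le_degree (hN : IsNetwork P B₀ B Z A) (i : ι) (t : ℕ) :
    ∀ᵐ ω ∂P, 1 ≤ degree A i t ω := by
  filter_upwards [degree_eq hN i t] with ω hω
  rw [hω]
  exact le_add_of_nonneg_right (Finset.sum_nonneg fun j _ => (edgeVal_mem _).1)

theorem degree_le (A : ι → ι → ℕ → Ω → Bool) (i : ι) (t : ℕ) (ω : Ω) :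
    degree A i t ω ≤ Fintype.card ι := by
  refine (Finset.sum_le_card_nsmul Finset.univ (fun j => edgeVal (A i j t ω)) 1
    fun j _ => (edgeVal_mem _).2).trans ?_
  simp

theorem degree_nonneg (A : ι → ι → ℕ → Ω → Bool) (i : ι) (t : ℕ) (ω : Ω) :
    0 ≤ degree A i t ω := Finset.sum_nonneg fun _ _ => (edgeVal_mem _).1

theorem meanDegree_le (hB : IsInteraction B₀ B) (i : ι) (t : ℕ) (ω : Ω) :
    meanDegree B₀ B Z A i t ω ≤ 1 + Fintype.card ι := by
  refine add_le_add_right ?_ 1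
  refine (Finset.sum_le_card_nsmul _ _ 1 fun j _ => (edgeProb_mem hB i j t ω).2).trans ?_
  simp only [nsmul_eq_mul, mul_one]
  exact_mod_cast Finset.card_le_univ _

/-- The conditional variance of the degree is the sum of the variances of its edges, hence at most
the sum of their probabilities. The deterministic self-loop cancels in the difference. -/
theorem integral_mul_degree_sub_sq_le (hB : IsInteraction B₀ B) (hN : IsNetwork P B₀ B Z A)
    (hZ : ∀ i t, Measurable (Z i t)) (i : ι) (t : ℕ)
    {F : Ω → ℝ} (hF : Measurable[preEdgeHistory Z A t] F) (hF0 : ∀ ω, 0 ≤ F ω)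
    {M : ℝ} (hM : ∀ ω, F ω ≤ M) :
    ∫ ω, F ω * (degree A i t ω - meanDegree B₀ B Z A i t ω) ^ 2 ∂P ≤
      ∫ ω, F ω * meanDegree B₀ B Z A i t ω ∂P := by
  have hle := preEdgeHistory_le hZ hN.measurable t
  have hF' := hF.mono hle le_rfl
  have hFM : ∀ ω, |F ω| ≤ M := fun ω => by rw [abs_of_nonneg (hF0 ω)]; exact hM ω
  have hp' := fun j => (measurable_edgeProb (Z := Z) (A := A) hB i j t).mono hle le_rfl
  have hpm := fun j ω => edgeProb_mem (Z := Z) (A := A) hB i j t ω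
  have hIm := fun j ω => edgeVal_mem (A i j t ω)
  have hI : ∀ j, Measurable fun ω => edgeVal (A i j t ω) :=
    fun j => measurable_edgeVal (hN.measurable i j t)
  have hM0 : 0 ≤ M := by
    obtain ⟨ω⟩ := nonempty_of_isProbabilityMeasure P
    exact (hF0 ω).trans (hM ω)
  have hint : ∀ j l, Integrable (fun ω => F ω *
      ((edgeVal (A i j t ω) - edgeProb B₀ B Z A i j t ω) *
        (edgeVal (A i l t ω) - edgeProb B₀ B Z A i l t ω))) P := by
    intro j l
    refine integrable_bounded (hF'.mul (((hI j).sub (hp' j)).mul ((hI l).sub (hp' l)))) (M := M)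
      fun ω => ?_
    have h1 : |edgeVal (A i j t ω) - edgeProb B₀ B Z A i j t ω| ≤ 1 := by
      have := hIm j ω; have := hpm j ω; rw [abs_le]; constructor <;> linarith [this.1, this.2,
        (hIm j ω).1, (hIm j ω).2]
    have h2 : |edgeVal (A i l t ω) - edgeProb B₀ B Z A i l t ω| ≤ 1 := by
      have := hIm l ω; have := hpm l ω; rw [abs_le]; constructor <;> linarith [this.1, this.2,
        (hIm l ω).1, (hIm l ω).2]
    rw [abs_mul, abs_mul]
    calc |F ω| * (_ * _) ≤ M * (1 * 1) := by gcongr; exact hFM ω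
      _ = M := by ring
  have heq : ∫ ω, F ω * (degree A i t ω - meanDegree B₀ B Z A i t ω) ^ 2 ∂P =
      ∑ j ∈ Finset.univ.erase i, ∑ l ∈ Finset.univ.erase i, ∫ ω, F ω *
      ((edgeVal (A i j t ω) - edgeProb B₀ B Z A i j t ω) *
        (edgeVal (A i l t ω) - edgeProb B₀ B Z A i l t ω)) ∂P := by
    have h1 : ∀ j, ∑ l ∈ Finset.univ.erase i, ∫ ω, F ω *
        ((edgeVal (A i j t ω) - edgeProb B₀ B Z A i j t ω) *
        (edgeVal (A i l t ω) - edgeProb B₀ B Z A i l t ω)) ∂P =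
        ∫ ω, ∑ l ∈ Finset.univ.erase i, F ω *
        ((edgeVal (A i j t ω) - edgeProb B₀ B Z A i j t ω) *
        (edgeVal (A i l t ω) - edgeProb B₀ B Z A i l t ω)) ∂P := fun j =>
      (integral_finsetSum _ fun l _ => hint j l).symm
    rw [Finset.sum_congr rfl fun j _ => h1 j, ← integral_finsetSum _ fun j _ =>
      integrable_finsetSum _ fun l _ => hint j l]
    refine integral_congr_ae ?_
    filter_upwards [degree_eq hN i t] with ω hω
    rw [hω, meanDegree, add_sub_add_left_eq_sub, ← Finset.sum_sub_distrib, sq,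
      Finset.sum_mul_sum, Finset.mul_sum]
    simp only [Finset.mul_sum]
  rw [heq]
  calc _ ≤ ∑ j ∈ Finset.univ.erase i, ∑ l ∈ Finset.univ.erase i,
        (if j = l then ∫ ω, F ω * edgeProb B₀ B Z A i j t ω ∂P else 0) :=
        Finset.sum_le_sum fun j hj => Finset.sum_le_sum fun l hl =>
          integral_mul_centered hB hN hZ (Finset.ne_of_mem_erase hj).symm
            (Finset.ne_of_mem_erase hl).symm t hF hF0 hM
    _ = ∑ j ∈ Finset.univ.erase i, ∫ ω, F ω * edgeProb B₀ B Z A i j t ω ∂P := by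
        refine Finset.sum_congr rfl fun j hj => ?_
        rw [Finset.sum_ite_eq, if_pos hj]
    _ = ∫ ω, ∑ j ∈ Finset.univ.erase i, F ω * edgeProb B₀ B Z A i j t ω ∂P := by
        rw [integral_finsetSum]
        exact fun j _ => integrable_bounded (hF'.mul (hp' j))
          fun ω => abs_mul_le_of_mem_Icc (hFM ω) (hpm j ω)
    _ ≤ _ := by
        refine integral_mono ?_ ?_ fun ω => ?_
        · exact integrable_finsetSum _ fun j _ => integrable_bounded (hF'.mul (hp' j))
            fun ω => abs_mul_le_of_mem_Icc (hFM ω) (hpm j ω)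
        · refine integrable_bounded (hF'.mul ((measurable_meanDegree hB i t).mono hle le_rfl))
            (M := M * (1 + Fintype.card ι)) fun ω => ?_
          have h1 := one_le_meanDegree (Z := Z) (A := A) hB i t ω
          rw [abs_mul, abs_of_nonneg (by linarith : 0 ≤ meanDegree B₀ B Z A i t ω)]
          exact mul_le_mul (hFM ω) (meanDegree_le hB i t ω) (by linarith) hM0
        · simp only [← Finset.mul_sum]
          exact mul_le_mul_of_nonneg_left (le_add_of_nonneg_left zero_le_one) (hF0 ω)

/-- A pointwise Chebyshev bound. Either D ≥ m/2 and the first term suffices, or D deviates from m by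
more than m/2, so that the last term is at least 1 ≥ 1/D. -/
theorem inv_le_of_sq {D m : ℝ} (hD : 1 ≤ D) (hm : 0 < m) :
    D⁻¹ ≤ 2 * m⁻¹ + 4 * ((m ^ 2)⁻¹ * (D - m) ^ 2) := by
  by_cases h : m / 2 ≤ D
  · have h1 : D⁻¹ ≤ (m / 2)⁻¹ := inv_anti₀ (by positivity) h
    have h2 : (m / 2)⁻¹ = 2 * m⁻¹ := by field_simp
    have h3 : 0 ≤ 4 * ((m ^ 2)⁻¹ * (D - m) ^ 2) := by positivity
    linarith
  · push Not at h
    have h1 : D⁻¹ ≤ 1 := inv_le_one_of_one_le₀ hD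
    have h2 : (m / 2) ^ 2 ≤ (D - m) ^ 2 := by nlinarith
    have h3 : 4 * ((m ^ 2)⁻¹ * (m / 2) ^ 2) = 1 := by field_simp; norm_num
    have h4 : 4 * ((m ^ 2)⁻¹ * (m / 2) ^ 2) ≤ 4 * ((m ^ 2)⁻¹ * (D - m) ^ 2) := by gcongr
    have h5 : 0 ≤ 2 * m⁻¹ := by positivity
    linarith

/-- The degree depends on edges that are not yet drawn, its conditional mean does not. Integrating
`inv_le_of_sq` and applying the variance bound costs the factor 2 + 4 = 6. -/
theorem integral_mul_inv_degree_le (hB : IsInteraction B₀ B) (hN : IsNetwork P B₀ B Z A)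
    (hZ : ∀ i t, Measurable (Z i t)) (i : ι) (t : ℕ)
    {F : Ω → ℝ} (hF : Measurable[preEdgeHistory Z A t] F) (hF0 : ∀ ω, 0 ≤ F ω)
    {M : ℝ} (hM : ∀ ω, F ω ≤ M) :
    ∫ ω, F ω * (degree A i t ω)⁻¹ ∂P ≤ 6 * ∫ ω, F ω * (meanDegree B₀ B Z A i t ω)⁻¹ ∂P := by
  have hle := preEdgeHistory_le hZ hN.measurable t
  have hF' := hF.mono hle le_rfl
  have hFM : ∀ ω, |F ω| ≤ M := fun ω => by rw [abs_of_nonneg (hF0 ω)]; exact hM ω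
  have hM0 : 0 ≤ M := by
    obtain ⟨ω⟩ := nonempty_of_isProbabilityMeasure P
    exact (hF0 ω).trans (hM ω)
  have hm1 := fun ω => one_le_meanDegree (Z := Z) (A := A) hB i t ω
  have hmm := measurable_meanDegree (Z := Z) (A := A) hB i t
  have hmm' := hmm.mono hle le_rfl
  have hDm := measurable_degree hN.measurable i t
  -- With the weight F/m² the variance bound m turns into F/m, the quantity wanted on the right.
  set G : Ω → ℝ := fun ω => F ω * ((meanDegree B₀ B Z A i t ω) ^ 2)⁻¹ with hG
  have hsqI : ∀ ω, ((meanDegree B₀ B Z A i t ω) ^ 2)⁻¹ ∈ Set.Icc (0 : ℝ) 1 := fun ω =>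
    ⟨by positivity, inv_le_one_of_one_le₀ (one_le_pow₀ (hm1 ω))⟩
  have hinvI : ∀ ω, (meanDegree B₀ B Z A i t ω)⁻¹ ∈ Set.Icc (0 : ℝ) 1 := fun ω =>
    ⟨inv_nonneg.2 (by linarith [hm1 ω]), inv_le_one_of_one_le₀ (hm1 ω)⟩
  have hGM : ∀ ω, |G ω| ≤ M := fun ω => abs_mul_le_of_mem_Icc (hFM ω) (hsqI ω)
  have hG0 : ∀ ω, 0 ≤ G ω := fun ω => mul_nonneg (hF0 ω) (hsqI ω).1
  have hGm : Measurable[preEdgeHistory Z A t] G := hF.mul (hmm.pow_const 2).inv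
  have hsq := integral_mul_degree_sub_sq_le hB hN hZ i t hGm hG0 fun ω => (le_abs_self _).trans
    (hGM ω)
  have hGmean : (fun ω => G ω * meanDegree B₀ B Z A i t ω) =
      fun ω => F ω * (meanDegree B₀ B Z A i t ω)⁻¹ := by
    ext ω
    have : meanDegree B₀ B Z A i t ω ≠ 0 := by linarith [hm1 ω]
    simp only [hG]
    field_simp
  rw [hGmean] at hsq
  have i1 : Integrable (fun ω => F ω * (meanDegree B₀ B Z A i t ω)⁻¹) P :=
    integrable_bounded (hF'.mul hmm'.inv) fun ω => abs_mul_le_of_mem_Icc (hFM ω) (hinvI ω)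
  have i2 : Integrable (fun ω => G ω * (degree A i t ω - meanDegree B₀ B Z A i t ω) ^ 2) P := by
    refine integrable_bounded ((hGm.mono hle le_rfl).mul ((hDm.sub hmm').pow_const 2))
      (M := M * (1 + Fintype.card ι) ^ 2) fun ω => ?_
    rw [abs_mul, abs_of_nonneg (sq_nonneg (degree A i t ω - meanDegree B₀ B Z A i t ω))]
    refine mul_le_mul (hGM ω) ?_ (sq_nonneg _) hM0
    rw [← sq_abs]
    refine pow_le_pow_left₀ (abs_nonneg _) ?_ 2
    rw [abs_le]
    have h1 := degree_le A i t ω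
    have h2 := degree_nonneg A i t ω
    have h3 := meanDegree_le (Z := Z) (A := A) hB i t ω
    have h4 := hm1 ω
    constructor <;> linarith
  calc ∫ ω, F ω * (degree A i t ω)⁻¹ ∂P
      ≤ ∫ ω, (2 * (F ω * (meanDegree B₀ B Z A i t ω)⁻¹) +
          4 * (G ω * (degree A i t ω - meanDegree B₀ B Z A i t ω) ^ 2)) ∂P := by
        refine integral_mono_ae ?_ ((i1.const_mul 2).add (i2.const_mul 4)) ?_
        · refine Integrable.of_bound (hF'.mul hDm.inv).aestronglyMeasurable M ?_
          filter_upwards [one_le_degree hN i t] with ω hω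
          exact abs_mul_le_of_mem_Icc (hFM ω)
            ⟨inv_nonneg.2 (by linarith), inv_le_one_of_one_le₀ hω⟩
        · filter_upwards [one_le_degree hN i t] with ω hω
          have := mul_le_mul_of_nonneg_left
            (inv_le_of_sq hω (by linarith [hm1 ω] : 0 < meanDegree B₀ B Z A i t ω)) (hF0 ω)
          refine this.trans (le_of_eq ?_)
          simp only [hG]
          ring
    _ = 2 * ∫ ω, F ω * (meanDegree B₀ B Z A i t ω)⁻¹ ∂P +
          4 * ∫ ω, G ω * (degree A i t ω - meanDegree B₀ B Z A i t ω) ^ 2 ∂P := by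
        rw [integral_add (i1.const_mul 2) (i2.const_mul 4), integral_const_mul,
          integral_const_mul]
    _ ≤ _ := by linarith

/-- Truncating `F` at level R and monotone convergence remove the boundedness, which fails for sums
of exponentials of opinions. -/
theorem lintegral_mul_inv_degree_le (hB : IsInteraction B₀ B) (hN : IsNetwork P B₀ B Z A)
    (hZ : ∀ i t, Measurable (Z i t)) (i : ι) (t : ℕ)
    {F : Ω → ℝ} (hF : Measurable[preEdgeHistory Z A t] F) (hF0 : ∀ ω, 0 ≤ F ω) :
    ∫⁻ ω, ENNReal.ofReal (F ω * (degree A i t ω)⁻¹) ∂P ≤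
      6 * ∫⁻ ω, ENNReal.ofReal (F ω * (meanDegree B₀ B Z A i t ω)⁻¹) ∂P := by
  have hle := preEdgeHistory_le hZ hN.measurable t
  have hm1 := fun ω => one_le_meanDegree (Z := Z) (A := A) hB i t ω
  have hmm' := (measurable_meanDegree (Z := Z) (A := A) hB i t).mono hle le_rfl
  have hDm := measurable_degree hN.measurable i t
  have hD0 : ∀ ω, 0 ≤ (degree A i t ω)⁻¹ := fun ω => inv_nonneg.2 (degree_nonneg A i t ω)
  have hm0 : ∀ ω, 0 ≤ (meanDegree B₀ B Z A i t ω)⁻¹ :=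
    fun ω => inv_nonneg.2 (by linarith [hm1 ω])
  have hFR : ∀ R : ℕ, Measurable[preEdgeHistory Z A t] fun ω => min (F ω) (R : ℝ) :=
    fun R => hF.min measurable_const
  have hFR' := fun R => (hFR R).mono hle le_rfl
  have hFR0 : ∀ (R : ℕ) ω, 0 ≤ min (F ω) (R : ℝ) := fun R ω => le_min (hF0 ω) (Nat.cast_nonneg R)
  have hFRM : ∀ (R : ℕ) ω, |min (F ω) (R : ℝ)| ≤ R := fun R ω => by
    rw [abs_of_nonneg (hFR0 R ω)]; exact min_le_right _ _
  have hlim : Tendsto (fun R : ℕ => ∫⁻ ω, ENNReal.ofReal (min (F ω) R * (degree A i t ω)⁻¹) ∂P)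
      atTop (𝓝 (∫⁻ ω, ENNReal.ofReal (F ω * (degree A i t ω)⁻¹) ∂P)) := by
    refine lintegral_tendsto_of_tendsto_of_monotone
      (fun R => ((hFR' R).mul hDm.inv).ennreal_ofReal.aemeasurable)
      (ae_of_all _ fun ω R R' hR => ?_) (ae_of_all _ fun ω => ?_)
    · refine ENNReal.ofReal_le_ofReal (mul_le_mul_of_nonneg_right ?_ (hD0 ω))
      exact min_le_min_left _ (by exact_mod_cast hR)
    · refine tendsto_const_nhds.congr' ?_
      obtain ⟨N, hN'⟩ := exists_nat_ge (F ω)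
      filter_upwards [eventually_ge_atTop N] with R hR
      rw [min_eq_left (hN'.trans (by exact_mod_cast hR))]
  refine le_of_tendsto' hlim fun R => ?_
  have h := integral_mul_inv_degree_le hB hN hZ i t (hFR R) (hFR0 R)
    fun ω => min_le_right _ _
  have i1 : Integrable (fun ω => min (F ω) R * (degree A i t ω)⁻¹) P := by
    refine Integrable.of_bound ((hFR' R).mul hDm.inv).aestronglyMeasurable R ?_
    filter_upwards [one_le_degree hN i t] with ω hω
    exact abs_mul_le_of_mem_Icc (hFRM R ω) ⟨hD0 ω, inv_le_one_of_one_le₀ hω⟩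
  have i2 : Integrable (fun ω => min (F ω) R * (meanDegree B₀ B Z A i t ω)⁻¹) P :=
    integrable_bounded ((hFR' R).mul hmm'.inv) fun ω => abs_mul_le_of_mem_Icc (hFRM R ω)
      ⟨hm0 ω, inv_le_one_of_one_le₀ (hm1 ω)⟩
  rw [← ofReal_integral_eq_lintegral_ofReal i1
    (ae_of_all _ fun ω => mul_nonneg (hFR0 R ω) (hD0 ω))]
  calc _ ≤ ENNReal.ofReal (6 * ∫ ω, min (F ω) R * (meanDegree B₀ B Z A i t ω)⁻¹ ∂P) :=
        ENNReal.ofReal_le_ofReal h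
    _ = 6 * ∫⁻ ω, ENNReal.ofReal (min (F ω) R * (meanDegree B₀ B Z A i t ω)⁻¹) ∂P := by
        rw [ENNReal.ofReal_mul (by norm_num), ofReal_integral_eq_lintegral_ofReal i2
          (ae_of_all _ fun ω => mul_nonneg (hFR0 R ω) (hm0 ω))]
        norm_num
    _ ≤ _ := by
        gcongr with ω
        · exact hm0 ω
        · exact min_le_left _ _

end DegreeBounds

/-! ### Exponential moments of the neighbourhood mean -/

section NeighbourMean

variable {Ω ι : Type*} {d : ℕ} [MeasurableSpace Ω] {P : Measure Ω} [IsProbabilityMeasure P]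
  [LinearOrder ι] [Fintype ι]
  {B₀ : Opinion d → Opinion d → ℝ} {B : Bool → Opinion d → Opinion d → ℝ}
  {Z : ι → ℕ → Ω → Opinion d} {A : ι → ι → ℕ → Ω → Bool}

theorem neighbourMean_eq (i : ι) (t : ℕ) (ω : Ω) :
    neighbourMean Z A i t ω = ∑ j, ((degree A i t ω)⁻¹ * edgeVal (A i j t ω)) • Z j t ω := by
  simp only [neighbourMean, degree, Finset.smul_sum, smul_smul]

theorem measurable_neighbourMean (hZ : ∀ i t, Measurable (Z i t))
    (hA : ∀ i j t, Measurable (A i j t)) (i : ι) (t : ℕ) : Measurable (neighbourMean Z A i t) := by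
  have h1 := measurable_degree hA i t
  have h2 := fun j => measurable_edgeVal (hA i j t)
  exact h1.inv.smul (Finset.measurable_sum _ fun j _ => (h2 j).smul (hZ j t))

theorem sum_weight_eq_one {i : ι} {t : ℕ} {ω : Ω} (hD : 1 ≤ degree A i t ω) :
    ∑ j, (degree A i t ω)⁻¹ * edgeVal (A i j t ω) = 1 := by
  rw [← Finset.mul_sum]
  exact inv_mul_cancel₀ (by rw [degree] at *; linarith)

theorem weight_nonneg (A : ι → ι → ℕ → Ω → Bool) (i j : ι) (t : ℕ) (ω : Ω) :
    0 ≤ (degree A i t ω)⁻¹ * edgeVal (A i j t ω) :=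
  mul_nonneg (inv_nonneg.2 (degree_nonneg A i t ω)) (edgeVal_mem _).1

/-- Jensen for the convex combination of the neighbours. The edge indicators in the numerator are
then bounded by 1, which leaves a factor that is known before the edges are drawn, as
`lintegral_mul_inv_degree_le` requires. -/
theorem exp_norm_neighbourMean_le {i : ι} {t : ℕ} {ω : Ω} (hD : 1 ≤ degree A i t ω) {C : ℝ}
    (hC : 0 ≤ C) : Real.exp (C * ‖neighbourMean Z A i t ω‖) ≤
      (∑ j, Real.exp (C * ‖Z j t ω‖)) * (degree A i t ω)⁻¹ := by
  have h1 : ‖neighbourMean Z A i t ω‖ ≤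
      ∑ j, ((degree A i t ω)⁻¹ * edgeVal (A i j t ω)) * ‖Z j t ω‖ := by
    rw [neighbourMean_eq]
    refine (norm_sum_le _ _).trans (Finset.sum_le_sum fun j _ => ?_)
    rw [norm_smul, Real.norm_eq_abs, abs_of_nonneg (weight_nonneg A i j t ω)]
  have h2 := convexOn_exp.map_sum_le (t := Finset.univ)
    (w := fun j => (degree A i t ω)⁻¹ * edgeVal (A i j t ω)) (p := fun j => C * ‖Z j t ω‖)
    (fun j _ => weight_nonneg A i j t ω) (sum_weight_eq_one hD) (fun _ _ => Set.mem_univ _)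
  calc Real.exp (C * ‖neighbourMean Z A i t ω‖)
      ≤ Real.exp (∑ j, ((degree A i t ω)⁻¹ * edgeVal (A i j t ω)) • (C * ‖Z j t ω‖)) := by
        refine Real.exp_le_exp.2 ((mul_le_mul_of_nonneg_left h1 hC).trans (le_of_eq ?_))
        rw [Finset.mul_sum]
        exact Finset.sum_congr rfl fun j _ => by rw [smul_eq_mul]; ring
    _ ≤ ∑ j, ((degree A i t ω)⁻¹ * edgeVal (A i j t ω)) • Real.exp (C * ‖Z j t ω‖) := h2
    _ ≤ ∑ j, Real.exp (C * ‖Z j t ω‖) * (degree A i t ω)⁻¹ := by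
        refine Finset.sum_le_sum fun j _ => ?_
        rw [smul_eq_mul, mul_comm (Real.exp _)]
        refine mul_le_mul_of_nonneg_right ?_ (Real.exp_nonneg _)
        exact mul_le_of_le_one_right (inv_nonneg.2 (degree_nonneg A i t ω)) (edgeVal_mem _).2
    _ = _ := by rw [Finset.sum_mul]

theorem ExpDecay.exists_lower (h : ExpDecay B₀ B) (hB : IsInteraction B₀ B) :
    ∃ C > 0, ∃ c > 0, (∀ x y, c * Real.exp (-(C * ‖x - y‖)) ≤ B₀ x y) ∧
      ∀ a x y, c * Real.exp (-(C * ‖x - y‖)) ≤ B a x y := by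
  obtain ⟨C, hC, h0, h1⟩ := h
  refine ⟨C, hC, _, lt_min h0 h1, fun x y => ?_, fun a x y => ?_⟩
  · have hb : BddBelow (Set.range fun p : Opinion d × Opinion d =>
        B₀ p.1 p.2 * Real.exp (C * ‖p.1 - p.2‖)) :=
      ⟨0, by rintro _ ⟨p, rfl⟩; exact mul_nonneg (hB.init_mem _ _).1 (Real.exp_nonneg _)⟩
    have := (min_le_left _ (⨅ p : Bool × Opinion d × Opinion d,
      B p.1 p.2.1 p.2.2 * Real.exp (C * ‖p.2.1 - p.2.2‖))).trans (ciInf_le hb (x, y))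
    rw [Real.exp_neg, ← div_eq_mul_inv, div_le_iff₀ (Real.exp_pos _)]
    exact this
  · have hb : BddBelow (Set.range fun p : Bool × Opinion d × Opinion d =>
        B p.1 p.2.1 p.2.2 * Real.exp (C * ‖p.2.1 - p.2.2‖)) :=
      ⟨0, by rintro _ ⟨p, rfl⟩; exact mul_nonneg (hB.mem _ _ _).1 (Real.exp_nonneg _)⟩
    have := (min_le_right (⨅ p : Opinion d × Opinion d,
      B₀ p.1 p.2 * Real.exp (C * ‖p.1 - p.2‖)) _).trans (ciInf_le hb (a, x, y))
    rw [Real.exp_neg, ← div_eq_mul_inv, div_le_iff₀ (Real.exp_pos _)]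
    exact this

theorem edgeProb_lower {C c : ℝ} (h0 : ∀ x y, c * Real.exp (-(C * ‖x - y‖)) ≤ B₀ x y)
    (h1 : ∀ a x y, c * Real.exp (-(C * ‖x - y‖)) ≤ B a x y) (i j : ι) (t : ℕ) (ω : Ω) :
    c * Real.exp (-(C * ‖Z i t ω - Z j t ω‖)) ≤ edgeProb B₀ B Z A i j t ω := by
  cases t with
  | zero => exact h0 _ _
  | succ t => exact h1 _ _ _

theorem card_sq_le_sum_mul_sum_inv {v : ι → ℝ} (hv : ∀ j, 0 < v j) :
    (Fintype.card ι : ℝ) ^ 2 ≤ (∑ j, v j) * ∑ j, (v j)⁻¹ := by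
  have := Finset.sum_sq_le_sum_mul_sum_of_sq_le_mul Finset.univ (r := fun _ => (1 : ℝ))
    (f := v) (g := fun j => (v j)⁻¹) (fun j _ => (hv j).le) (fun j _ => (inv_pos.2 (hv j)).le)
    (fun j _ => by rw [mul_inv_cancel₀ (hv j).ne']; norm_num)
  simpa using this

theorem mul_sq_le_cube_add_cube {x y : ℝ} (hx : 0 ≤ x) (hy : 0 ≤ y) :
    x * y ^ 2 ≤ x ^ 3 + y ^ 3 := by
  rcases le_total x y with h | h
  · have : x * y ^ 2 ≤ y * y ^ 2 := by gcongr
    nlinarith [pow_nonneg hx 3]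
  · have : x * y ^ 2 ≤ x * x ^ 2 := by gcongr
    nlinarith [pow_nonneg hy 3]

/-- Write v_j for exp(C'|Z_j|). The decay bound and the triangle inequality give an expected degree
of at least c v_i⁻¹ ∑ v_j⁻¹, and Cauchy–Schwarz bounds ∑ v_j⁻¹ below by n²/∑ v_j. The left side is
thus at most c⁻¹ v_i times the squared average of the v_j. Separating the two factors by cubes
explains the exponent 3C'; the result is bounded in mean uniformly in n. -/
theorem sum_mul_inv_meanDegree_le (hB : IsInteraction B₀ B) {C c : ℝ} (hc : 0 < c)
    (h0 : ∀ x y, c * Real.exp (-(C * ‖x - y‖)) ≤ B₀ x y)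
    (h1 : ∀ a x y, c * Real.exp (-(C * ‖x - y‖)) ≤ B a x y) {C' : ℝ} (hC' : C ≤ C') (i : ι)
    (hC0 : 0 ≤ C) (t : ℕ) (ω : Ω) :
    (∑ j, Real.exp (C' * ‖Z j t ω‖)) * (meanDegree B₀ B Z A i t ω)⁻¹ ≤
      c⁻¹ * (Real.exp (3 * C' * ‖Z i t ω‖) +
        (Fintype.card ι : ℝ)⁻¹ * ∑ j, Real.exp (3 * C' * ‖Z j t ω‖)) := by
  set v : ι → ℝ := fun j => Real.exp (C' * ‖Z j t ω‖) with hv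
  have hvpos : ∀ j, 0 < v j := fun j => Real.exp_pos _
  have hcube : ∀ j, Real.exp (3 * C' * ‖Z j t ω‖) = v j ^ 3 := fun j => by
    rw [hv, ← Real.exp_nat_mul]; congr 1; push_cast; ring
  simp only [hcube]
  have hn : (0 : ℝ) < Fintype.card ι := by exact_mod_cast Fintype.card_pos_iff.2 ⟨i⟩
  set n : ℝ := (Fintype.card ι : ℝ) with hn'
  -- Needed for j = i, where the self-loop contributes 1 to the mean degree instead of an
  -- interaction probability.
  have hc1 : c ≤ 1 := by
    have := (h0 (Z i t ω) (Z i t ω)).trans (hB.init_mem _ _).2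
    simpa using this
  have hlow : ∀ j, c * ((v i)⁻¹ * (v j)⁻¹) ≤ c * Real.exp (-(C * ‖Z i t ω - Z j t ω‖)) := by
    intro j
    refine mul_le_mul_of_nonneg_left ?_ hc.le
    rw [hv, ← Real.exp_neg, ← Real.exp_neg, ← Real.exp_add]
    refine Real.exp_le_exp.2 ?_
    have h2 : C * ‖Z i t ω - Z j t ω‖ ≤ C' * (‖Z i t ω‖ + ‖Z j t ω‖) :=
      mul_le_mul hC' (norm_sub_le _ _) (norm_nonneg _) (hC0.trans hC')
    linarith
  have hm : c * ((v i)⁻¹ * ∑ j, (v j)⁻¹) ≤ meanDegree B₀ B Z A i t ω := by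
    rw [Finset.mul_sum, Finset.mul_sum, ← Finset.add_sum_erase _ _ (Finset.mem_univ i)]
    refine add_le_add ?_ (Finset.sum_le_sum fun j _ =>
      (hlow j).trans (edgeProb_lower h0 h1 i j t ω))
    refine (hlow i).trans ?_
    simpa using hc1
  have hS : 0 < ∑ j, v j := Finset.sum_pos (fun j _ => hvpos j) ⟨i, Finset.mem_univ i⟩
  have hS' : 0 < ∑ j, (v j)⁻¹ :=
    Finset.sum_pos (fun j _ => inv_pos.2 (hvpos j)) ⟨i, Finset.mem_univ i⟩
  have hvi := hvpos i
  have hcs := card_sq_le_sum_mul_sum_inv hvpos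
  calc (∑ j, v j) * (meanDegree B₀ B Z A i t ω)⁻¹
      ≤ (∑ j, v j) * (c * ((v i)⁻¹ * ∑ j, (v j)⁻¹))⁻¹ := by
        gcongr
    _ ≤ c⁻¹ * (v i * (n⁻¹ * ∑ j, v j) ^ 2) := by
        have h5 : (∑ j, (v j)⁻¹)⁻¹ ≤ (∑ j, v j) * (n ^ 2)⁻¹ := by
          rw [← div_eq_mul_inv, inv_le_comm₀ hS' (by positivity), inv_div, div_le_iff₀ hS]
          linarith
        calc (∑ j, v j) * (c * ((v i)⁻¹ * ∑ j, (v j)⁻¹))⁻¹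
            = c⁻¹ * (v i * ((∑ j, v j) * (∑ j, (v j)⁻¹)⁻¹)) := by
              rw [mul_inv, mul_inv, inv_inv]; ring
          _ ≤ c⁻¹ * (v i * ((∑ j, v j) * ((∑ j, v j) * (n ^ 2)⁻¹))) := by gcongr
          _ = _ := by rw [mul_pow, inv_pow]; ring
    _ ≤ c⁻¹ * (v i ^ 3 + (n⁻¹ * ∑ j, v j) ^ 3) := by
        gcongr
        exact mul_sq_le_cube_add_cube hvi.le (by positivity)
    _ ≤ _ := by
        gcongr
        -- Jensen for the cube turns the cubed average into an average of cubes.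
        have h6 := Real.pow_arith_mean_le_arith_mean_pow Finset.univ (fun _ : ι => n⁻¹) v
          (fun _ _ => by positivity) (by simp [← hn', hn.ne'])
          (fun j _ => (hvpos j).le) 3
        simpa [← Finset.mul_sum] using h6

/-- One `K` accounts for agent i itself and the other for the average over all agents, so the bound
does not depend on the number of agents. -/
theorem lintegral_exp_neighbourMean_le_of_expDecay (hB : IsInteraction B₀ B)
    (hN : IsNetwork P B₀ B Z A) (hZ : ∀ i t, Measurable (Z i t)) {C c : ℝ} (hc : 0 < c)
    (h0 : ∀ x y, c * Real.exp (-(C * ‖x - y‖)) ≤ B₀ x y)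
    (h1 : ∀ a x y, c * Real.exp (-(C * ‖x - y‖)) ≤ B a x y) (hC0 : 0 ≤ C) {C' : ℝ} (hC' : C ≤ C')
    (i : ι) (t : ℕ) {K : ℝ≥0∞}
    (hK : ∀ j, ∫⁻ ω, ENNReal.ofReal (Real.exp (3 * C' * ‖Z j t ω‖)) ∂P ≤ K) :
    ∫⁻ ω, ENNReal.ofReal (Real.exp (C' * ‖neighbourMean Z A i t ω‖)) ∂P ≤
      6 * (ENNReal.ofReal c⁻¹ * (K + K)) := by
  have hmeas : ∀ (j : ι) (b : ℝ), Measurable[preEdgeHistory Z A t] fun ω =>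
      Real.exp (b * ‖Z j t ω‖) := fun j b => by
    have h : Measurable fun z : Opinion d => Real.exp (b * ‖z‖) := by fun_prop
    exact h.comp (measurable_pre_node Z A le_rfl j)
  have hF : Measurable[preEdgeHistory Z A t] fun ω => ∑ j, Real.exp (C' * ‖Z j t ω‖) := by
    let _ : MeasurableSpace Ω := preEdgeHistory Z A t
    exact Finset.measurable_sum _ fun j _ => hmeas j C'
  have hle := preEdgeHistory_le hZ hN.measurable t
  have hm2 : ∀ j, Measurable fun ω => ENNReal.ofReal (Real.exp (3 * C' * ‖Z j t ω‖)) :=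
    fun j => ((hmeas j (3 * C')).mono hle le_rfl).ennreal_ofReal
  have hn : (Fintype.card ι : ℝ≥0∞) ≠ 0 := by
    have := Fintype.card_pos_iff.2 ⟨i⟩
    exact_mod_cast this.ne'
  have hcard : ENNReal.ofReal (Fintype.card ι : ℝ)⁻¹ = (Fintype.card ι : ℝ≥0∞)⁻¹ := by
    rw [ENNReal.ofReal_inv_of_pos (by exact_mod_cast Fintype.card_pos_iff.2 ⟨i⟩),
      ENNReal.ofReal_natCast]
  calc _ ≤ ∫⁻ ω, ENNReal.ofReal ((∑ j, Real.exp (C' * ‖Z j t ω‖)) * (degree A i t ω)⁻¹) ∂P := by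
        refine lintegral_mono_ae ?_
        filter_upwards [one_le_degree hN i t] with ω hω
        exact ENNReal.ofReal_le_ofReal (exp_norm_neighbourMean_le hω (hC0.trans hC'))
    _ ≤ 6 * ∫⁻ ω, ENNReal.ofReal ((∑ j, Real.exp (C' * ‖Z j t ω‖)) *
          (meanDegree B₀ B Z A i t ω)⁻¹) ∂P :=
        lintegral_mul_inv_degree_le hB hN hZ i t hF
          fun ω => Finset.sum_nonneg fun j _ => Real.exp_nonneg _
    _ ≤ 6 * ∫⁻ ω, ENNReal.ofReal c⁻¹ * (ENNReal.ofReal (Real.exp (3 * C' * ‖Z i t ω‖)) +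
          (Fintype.card ι : ℝ≥0∞)⁻¹ *
            ∑ j, ENNReal.ofReal (Real.exp (3 * C' * ‖Z j t ω‖))) ∂P := by
        gcongr with ω
        refine (ENNReal.ofReal_le_ofReal
          (sum_mul_inv_meanDegree_le hB hc h0 h1 hC' i hC0 t ω)).trans (le_of_eq ?_)
        rw [ENNReal.ofReal_mul (by positivity), ENNReal.ofReal_add (by positivity) (by positivity),
          ENNReal.ofReal_mul (by positivity), ENNReal.ofReal_sum_of_nonneg fun j _ =>
          Real.exp_nonneg _, hcard]
    _ ≤ _ := by
        rw [lintegral_const_mul _ (by fun_prop), lintegral_add_left (hm2 i),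
          lintegral_const_mul _ (by fun_prop), lintegral_finsetSum _ fun j _ => hm2 j]
        gcongr
        · exact hK i
        · calc _ ≤ (Fintype.card ι : ℝ≥0∞)⁻¹ * ∑ j : ι, K := by gcongr with j; exact hK j
            _ = K := by
              rw [Finset.sum_const, Finset.card_univ, nsmul_eq_mul, ← mul_assoc,
                ENNReal.inv_mul_cancel hn (ENNReal.natCast_ne_top _), one_mul]

/-- The indicator of a distance larger than C is known before the edge is drawn, and the edge
probability vanishes there; so the expectation of its product with the edge indicator is zero. -/
theorem norm_sub_le_of_edge (hN : IsNetwork P B₀ B Z A)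
    (hZ : ∀ i t, Measurable (Z i t)) {C : ℝ}
    (hC : ∀ a x y, C < ‖x - y‖ → B₀ x y = 0 ∧ B a x y = 0) {i j : ι} (hij : i ≠ j) (t : ℕ) :
    ∀ᵐ ω ∂P, A i j t ω = true → ‖Z i t ω - Z j t ω‖ ≤ C := by
  have hle := preEdgeHistory_le hZ hN.measurable t
  let F : Ω → ℝ := {ω | C < ‖Z i t ω - Z j t ω‖}.indicator fun _ => 1
  have hFm : Measurable[preEdgeHistory Z A t] F := by
    let _ : MeasurableSpace Ω := preEdgeHistory Z A t
    refine measurable_const.indicator (measurableSet_lt measurable_const ?_)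
    exact ((measurable_pre_node Z A le_rfl i).sub (measurable_pre_node Z A le_rfl j)).norm
  have hF1 : ∀ ω, |F ω| ≤ 1 := fun ω => by
    by_cases h : C < ‖Z i t ω - Z j t ω‖ <;> simp [F, h]
  have hF0 : ∀ ω, 0 ≤ F ω := fun ω => Set.indicator_nonneg (fun _ _ => zero_le_one) ω
  have h := integral_mul_edgeVal hN hZ hij t hFm hF1
  have h2 : ∀ ω, F ω * edgeProb B₀ B Z A i j t ω = 0 := by
    intro ω
    by_cases hω : C < ‖Z i t ω - Z j t ω‖
    · have : edgeProb B₀ B Z A i j t ω = 0 := by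
        cases t with
        | zero => exact (hC true _ _ hω).1
        | succ t => exact (hC _ _ _ hω).2
      rw [this, mul_zero]
    · simp [F, hω]
  simp only [h2, integral_zero] at h
  rw [integral_eq_zero_iff_of_nonneg (fun ω => mul_nonneg (hF0 ω) (edgeVal_mem _).1)
    (integrable_bounded ((hFm.mono hle le_rfl).mul (measurable_edgeVal (hN.measurable i j t)))
      fun ω => abs_mul_le_of_mem_Icc (hF1 ω) (edgeVal_mem _))] at h
  filter_upwards [h] with ω hω hA
  by_contra hcon
  push Not at hcon
  simp [F, hcon, hA, edgeVal] at hω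

/-- The neighbourhood mean is a convex combination of opinions within distance C of agent i. -/
theorem norm_neighbourMean_le_of_finiteRange (hN : IsNetwork P B₀ B Z A)
    (hZ : ∀ i t, Measurable (Z i t)) {C : ℝ} (hC0 : 0 < C)
    (hC : ∀ a x y, C < ‖x - y‖ → B₀ x y = 0 ∧ B a x y = 0) (i : ι) (t : ℕ) :
    ∀ᵐ ω ∂P, ‖neighbourMean Z A i t ω‖ ≤ ‖Z i t ω‖ + C := by
  have h1 : ∀ᵐ ω ∂P, ∀ j, i ≠ j → A i j t ω = true → ‖Z i t ω - Z j t ω‖ ≤ C := by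
    rw [ae_all_iff]
    intro j
    by_cases hij : i = j
    · simp [hij]
    · filter_upwards [norm_sub_le_of_edge hN hZ hC hij t] with ω hω _ using hω
  filter_upwards [h1, one_le_degree hN i t] with ω hω hD
  rw [neighbourMean_eq]
  calc _ ≤ ∑ j, ((degree A i t ω)⁻¹ * edgeVal (A i j t ω)) * (‖Z i t ω‖ + C) := by
        refine (norm_sum_le _ _).trans (Finset.sum_le_sum fun j _ => ?_)
        rw [norm_smul, Real.norm_eq_abs, abs_of_nonneg (weight_nonneg A i j t ω)]
        cases hA : A i j t ω with
        | false => simp [edgeVal]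
        | true =>
          refine mul_le_mul_of_nonneg_left ?_ (hA ▸ weight_nonneg A i j t ω)
          by_cases hij : i = j
          · rw [← hij]; linarith
          · have h2 := hω j hij hA
            have h3 := norm_sub_norm_le (Z j t ω) (Z i t ω)
            rw [norm_sub_rev] at h3
            linarith
    _ = _ := by rw [← Finset.sum_mul, sum_weight_eq_one hD, one_mul]

end NeighbourMean

/-! ### Uniform exponential moments of the particle systems -/

section Particles

variable {Ω : Type*} [MeasurableSpace Ω] {P : Measure Ω} [IsProbabilityMeasure P] {d : ℕ} {γ : ℝ}
  {B₀ : Opinion d → Opinion d → ℝ} {B : Bool → Opinion d → Opinion d → ℝ}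
  {ξ : ℕ → ℕ → Ω → Opinion d} {Z : (n : ℕ) → Fin n → ℕ → Ω → Opinion d}
  {A : (n : ℕ) → Fin n → Fin n → ℕ → Ω → Bool} {μ₀ : Measure (Opinion d)}
  [IsProbabilityMeasure μ₀]

/-- All exponential moments of the opinions at time `t` are bounded, uniformly over the agents of
large systems. -/
def MomentBound (P : Measure Ω) (Z : (n : ℕ) → Fin n → ℕ → Ω → Opinion d) (t : ℕ) : Prop :=
  ∀ C : ℝ, ∃ K : ℝ≥0∞, K < ⊤ ∧ ∀ᶠ m : ℕ in atTop, ∀ i : Fin (m + 1),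
    ∫⁻ ω, ENNReal.ofReal (Real.exp (C * ‖Z (m + 1) i t ω‖)) ∂P ≤ K

theorem measurable_ofReal_exp_norm (C : ℝ) :
    Measurable fun x : Opinion d => ENNReal.ofReal (Real.exp (C * ‖x‖)) := by fun_prop

/-- Exchangeability transports the assumed bound for the first agent to all agents, by swapping the
two. -/
theorem momentBound_zero (hinit : IsInitial P (fun n i => Z n i 0) μ₀)
    (hbds : HasBounds P B₀ B ξ (fun n i => Z n i 0)) : MomentBound P Z 0 := by
  intro C
  obtain ⟨K, hK1, hK2⟩ := exists_between (hbds.init C)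
  refine ⟨K, hK2, ?_⟩
  filter_upwards [eventually_lt_of_limsup_lt hK1] with m hm i
  have h := ((hinit.exchangeable (m + 1) (Equiv.swap 0 i)).comp (u := fun x : Fin (m + 1) →
    Opinion d => ENNReal.ofReal (Real.exp (C * ‖x 0‖)))
    ((measurable_ofReal_exp_norm C).comp (measurable_pi_apply 0))).lintegral_eq
  simp only [Function.comp_apply, Equiv.swap_apply_left] at h
  rw [h]
  exact hm.le

theorem exists_neighbourMean_bound (hB : IsInteraction B₀ B)
    (hsys : IsParticleSystem P γ B₀ B ξ Z A) (hint : ExpDecay B₀ B ∨ FiniteRange B₀ B) {t : ℕ}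
    (hmom : MomentBound P Z t) {C : ℝ} (hC : 0 ≤ C) :
    ∃ K : ℝ≥0∞, K < ⊤ ∧ ∀ᶠ m : ℕ in atTop, ∀ i : Fin (m + 1),
      ∫⁻ ω, ENNReal.ofReal (Real.exp (C * ‖neighbourMean (Z (m + 1)) (A (m + 1)) i t ω‖)) ∂P
        ≤ K := by
  rcases hint with hE | hR
  · obtain ⟨Cb, hCb, c, hc, h0, h1⟩ := hE.exists_lower hB
    obtain ⟨K, hK, hev⟩ := hmom (3 * max C Cb)
    refine ⟨6 * (ENNReal.ofReal c⁻¹ * (K + K)), ?_, ?_⟩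
    · exact ENNReal.mul_lt_top (by simp) (ENNReal.mul_lt_top ENNReal.ofReal_lt_top
        (ENNReal.add_lt_top.2 ⟨hK, hK⟩))
    · filter_upwards [hev] with m hm i
      refine le_trans (lintegral_mono fun ω => ENNReal.ofReal_le_ofReal (Real.exp_le_exp.2
        (mul_le_mul_of_nonneg_right (le_max_left C Cb) (norm_nonneg _)))) ?_
      exact lintegral_exp_neighbourMean_le_of_expDecay hB (hsys.network (m + 1))
        (hsys.measurable_opinion (m + 1)) hc h0 h1 hCb.le (le_max_right _ _) i t hm
  · obtain ⟨⟨Cb, hCb, hzero⟩, -⟩ := hR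
    obtain ⟨K, hK, hev⟩ := hmom C
    refine ⟨ENNReal.ofReal (Real.exp (C * Cb)) * K,
      ENNReal.mul_lt_top ENNReal.ofReal_lt_top hK, ?_⟩
    filter_upwards [hev] with m hm i
    calc _ ≤ ∫⁻ ω, ENNReal.ofReal (Real.exp (C * Cb)) *
          ENNReal.ofReal (Real.exp (C * ‖Z (m + 1) i t ω‖)) ∂P := by
          refine lintegral_mono_ae ?_
          filter_upwards [norm_neighbourMean_le_of_finiteRange (hsys.network (m + 1))
            (hsys.measurable_opinion (m + 1)) hCb hzero i t] with ω hω
          rw [← ENNReal.ofReal_mul (Real.exp_nonneg _), ← Real.exp_add]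
          refine ENNReal.ofReal_le_ofReal (Real.exp_le_exp.2 ?_)
          nlinarith
      _ ≤ _ := by
          have h : Measurable fun ω => ENNReal.ofReal (Real.exp (C * ‖Z (m + 1) i t ω‖)) :=
            (measurable_ofReal_exp_norm C).comp (hsys.measurable_opinion (m + 1) i t)
          rw [lintegral_const_mul _ h]
          gcongr
          exact hm i

theorem exp_add_three_le (C a b c : ℝ) :
    Real.exp (C * (a + b + c)) ≤
      Real.exp (3 * C * a) + Real.exp (3 * C * b) + Real.exp (3 * C * c) := by
  have h := convexOn_exp.map_sum_le (t := Finset.univ) (w := fun _ : Fin 3 => (1 / 3 : ℝ))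
    (p := ![3 * C * a, 3 * C * b, 3 * C * c]) (fun _ _ => by norm_num)
    (by simp) (fun _ _ => Set.mem_univ _)
  simp only [Fin.sum_univ_three, smul_eq_mul, Matrix.cons_val_zero, Matrix.cons_val_one,
    Matrix.cons_val] at h
  have h1 : (1 / 3 * (3 * C * a) + 1 / 3 * (3 * C * b) + 1 / 3 * (3 * C * c)) = C * (a + b + c) := by
    ring
  rw [h1] at h
  have := Real.exp_nonneg (3 * C * a)
  have := Real.exp_nonneg (3 * C * b)
  have := Real.exp_nonneg (3 * C * c)
  linarith

/-- Convexity splits the exponential of own opinion, neighbourhood mean and noise into three terms,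
at the price of tripling the exponent. The loss is harmless because `MomentBound` covers all
exponents. -/
theorem momentBound_succ (hγ : γ ∈ Set.Ioo (0 : ℝ) 1) (hB : IsInteraction B₀ B)
    (hsys : IsParticleSystem P γ B₀ B ξ Z A) (hbds : HasBounds P B₀ B ξ (fun n i => Z n i 0))
    {t : ℕ} (hmom : MomentBound P Z t) : MomentBound P Z (t + 1) := by
  intro C
  obtain ⟨K1, hK1, hev1⟩ := hmom (3 * |C|)
  obtain ⟨K2, hK2, hev2⟩ := exists_neighbourMean_bound hB hsys hbds.interaction hmom
    (by positivity : 0 ≤ 3 * |C|)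
  refine ⟨K1 + K2 + ∫⁻ ω, ENNReal.ofReal (Real.exp (3 * |C| * ‖ξ 0 0 ω‖)) ∂P,
    ENNReal.add_lt_top.2 ⟨ENNReal.add_lt_top.2 ⟨hK1, hK2⟩, hbds.noise _⟩, ?_⟩
  filter_upwards [hev1, hev2] with m hm1 hm2 i
  have hξ := ((hsys.noise_identDistrib i t).comp
    (measurable_ofReal_exp_norm (3 * |C|))).lintegral_eq
  simp only [Function.comp_apply] at hξ
  have hmL := measurable_neighbourMean (hsys.measurable_opinion (m + 1))
    (hsys.network (m + 1)).measurable i t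
  have m1 := (measurable_ofReal_exp_norm (3 * |C|)).comp (hsys.measurable_opinion (m + 1) i t)
  have m2 := (measurable_ofReal_exp_norm (3 * |C|)).comp hmL
  calc _ ≤ ∫⁻ ω, (ENNReal.ofReal (Real.exp (3 * |C| * ‖Z (m + 1) i t ω‖)) +
        ENNReal.ofReal (Real.exp (3 * |C| * ‖neighbourMean (Z (m + 1)) (A (m + 1)) i t ω‖)) +
        ENNReal.ofReal (Real.exp (3 * |C| * ‖ξ i t ω‖))) ∂P := by
        refine lintegral_mono_ae ?_
        filter_upwards [hsys.opinion_step (m + 1) i t] with ω hω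
        rw [← ENNReal.ofReal_add (Real.exp_nonneg _) (Real.exp_nonneg _),
          ← ENNReal.ofReal_add (by positivity) (Real.exp_nonneg _)]
        refine ENNReal.ofReal_le_ofReal (le_trans (Real.exp_le_exp.2 ?_) (exp_add_three_le _ _ _ _))
        refine (mul_le_mul_of_nonneg_right (le_abs_self C) (norm_nonneg _)).trans
          (mul_le_mul_of_nonneg_left ?_ (abs_nonneg C))
        rw [hω]
        refine (norm_add₃_le).trans ?_
        rw [norm_smul, norm_smul, Real.norm_eq_abs, Real.norm_eq_abs, abs_of_pos hγ.1,
          abs_of_pos (sub_pos.2 hγ.2)]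
        have h1 := mul_le_of_le_one_left (norm_nonneg (Z (m + 1) i t ω)) (by linarith [hγ.1] :
          1 - γ ≤ 1)
        have h2 := mul_le_of_le_one_left
          (norm_nonneg (neighbourMean (Z (m + 1)) (A (m + 1)) i t ω)) hγ.2.le
        linarith
    _ ≤ _ := by
        rw [lintegral_add_left, lintegral_add_left, hξ]
        · gcongr
          · exact hm1 i
          · exact hm2 i
        · exact m1
        · exact m1.add m2

theorem momentBound (hγ : γ ∈ Set.Ioo (0 : ℝ) 1) (hB : IsInteraction B₀ B)
    (hsys : IsParticleSystem P γ B₀ B ξ Z A) (hinit : IsInitial P (fun n i => Z n i 0) μ₀)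
    (hbds : HasBounds P B₀ B ξ (fun n i => Z n i 0)) (t : ℕ) : MomentBound P Z t := by
  induction t with
  | zero => exact momentBound_zero hinit hbds
  | succ t ih => exact momentBound_succ hγ hB hsys hbds ih

/-! ### The initial opinions of arbitrary agents -/

theorem exists_perm_extending {k n : ℕ} {I J : Fin k → Fin n} (hI : Function.Injective I)
    (hJ : Function.Injective J) : ∃ σ : Equiv.Perm (Fin n), ∀ i, σ (I i) = J i := by
  classical
  let e : {x // x ∈ Set.range I} ≃ {x // x ∈ Set.range J} :=
    (Equiv.ofInjective I hI).symm.trans (Equiv.ofInjective J hJ)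
  refine ⟨e.extendSubtype, fun i => ?_⟩
  rw [Equiv.extendSubtype_apply_of_mem e _ (Set.mem_range_self i)]
  have : (⟨I i, Set.mem_range_self i⟩ : Set.range I) = Equiv.ofInjective I hI i := rfl
  simp only [e, Equiv.trans_apply]
  erw [this]
  simp

/-- A permutation taking the first k agents to any k distinct agents preserves the law of the
initial opinions. -/
theorem integral_initial_eq (hinit : IsInitial P (fun n i => Z n i 0) μ₀) {k : ℕ}
    {f : (Fin k → Opinion d) → ℝ} (hf : Measurable f) {n m : ℕ} (hn : n = m + k)
    {J : Fin k → Fin n} (hJ : Function.Injective J) :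
    ∫ ω, f (fun i => Z n (J i) 0 ω) ∂P =
      ∫ ω, f (fun i => Z (m + k) (Fin.castLE (Nat.le_add_left k m) i) 0 ω) ∂P := by
  subst hn
  obtain ⟨σ, hσ⟩ := exists_perm_extending (Fin.castLE_injective (Nat.le_add_left k m)) hJ
  have h := ((hinit.exchangeable (m + k) σ).comp (u := fun x : Fin (m + k) → Opinion d =>
    f fun i => x (Fin.castLE (Nat.le_add_left k m) i))
    (hf.comp (measurable_pi_lambda _ fun i => measurable_pi_apply _))).integral_eq
  simpa only [Function.comp_apply, hσ] using h

theorem tendsto_integral_initial (hinit : IsInitial P (fun n i => Z n i 0) μ₀) {k : ℕ}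
    {J : (m : ℕ) → Fin k → Fin (m + 1)} (hJ : ∀ᶠ m in atTop, Function.Injective (J m))
    {f : (Fin k → Opinion d) → ℝ} (hf : Continuous f) {M : ℝ} (hM : ∀ x, |f x| ≤ M) :
    Tendsto (fun m => ∫ ω, f (fun i => Z (m + 1) (J m i) 0 ω) ∂P) atTop
      (𝓝 (∫ x, f x ∂Measure.pi fun _ : Fin k => μ₀)) := by
  have ht := hinit.tendsto k
  have h1 := (ProbabilityMeasure.tendsto_iff_forall_integral_tendsto.1 ht.tendsto)
    (BoundedContinuousFunction.ofNormedAddCommGroup f hf M hM)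
  simp only [ProbabilityMeasure.coe_mk, BoundedContinuousFunction.coe_ofNormedAddCommGroup,
    Measure.map_id] at h1
  have h2 : ∀ m, ∫ x, f x ∂(P.map fun ω (i : Fin k) =>
      Z (m + k) (Fin.castLE (Nat.le_add_left k m) i) 0 ω) =
      ∫ ω, f (fun i => Z (m + k) (Fin.castLE (Nat.le_add_left k m) i) 0 ω) ∂P := fun m =>
    integral_map (ht.forall_aemeasurable m) hf.aestronglyMeasurable
  simp only [h2] at h1
  rw [Metric.tendsto_atTop] at h1 ⊢
  intro ε hε
  obtain ⟨N, hN⟩ := h1 ε hε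
  obtain ⟨N', hN'⟩ := eventually_atTop.1 hJ
  -- The system of m + 1 agents has index m + 1 - k in the assumed convergence, which must exceed N.
  refine ⟨max N' (N + k), fun m hm => ?_⟩
  have hm1 : N' ≤ m := (le_max_left _ _).trans hm
  have hm2 : N + k ≤ m := (le_max_right _ _).trans hm
  rw [integral_initial_eq hinit hf.measurable (by omega : m + 1 = (m + 1 - k) + k) (hN' m hm1)]
  exact hN _ (by omega)

end Particles

/-! ### Propagation of chaos and the law of large numbers -/

theorem prod_same {κ X : Type*} [Fintype κ] [DecidableEq κ] [DecidableEq X] (x a : κ → X) :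
    ∏ e, same (x e) (a e) = if x = a then 1 else 0 := by
  split_ifs with h
  · simp [h, same]
  · obtain ⟨e, he⟩ := Function.ne_iff.1 h
    exact Finset.prod_eq_zero (Finset.mem_univ e) (by simp [same, he])

/-- There are finitely many edge paths, so any function of them is a finite combination of the
indicators that occur in `Chaos`. -/
theorem sum_mul_prod_same {κ X : Type*} [Fintype κ] [DecidableEq κ] [Fintype X] [DecidableEq X]
    (F : (κ → X) → ℝ) (x : κ → X) : ∑ a, F a * ∏ e, same (x e) (a e) = F x := by
  simp [prod_same]

theorem measurePreserving_eval_triple {X : Type*} [MeasurableSpace X] (μ : Measure X)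
    [IsProbabilityMeasure μ] :
    MeasurePreserving (fun z : Fin 3 → X => (z 0, (z 1, z 2))) (Measure.pi fun _ => μ)
      (μ.prod (μ.prod μ)) := by
  refine ⟨by fun_prop, ?_⟩
  have h := ((iIndepFun_pi (μ := fun _ : Fin 3 => μ) (X := fun _ x => x)
    (fun _ => aemeasurable_id)).indepFun_prodMk (fun i => measurable_pi_apply i) 1 2 0
    (by decide) (by decide)).symm
  rw [(indepFun_iff_map_prod_eq_prod_map_map (measurable_pi_apply 0).aemeasurable
    (by fun_prop)).1 h]
  congr 1
  · exact (measurePreserving_eval (fun _ : Fin 3 => μ) 0).map_eq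
  · exact (measurePreserving_eval_pair (κ := Fin 3) μ (by decide : (1 : Fin 3) ≠ 2)).map_eq

/-- Given the first coordinate, the two vectors are independent with mean zero, and the inner
product is bilinear. -/
theorem integral_inner_conditional_eq_zero {X H : Type*} [MeasurableSpace X]
    [NormedAddCommGroup H] [InnerProductSpace ℝ H] [CompleteSpace H] [MeasurableSpace H]
    [BorelSpace H] [SecondCountableTopology H] {μ : Measure X} [IsProbabilityMeasure μ]
    {f : X → X → H} (hf : Measurable (Function.uncurry f)) {M : ℝ} (hM : ∀ x y, ‖f x y‖ ≤ M)
    (h0 : ∀ x, ∫ y, f x y ∂μ = 0) :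
    ∫ z, inner ℝ (f (z 0) (z 1)) (f (z 0) (z 2)) ∂(Measure.pi fun _ : Fin 3 => μ) = 0 := by
  have hbound : ∀ x y w, ‖inner ℝ (f x y) (f x w)‖ ≤ M * M := fun x y w =>
    (norm_inner_le_norm _ _).trans (mul_le_mul (hM x y) (hM x w) (norm_nonneg _)
      ((norm_nonneg _).trans (hM x y)))
  have hm : Measurable fun p : X × (X × X) => inner ℝ (f p.1 p.2.1) (f p.1 p.2.2) :=
    Measurable.inner (hf.comp (by fun_prop : Measurable fun p : X × (X × X) => (p.1, p.2.1)))
      (hf.comp (by fun_prop : Measurable fun p : X × (X × X) => (p.1, p.2.2)))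
  have h1 := integral_map (μ := Measure.pi fun _ : Fin 3 => μ)
    (measurePreserving_eval_triple μ).measurable.aemeasurable hm.aestronglyMeasurable
  rw [(measurePreserving_eval_triple μ).map_eq] at h1
  rw [← h1, integral_prod _ (Integrable.of_bound hm.aestronglyMeasurable (M * M)
    (ae_of_all _ fun p => hbound _ _ _))]
  refine integral_eq_zero_of_ae (ae_of_all _ fun x => ?_)
  have hmx : Measurable fun p : X × X => inner ℝ (f x p.1) (f x p.2) :=
    hm.comp measurable_prodMk_left
  simp only [Pi.zero_apply]
  rw [integral_prod _ (Integrable.of_bound hmx.aestronglyMeasurable (M * M)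
    (ae_of_all _ fun p => hbound _ _ _))]
  refine integral_eq_zero_of_ae (ae_of_all _ fun y => ?_)
  simp only [Pi.zero_apply]
  have hI : Integrable (fun w => f x w) μ := Integrable.of_bound
    (hf.comp measurable_prodMk_left).aestronglyMeasurable M (ae_of_all _ fun w => hM x w)
  rw [integral_inner hI, h0 x, inner_zero_right]

section Chaos

variable {Ω : Type*} [MeasurableSpace Ω] {P : Measure Ω} [IsProbabilityMeasure P] {d : ℕ} {γ : ℝ}
  {B₀ : Opinion d → Opinion d → ℝ} {B : Bool → Opinion d → Opinion d → ℝ}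
  {Z : (n : ℕ) → Fin n → ℕ → Ω → Opinion d}
  {A : (n : ℕ) → Fin n → Fin n → ℕ → Ω → Bool} {μ₀ ν : Measure (Opinion d)}
  [IsProbabilityMeasure μ₀] [IsProbabilityMeasure ν]

/-- Propagation of chaos up to time `t`: the trajectories of boundedly many agents become
independent with law `limLaw`, and given these the edge paths become independent with law
`edgeLaw`. -/
def Chaos (P : Measure Ω) (γ : ℝ) (B₀ : Opinion d → Opinion d → ℝ)
    (B : Bool → Opinion d → Opinion d → ℝ) (μ₀ ν : Measure (Opinion d))
    (Z : (n : ℕ) → Fin n → ℕ → Ω → Opinion d) (A : (n : ℕ) → Fin n → Fin n → ℕ → Ω → Bool)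
    (t : ℕ) : Prop :=
  ∀ (k r : ℕ) (p q : Fin r → Fin k), IsSimpleFamily p q →
    ∀ J : (m : ℕ) → Fin k → Fin (m + 1), (∀ᶠ m in atTop, Function.Injective (J m)) →
    ∀ (a : Fin r → Traj Bool t) (G : (Fin k → Traj (Opinion d) t) → ℝ) (M : ℝ),
    Measurable G → (∀ z, |G z| ≤ M) →
    (∀ᵐ z ∂(Measure.pi fun _ : Fin k => limLaw γ B₀ B μ₀ ν t), ContinuousAt G z) →
    Tendsto (fun m => ∫ ω, G (fun i => traj (Z (m + 1) (J m i)) t ω) *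
      ∏ e, same (traj (A (m + 1) (J m (p e)) (J m (q e))) t ω) (a e) ∂P) atTop
      (𝓝 (∫ z, G z * ∏ e, edgeLaw B₀ B t (z (p e)) (z (q e)) (a e)
        ∂(Measure.pi fun _ : Fin k => limLaw γ B₀ B μ₀ ν t)))

/-- The limiting conditional mean, given the trajectory `x`, of `f` at a pair of agents. -/
noncomputable def pairMean {H : Type*} [NormedAddCommGroup H] [NormedSpace ℝ H]
    (B₀ : Opinion d → Opinion d → ℝ) (B : Bool → Opinion d → Opinion d → ℝ) (t : ℕ)
    (μ : Measure (Traj (Opinion d) t))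
    (f : Traj Bool t → Traj (Opinion d) t → Traj (Opinion d) t → H)
    (x : Traj (Opinion d) t) : H := ∫ y, ∑ a, edgeLaw B₀ B t x y a • f a x y ∂μ

section PairMean

variable {H : Type*} [NormedAddCommGroup H] [NormedSpace ℝ H] [MeasurableSpace H]
  [BorelSpace H] [SecondCountableTopology H] {t : ℕ}
  {f : Traj Bool t → Traj (Opinion d) t → Traj (Opinion d) t → H}

theorem norm_sum_edgeLaw_smul_le (hB : IsInteraction B₀ B) {x y : Traj (Opinion d) t}
    {M : ℝ} (hM : ∀ a, ‖f a x y‖ ≤ M) : ‖∑ a, edgeLaw B₀ B t x y a • f a x y‖ ≤ M := by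
  calc _ ≤ ∑ a, edgeLaw B₀ B t x y a * M := by
        refine (norm_sum_le _ _).trans (Finset.sum_le_sum fun a _ => ?_)
        have h := (edgeLaw_mem hB t x y a).1
        rw [norm_smul, Real.norm_eq_abs, abs_of_nonneg h]
        exact mul_le_mul_of_nonneg_left (hM a) h
    _ = M := by rw [← Finset.sum_mul, sum_edgeLaw, one_mul]

theorem measurable_sum_edgeLaw_smul (hB : IsInteraction B₀ B)
    (hf : ∀ a, Measurable fun p : Traj (Opinion d) t × Traj (Opinion d) t => f a p.1 p.2) :
    Measurable (Function.uncurry fun x y => ∑ a, edgeLaw B₀ B t x y a • f a x y) :=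
  Finset.measurable_sum _ fun a _ => (measurable_edgeLaw hB t a).smul (hf a)

theorem measurable_pairMean (hB : IsInteraction B₀ B) {μ : Measure (Traj (Opinion d) t)}
    [SFinite μ]
    (hf : ∀ a, Measurable fun p : Traj (Opinion d) t × Traj (Opinion d) t => f a p.1 p.2) :
    Measurable (pairMean B₀ B t μ f) :=
  measurable_integral_left (measurable_sum_edgeLaw_smul hB hf)

theorem norm_pairMean_le (hB : IsInteraction B₀ B) {μ : Measure (Traj (Opinion d) t)}
    [IsProbabilityMeasure μ] {M : ℝ} (hM : ∀ a x y, ‖f a x y‖ ≤ M) (x : Traj (Opinion d) t) :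
    ‖pairMean B₀ B t μ f x‖ ≤ M := by
  have := norm_integral_le_of_norm_le_const (μ := μ)
    (ae_of_all _ fun y => norm_sum_edgeLaw_smul_le hB fun a => hM a x y)
  simpa [pairMean] using this

theorem ae_continuousAt_pairMean (hB : IsInteraction B₀ B) (hμ₀ : μ₀ ≪ volume)
    (hν : ν ≪ volume)
    (hf : ∀ a, Measurable fun p : Traj (Opinion d) t × Traj (Opinion d) t => f a p.1 p.2)
    {b : Traj (Opinion d) t → ℝ} (hb : Integrable b (limLaw γ B₀ B μ₀ ν t))
    (hM : ∀ a x y, ‖f a x y‖ ≤ b y)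
    (hfc : ∀ a, ∀ᵐ p ∂((limLaw γ B₀ B μ₀ ν t).prod (limLaw γ B₀ B μ₀ ν t)),
      ContinuousAt (fun p : Traj (Opinion d) t × Traj (Opinion d) t => f a p.1 p.2) p) :
    ∀ᵐ x ∂(limLaw γ B₀ B μ₀ ν t),
      ContinuousAt (pairMean B₀ B t (limLaw γ B₀ B μ₀ ν t) f) x := by
  have := isProbabilityMeasure_limLaw (γ := γ) (μ₀ := μ₀) (ν := ν) hB t
  refine ae_continuousAt_integral (measurable_sum_edgeLaw_smul hB hf) hb
    (fun x y => norm_sum_edgeLaw_smul_le hB fun a => hM a x y) ?_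
  filter_upwards [ae_all_iff.2 hfc, ae_all_iff.2 (ae_continuousAt_edgeLaw hB hμ₀ hν t)] with p h1 h2
  exact tendsto_finsetSum _ fun a _ => (h2 a).smul (h1 a)

end PairMean

variable {H : Type*} [NormedAddCommGroup H] [InnerProductSpace ℝ H] [CompleteSpace H]
  [MeasurableSpace H] [BorelSpace H] [SecondCountableTopology H] {t : ℕ}

/-- Chaos for three agents and the edges ij and il. After summing over both edge paths, the limit is
the inner product of two conditionally independent vectors whose conditional mean is zero by `h0`.
-/
theorem Chaos.tendsto_integral_inner (hB : IsInteraction B₀ B)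
    (hch : Chaos P γ B₀ B μ₀ ν Z A t)
    (hZ : ∀ n i t, Measurable (Z n i t)) (hA : ∀ n i j t, Measurable (A n i j t))
    {f : Traj Bool t → Traj (Opinion d) t → Traj (Opinion d) t → H}
    (hf : ∀ a, Measurable fun p : Traj (Opinion d) t × Traj (Opinion d) t => f a p.1 p.2)
    {M : ℝ} (hM : ∀ a x y, ‖f a x y‖ ≤ M)
    (hfc : ∀ a, ∀ᵐ p ∂((limLaw γ B₀ B μ₀ ν t).prod (limLaw γ B₀ B μ₀ ν t)),
      ContinuousAt (fun p : Traj (Opinion d) t × Traj (Opinion d) t => f a p.1 p.2) p)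
    (h0 : ∀ x, pairMean B₀ B t (limLaw γ B₀ B μ₀ ν t) f x = 0)
    {i j l : (m : ℕ) → Fin (m + 1)} (hijl : ∀ᶠ m in atTop, i m ≠ j m ∧ i m ≠ l m ∧ j m ≠ l m) :
    Tendsto (fun m => ∫ ω, inner ℝ
      (f (traj (A (m + 1) (i m) (j m)) t ω) (traj (Z (m + 1) (i m)) t ω)
        (traj (Z (m + 1) (j m)) t ω))
      (f (traj (A (m + 1) (i m) (l m)) t ω) (traj (Z (m + 1) (i m)) t ω)
        (traj (Z (m + 1) (l m)) t ω)) ∂P) atTop (𝓝 0) := by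
  have := isProbabilityMeasure_limLaw (γ := γ) (μ₀ := μ₀) (ν := ν) hB t
  set μ := limLaw γ B₀ B μ₀ ν t with hμ
  let J : (m : ℕ) → Fin 3 → Fin (m + 1) := fun m => ![i m, j m, l m]
  have hJ : ∀ᶠ m in atTop, Function.Injective (J m) := by
    filter_upwards [hijl] with m hm x y hxy
    fin_cases x <;> fin_cases y <;>
      simp_all [J, hm.1.symm, hm.2.1.symm, hm.2.2.symm]
  -- Agent 0 stands for i, agents 1 and 2 for j and l.
  have hpq : IsSimpleFamily (![0, 0] : Fin 2 → Fin 3) ![1, 2] :=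
    ⟨by decide, by decide, by decide⟩
  let G : (Fin 2 → Traj Bool t) → (Fin 3 → Traj (Opinion d) t) → ℝ := fun a z =>
    inner ℝ (f (a 0) (z 0) (z 1)) (f (a 1) (z 0) (z 2))
  have hGb : ∀ a z, |G a z| ≤ M * M := fun a z =>
    (abs_real_inner_le_norm _ _).trans (mul_le_mul (hM _ _ _) (hM _ _ _) (norm_nonneg _)
      ((norm_nonneg _).trans (hM (a 0) (z 0) (z 1))))
  have hGm : ∀ a, Measurable (G a) := fun a =>
    Measurable.inner ((hf (a 0)).comp (by fun_prop : Measurable fun z :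
      Fin 3 → Traj (Opinion d) t => (z 0, z 1))) ((hf (a 1)).comp (by fun_prop : Measurable fun z :
      Fin 3 → Traj (Opinion d) t => (z 0, z 2)))
  have hGc : ∀ a, ∀ᵐ z ∂(Measure.pi fun _ : Fin 3 => μ), ContinuousAt (G a) z := by
    intro a
    filter_upwards [(measurePreserving_eval_pair (κ := Fin 3) μ
      (by decide : (0 : Fin 3) ≠ 1)).quasiMeasurePreserving.ae (hfc (a 0)),
      (measurePreserving_eval_pair (κ := Fin 3) μ
      (by decide : (0 : Fin 3) ≠ 2)).quasiMeasurePreserving.ae (hfc (a 1))] with z h1 h2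
    exact (ContinuousAt.comp (f := fun z : Fin 3 → Traj (Opinion d) t => (z 0, z 1)) (x := z) h1
      (by fun_prop)).inner (𝕜 := ℝ) (ContinuousAt.comp
      (f := fun z : Fin 3 → Traj (Opinion d) t => (z 0, z 2)) (x := z) h2 (by fun_prop))
  have hlim := tendsto_finsetSum (Finset.univ : Finset (Fin 2 → Traj Bool t)) fun a _ =>
    hch 3 2 _ _ hpq J hJ a (G a) (M * M) (hGm a) (hGb a) (hGc a)
  have hprodm : ∀ (a : Fin 2 → Traj Bool t), Measurable fun z : Fin 3 → Traj (Opinion d) t =>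
      ∏ e : Fin 2, edgeLaw B₀ B t (z ((![0, 0] : Fin 2 → Fin 3) e))
        (z ((![1, 2] : Fin 2 → Fin 3) e)) (a e) := fun a =>
    Finset.measurable_prod _ fun e _ => by
      have h := (measurable_edgeLaw hB t (a e)).comp
        (by fun_prop : Measurable fun z : Fin 3 → Traj (Opinion d) t =>
          (z ((![0, 0] : Fin 2 → Fin 3) e), z ((![1, 2] : Fin 2 → Fin 3) e)))
      exact h
  have hzero : ∑ a : Fin 2 → Traj Bool t, ∫ z, G a z *
      ∏ e : Fin 2, edgeLaw B₀ B t (z ((![0, 0] : Fin 2 → Fin 3) e))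
        (z ((![1, 2] : Fin 2 → Fin 3) e)) (a e) ∂(Measure.pi fun _ : Fin 3 => μ) = 0 := by
    rw [← integral_finsetSum]
    · rw [← integral_inner_conditional_eq_zero (measurable_sum_edgeLaw_smul hB hf)
        (fun x y => norm_sum_edgeLaw_smul_le hB fun a => hM a x y) h0]
      refine integral_congr_ae (ae_of_all _ fun z => ?_)
      simp only [sum_inner, inner_sum, real_inner_smul_left, real_inner_smul_right]
      rw [← (finTwoArrowEquiv (Traj Bool t)).symm.sum_comp, Fintype.sum_prod_type, Finset.sum_comm]
      refine Finset.sum_congr rfl fun a _ => Finset.sum_congr rfl fun a' _ => ?_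
      simp [G, Fin.prod_univ_two]
      ring
    · intro a _
      exact integrable_bounded ((hGm a).mul (hprodm a)) fun z =>
        abs_mul_le_of_mem_Icc (hGb a z) (prod_mem_Icc fun e => edgeLaw_mem hB t _ _ _)
  rw [hzero] at hlim
  refine hlim.congr fun m => ?_
  have hT : ∀ i, Measurable (traj (Z (m + 1) i) t) := fun i => measurable_traj (hZ (m + 1) i) t
  have hTA : ∀ i j, Measurable (traj (A (m + 1) i j) t) := fun i j =>
    measurable_traj (hA (m + 1) i j) t
  rw [← integral_finsetSum]
  · refine integral_congr_ae (ae_of_all _ fun ω => ?_)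
    refine (sum_mul_prod_same (fun a => G a fun x => traj (Z (m + 1) (J m x)) t ω)
      (fun e => traj (A (m + 1) (J m ((![0, 0] : Fin 2 → Fin 3) e))
        (J m ((![1, 2] : Fin 2 → Fin 3) e))) t ω)).trans ?_
    simp [G, J]
  · intro a _
    refine integrable_bounded (M := M * M) (((hGm a).comp (measurable_pi_lambda _ fun x => hT _)).mul
      (Finset.measurable_prod _ fun e _ => measurable_same (hTA _ _) _)) fun ω =>
      abs_mul_le_of_mem_Icc (hGb a fun x => traj (Z (m + 1) (J m x)) t ω)
        (prod_mem_Icc fun e => same_mem _ _)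

/-- Expand the square of the average of the centred functions into a double sum over j and l: pairs
that are distinct and avoid i are asymptotically uncorrelated, the others are too few to matter.
Centring preserves almost everywhere continuity by `ae_continuousAt_pairMean`. -/
theorem Chaos.tendsto_lln (hB : IsInteraction B₀ B) (hμ₀ : μ₀ ≪ volume) (hν : ν ≪ volume)
    (hch : Chaos P γ B₀ B μ₀ ν Z A t)
    (hZ : ∀ n i t, Measurable (Z n i t)) (hA : ∀ n i j t, Measurable (A n i j t))
    {f : Traj Bool t → Traj (Opinion d) t → Traj (Opinion d) t → H}
    (hf : ∀ a, Measurable fun p : Traj (Opinion d) t × Traj (Opinion d) t => f a p.1 p.2)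
    {M : ℝ} (hM : ∀ a x y, ‖f a x y‖ ≤ M)
    (hfc : ∀ a, ∀ᵐ p ∂((limLaw γ B₀ B μ₀ ν t).prod (limLaw γ B₀ B μ₀ ν t)),
      ContinuousAt (fun p : Traj (Opinion d) t × Traj (Opinion d) t => f a p.1 p.2) p)
    (i : (m : ℕ) → Fin (m + 1)) :
    Tendsto (fun m : ℕ => ∫ ω, ‖((m : ℝ) + 1)⁻¹ • ∑ j, f (traj (A (m + 1) (i m) j) t ω)
        (traj (Z (m + 1) (i m)) t ω) (traj (Z (m + 1) j) t ω) -
        pairMean B₀ B t (limLaw γ B₀ B μ₀ ν t) f (traj (Z (m + 1) (i m)) t ω)‖ ^ 2 ∂P) atTop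
      (𝓝 0) := by
  have := isProbabilityMeasure_limLaw (γ := γ) (μ₀ := μ₀) (ν := ν) hB t
  set μ := limLaw γ B₀ B μ₀ ν t with hμ
  let h : Traj Bool t → Traj (Opinion d) t → Traj (Opinion d) t → H :=
    fun a x y => f a x y - pairMean B₀ B t μ f x
  have hpm : Measurable (pairMean B₀ B t μ f) := measurable_pairMean hB hf
  have hhm : ∀ a, Measurable fun p : Traj (Opinion d) t × Traj (Opinion d) t => h a p.1 p.2 :=
    fun a => (hf a).sub (hpm.comp measurable_fst)
  have hhM : ∀ a x y, ‖h a x y‖ ≤ M + M := fun a x y =>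
    (norm_sub_le _ _).trans (add_le_add (hM a x y) (norm_pairMean_le hB hM x))
  have hhc : ∀ a, ∀ᵐ p ∂(μ.prod μ),
      ContinuousAt (fun p : Traj (Opinion d) t × Traj (Opinion d) t => h a p.1 p.2) p := by
    intro a
    filter_upwards [hfc a, (Measure.quasiMeasurePreserving_fst (μ := μ) (ν := μ)).ae
      (ae_continuousAt_pairMean hB hμ₀ hν hf (integrable_const M) hM hfc)] with p h1 h2
    exact h1.sub (ContinuousAt.comp (f := fun p : Traj (Opinion d) t × Traj (Opinion d) t => p.1)
      (x := p) h2 (by fun_prop))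
  have hh0 : ∀ x, pairMean B₀ B t μ h x = 0 := by
    intro x
    have e1 : ∀ y, ∑ a, edgeLaw B₀ B t x y a • h a x y =
        ∑ a, edgeLaw B₀ B t x y a • f a x y - pairMean B₀ B t μ f x := by
      intro y
      simp only [h, smul_sub, Finset.sum_sub_distrib]
      rw [← Finset.sum_smul, sum_edgeLaw, one_smul]
    unfold pairMean
    simp only [e1]
    rw [integral_sub]
    · simp [pairMean]
    · exact Integrable.of_bound ((measurable_sum_edgeLaw_smul hB hf).comp
        measurable_prodMk_left).aestronglyMeasurable M
        (ae_of_all _ fun y => norm_sum_edgeLaw_smul_le hB fun a => hM a x y)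
    · exact integrable_const _
  have hT : ∀ n i, Measurable (traj (Z n i) t) := fun n i => measurable_traj (hZ n i) t
  have hTA : ∀ n i j, Measurable (traj (A n i j) t) := fun n i j => measurable_traj (hA n i j) t
  let V : (m : ℕ) → Fin (m + 1) → Ω → H := fun m j ω => h (traj (A (m + 1) (i m) j) t ω)
    (traj (Z (m + 1) (i m)) t ω) (traj (Z (m + 1) j) t ω)
  have hhall : Measurable fun p : Traj Bool t × (Traj (Opinion d) t × Traj (Opinion d) t) =>
      h p.1 p.2.1 p.2.2 := measurable_from_prod_countable_right fun a => hhm a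
  have hV : ∀ m j, Measurable (V m j) := fun m j =>
    hhall.comp ((hTA _ _ _).prodMk ((hT _ _).prodMk (hT _ _)))
  have hVM : ∀ m j ω, ‖V m j ω‖ ≤ M + M := fun m j ω => hhM _ _ _
  have hM0 : 0 ≤ M + M := by
    obtain ⟨ω⟩ := nonempty_of_isProbabilityMeasure P
    exact (norm_nonneg _).trans (hVM 0 0 ω)
  have hVb : ∀ m j l ω, |inner ℝ (V m j ω) (V m l ω)| ≤ (M + M) * (M + M) := fun m j l ω =>
    (abs_real_inner_le_norm _ _).trans (mul_le_mul (hVM _ _ _) (hVM _ _ _) (norm_nonneg _) hM0)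
  have hVi : ∀ m j l, Integrable (fun ω => inner ℝ (V m j ω) (V m l ω)) P := fun m j l =>
    integrable_bounded ((hV m j).inner (hV m l)) (hVb m j l)
  have hpair := tendsto_pair_average (a := fun m j l => ∫ ω, inner ℝ (V m j ω) (V m l ω) ∂P)
    (C := (M + M) * (M + M)) (fun m j l => by
      have := norm_integral_le_of_norm_le_const (μ := P) (ae_of_all _ fun ω =>
        (Real.norm_eq_abs _).le.trans (hVb m j l ω))
      simpa using this) i
    (fun j l hjl => hch.tendsto_integral_inner hB hZ hA hhm hhM hhc hh0 hjl)
  refine hpair.congr fun m => ?_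
  simp only [← integral_finsetSum _ fun l _ => hVi m _ l]
  rw [← integral_finsetSum _ fun j _ => integrable_finsetSum _ fun l _ => hVi m j l,
    ← integral_const_mul]
  refine integral_congr_ae (ae_of_all _ fun ω => ?_)
  have hm1 : ((m : ℝ) + 1) ≠ 0 := by positivity
  have e2 : ((m : ℝ) + 1)⁻¹ • ∑ j, f (traj (A (m + 1) (i m) j) t ω)
        (traj (Z (m + 1) (i m)) t ω) (traj (Z (m + 1) j) t ω) -
        pairMean B₀ B t μ f (traj (Z (m + 1) (i m)) t ω) = ((m : ℝ) + 1)⁻¹ • ∑ j, V m j ω := by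
    simp only [V, h, Finset.sum_sub_distrib, smul_sub]
    congr 1
    rw [Finset.sum_const, Finset.card_univ, Fintype.card_fin, ← Nat.cast_smul_eq_nsmul ℝ,
      smul_smul]
    push_cast
    rw [inv_mul_cancel₀ hm1, one_smul]
  simp only
  rw [e2, norm_smul, mul_pow, ← real_inner_self_eq_norm_sq (∑ j, V m j ω), Real.norm_eq_abs,
    sq_abs, inv_pow]
  simp only [sum_inner, inner_sum]
  congr 1
  exact Finset.sum_comm

end Chaos

/-! ### Convergence of the neighbourhood means -/

theorem tendsto_zero_of_forall_eventually_le {u : ℕ → ℝ} (h0 : ∀ m, 0 ≤ u m)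
    (h : ∀ ε > 0, ∀ᶠ m in atTop, u m ≤ ε) : Tendsto u atTop (𝓝 0) := by
  refine Metric.tendsto_atTop'.2 fun ε hε => ?_
  obtain ⟨N, hN⟩ := eventually_atTop.1 (h (ε / 2) (by positivity))
  refine ⟨N, fun m hm => ?_⟩
  rw [Real.dist_eq, sub_zero, abs_of_nonneg (h0 m)]
  linarith [hN m hm.le]

/-- A bounded radial contraction that is close to the identity for large `R`. -/
noncomputable def softTruncation {E : Type*} [NormedAddCommGroup E] [NormedSpace ℝ E] (R : ℝ)
    (x : E) : E := (1 + ‖x‖ / R)⁻¹ • x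

section SoftTruncation

variable {E : Type*} [NormedAddCommGroup E] [NormedSpace ℝ E] {R : ℝ}

theorem continuous_softTruncation (hR : 0 < R) : Continuous (softTruncation R : E → E) := by
  refine Continuous.smul (Continuous.inv₀ (by fun_prop) fun x => ?_) continuous_id
  positivity

theorem norm_softTruncation_le (hR : 0 < R) (x : E) : ‖softTruncation R x‖ ≤ R := by
  have h : 0 < 1 + ‖x‖ / R := by positivity
  rw [softTruncation, norm_smul, norm_inv, Real.norm_eq_abs, abs_of_pos h, inv_mul_le_iff₀ h,
    add_mul, div_mul_cancel₀ _ hR.ne']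
  linarith

theorem norm_sub_softTruncation_le (hR : 0 < R) (x : E) :
    ‖x - softTruncation R x‖ ≤ ‖x‖ ^ 2 / R := by
  have h : 0 < 1 + ‖x‖ / R := by positivity
  have e : x - softTruncation R x = (1 - (1 + ‖x‖ / R)⁻¹) • x := by
    rw [softTruncation, sub_smul, one_smul]
  have h1 : (1 + ‖x‖ / R)⁻¹ ≤ 1 := inv_le_one_of_one_le₀ (le_add_of_nonneg_right (by positivity))
  have h2 : 1 - ‖x‖ / R ≤ (1 + ‖x‖ / R)⁻¹ := by
    rw [← one_div, le_div_iff₀ h]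
    nlinarith [sq_nonneg (‖x‖ / R)]
  rw [e, norm_smul, Real.norm_eq_abs, abs_of_nonneg (by linarith), sq, mul_div_assoc, mul_comm]
  exact mul_le_mul_of_nonneg_left (by linarith) (norm_nonneg _)

end SoftTruncation

/-- Stability of a quotient without a lower bound on the denominators. If D' < 2δ the first term on
the right is at least 1; if |D - D'| ≥ δ the last one is; otherwise both denominators are at least δ
and the quotient rule applies. The first term depends on D' alone and is continuous in it, so it can
serve as a test function. -/
theorem min_norm_sub_ratio_le {E : Type*} [NormedAddCommGroup E] [NormedSpace ℝ E]
    {D D' δ K : ℝ} {N N' : E} (hδ : 0 < δ) (hN' : ‖N'‖ ≤ K) :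
    min 1 ‖D⁻¹ • N - D'⁻¹ • N'‖ ≤ 2 * max 0 (1 - D' / (4 * δ)) + δ⁻¹ * ‖N - N'‖ +
      (δ⁻¹ + K * (δ ^ 2)⁻¹) * |D - D'| := by
  have hK : 0 ≤ K := (norm_nonneg _).trans hN'
  have a1 : 0 ≤ 2 * max 0 (1 - D' / (4 * δ)) := by positivity
  have a2 : 0 ≤ δ⁻¹ * ‖N - N'‖ := by positivity
  have a3 : 0 ≤ K * (δ ^ 2)⁻¹ * |D - D'| := by positivity
  have a4 : 0 ≤ δ⁻¹ * |D - D'| := by positivity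
  rw [add_mul]
  by_cases h1 : D' < 2 * δ
  · have : D' / (4 * δ) ≤ 1 / 2 := by rw [div_le_iff₀ (by positivity)]; linarith
    have := le_max_right 0 (1 - D' / (4 * δ))
    exact (min_le_left _ _).trans (by linarith)
  by_cases h2 : δ ≤ |D - D'|
  · have : 1 ≤ δ⁻¹ * |D - D'| := by rw [le_inv_mul_iff₀ hδ]; linarith
    exact (min_le_left _ _).trans (by linarith)
  push Not at h1 h2
  have hD : δ ≤ D := by linarith [(abs_lt.1 h2).1]
  have hD0 : 0 < D := by linarith
  have hD'0 : 0 < D' := by linarith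
  have e : D⁻¹ • N - D'⁻¹ • N' = D⁻¹ • (N - N') - (D⁻¹ * D'⁻¹ * (D - D')) • N' := by
    have : D⁻¹ * D'⁻¹ * (D - D') = D'⁻¹ - D⁻¹ := by field_simp
    rw [this, sub_smul, smul_sub]
    abel
  have b1 : D⁻¹ ≤ δ⁻¹ := inv_anti₀ hδ hD
  have b2 : D'⁻¹ ≤ δ⁻¹ := inv_anti₀ hδ (by linarith)
  refine (min_le_right _ _).trans ?_
  rw [e]
  refine (norm_sub_le _ _).trans ?_
  rw [norm_smul, norm_smul, norm_mul, norm_mul, Real.norm_eq_abs, Real.norm_eq_abs,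
    Real.norm_eq_abs, abs_of_pos (inv_pos.2 hD0), abs_of_pos (inv_pos.2 hD'0)]
  have c1 : D⁻¹ * ‖N - N'‖ ≤ δ⁻¹ * ‖N - N'‖ := mul_le_mul_of_nonneg_right b1 (norm_nonneg _)
  have c2 : D⁻¹ * D'⁻¹ * |D - D'| * ‖N'‖ ≤ K * (δ ^ 2)⁻¹ * |D - D'| := by
    have : D⁻¹ * D'⁻¹ ≤ (δ ^ 2)⁻¹ := by
      rw [sq, mul_inv]
      exact mul_le_mul b1 b2 (by positivity) (by positivity)
    calc _ ≤ (δ ^ 2)⁻¹ * |D - D'| * K := by gcongr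
      _ = _ := by ring
  linarith

/-! ### Single agents, second moments and mean convergence -/

section Chaos

variable {Ω : Type*} [MeasurableSpace Ω] {P : Measure Ω} [IsProbabilityMeasure P] {d : ℕ} {γ : ℝ}
  {B₀ : Opinion d → Opinion d → ℝ} {B : Bool → Opinion d → Opinion d → ℝ}
  {Z : (n : ℕ) → Fin n → ℕ → Ω → Opinion d}
  {A : (n : ℕ) → Fin n → Fin n → ℕ → Ω → Bool} {μ₀ ν : Measure (Opinion d)}
  [IsProbabilityMeasure μ₀] [IsProbabilityMeasure ν] {t : ℕ}

theorem Chaos.tendsto_integral_single (hB : IsInteraction B₀ B) (hch : Chaos P γ B₀ B μ₀ ν Z A t)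
    {G : Traj (Opinion d) t → ℝ} (hG : Measurable G) {M : ℝ} (hM : ∀ z, |G z| ≤ M)
    (hGc : ∀ᵐ z ∂limLaw γ B₀ B μ₀ ν t, ContinuousAt G z) (i : (m : ℕ) → Fin (m + 1)) :
    Tendsto (fun m => ∫ ω, G (traj (Z (m + 1) (i m)) t ω) ∂P) atTop
      (𝓝 (∫ z, G z ∂limLaw γ B₀ B μ₀ ν t)) := by
  have := isProbabilityMeasure_limLaw (γ := γ) (μ₀ := μ₀) (ν := ν) hB t
  have hmp := measurePreserving_eval (fun _ : Fin 1 => limLaw γ B₀ B μ₀ ν t) 0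
  have h := hch 1 0 Fin.elim0 Fin.elim0 ⟨fun e => e.elim0, fun e => e.elim0, fun e => e.elim0⟩
    (fun m _ => i m) (Eventually.of_forall fun m => Function.injective_of_subsingleton _)
    Fin.elim0 (fun z => G (z 0)) M (hG.comp (measurable_pi_apply 0)) (fun z => hM _) (by
      filter_upwards [hmp.quasiMeasurePreserving.ae hGc] with z hz
      exact ContinuousAt.comp (f := fun z : Fin 1 → Traj (Opinion d) t => z 0) (x := z) hz
        (continuous_apply 0).continuousAt)
  simp only [Finset.univ_eq_empty, Finset.prod_empty, mul_one] at h
  rwa [← hmp.map_eq, integral_map (measurable_pi_apply 0).aemeasurable hG.aestronglyMeasurable]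

theorem MomentBound.exists_sq (hmom : MomentBound P Z t) :
    ∃ K : ℝ, 0 ≤ K ∧ ∀ᶠ m : ℕ in atTop, ∀ i : Fin (m + 1),
      ∫⁻ ω, ENNReal.ofReal (‖Z (m + 1) i t ω‖ ^ 2) ∂P ≤ ENNReal.ofReal K := by
  obtain ⟨K, hK, h⟩ := hmom 1
  refine ⟨2 * K.toReal, by positivity, ?_⟩
  filter_upwards [h] with m hm i
  calc _ ≤ ∫⁻ ω, 2 * ENNReal.ofReal (Real.exp (1 * ‖Z (m + 1) i t ω‖)) ∂P := by
        refine lintegral_mono fun ω => ?_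
        have h2 : (2 : ℝ≥0∞) = ENNReal.ofReal 2 := (ENNReal.ofReal_ofNat 2).symm
        simp only [h2, one_mul]
        rw [← ENNReal.ofReal_mul (by norm_num)]
        refine ENNReal.ofReal_le_ofReal ?_
        have := Real.quadratic_le_exp_of_nonneg (norm_nonneg (Z (m + 1) i t ω))
        nlinarith [norm_nonneg (Z (m + 1) i t ω)]
    _ ≤ 2 * K := by
        rw [lintegral_const_mul' _ _ (by norm_num)]
        exact mul_le_mul_right (hm i) 2
    _ = ENNReal.ofReal (2 * K.toReal) := by
        rw [ENNReal.ofReal_mul (by norm_num), ENNReal.ofReal_toReal hK.ne]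
        norm_num

/-- Second moments are lower semicontinuous under weak convergence: truncated squares are bounded
and continuous, so their bounds pass to the limit, and monotone convergence removes the truncation.
-/
theorem Chaos.lintegral_sq_le (hB : IsInteraction B₀ B) (hch : Chaos P γ B₀ B μ₀ ν Z A t)
    {K : ℝ} (hK : 0 ≤ K) (h : ∀ᶠ m : ℕ in atTop, ∀ i : Fin (m + 1),
      ∫⁻ ω, ENNReal.ofReal (‖Z (m + 1) i t ω‖ ^ 2) ∂P ≤ ENNReal.ofReal K)
    (hZ : ∀ n i t, Measurable (Z n i t)) :
    ∫⁻ z, ENNReal.ofReal (‖z (Fin.last t)‖ ^ 2) ∂limLaw γ B₀ B μ₀ ν t ≤ ENNReal.ofReal K := by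
  have := isProbabilityMeasure_limLaw (γ := γ) (μ₀ := μ₀) (ν := ν) hB t
  let G : ℕ → Traj (Opinion d) t → ℝ := fun R z => min (‖z (Fin.last t)‖ ^ 2) R
  have hGc : ∀ R, Continuous (G R) := fun R => by fun_prop
  have hG0 : ∀ R z, 0 ≤ G R z := fun R z => le_min (by positivity) (Nat.cast_nonneg R)
  have hGb : ∀ R z, |G R z| ≤ R := fun R z => by
    rw [abs_of_nonneg (hG0 R z)]
    exact min_le_right _ _
  have hbound : ∀ R, ∫⁻ z, ENNReal.ofReal (G R z) ∂limLaw γ B₀ B μ₀ ν t ≤ ENNReal.ofReal K := by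
    intro R
    rw [← ofReal_integral_eq_lintegral_ofReal (integrable_bounded (hGc R).measurable (hGb R))
      (ae_of_all _ (hG0 R))]
    refine ENNReal.ofReal_le_ofReal (le_of_tendsto (hch.tendsto_integral_single hB
      (hGc R).measurable (hGb R) (ae_of_all _ fun z => (hGc R).continuousAt) fun m => 0) ?_)
    filter_upwards [h] with m hm
    rw [integral_eq_lintegral_of_nonneg_ae (ae_of_all _ fun ω => hG0 R _)
      ((hGc R).measurable.comp (measurable_traj (hZ _ _) t)).aestronglyMeasurable]
    refine ENNReal.toReal_le_of_le_ofReal hK ((lintegral_mono fun ω =>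
      ENNReal.ofReal_le_ofReal ?_).trans (hm 0))
    exact min_le_left _ _
  refine le_of_tendsto' (lintegral_tendsto_of_tendsto_of_monotone
    (f := fun R z => ENNReal.ofReal (G R z)) (fun R => by fun_prop) ?_ ?_) hbound
  · refine ae_of_all _ fun z R R' hR => ENNReal.ofReal_le_ofReal (min_le_min_left _ ?_)
    exact_mod_cast hR
  · refine ae_of_all _ fun z => tendsto_const_nhds.congr' ?_
    filter_upwards [eventually_ge_atTop ⌈‖z (Fin.last t)‖ ^ 2⌉₊] with R hR
    simp only [G]
    rw [min_eq_left (Nat.ceil_le.1 hR)]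

theorem integrable_norm_of_lintegral_sq {X : Type*} [MeasurableSpace X] {μ : Measure X}
    [IsFiniteMeasure μ] {f : X → ℝ} (hf : Measurable f)
    (h : ∫⁻ x, ENNReal.ofReal (f x ^ 2) ∂μ < ⊤) :
    Integrable f μ ∧ Integrable (fun x => f x ^ 2) μ := by
  have h2 : Integrable (fun x => f x ^ 2) μ :=
    ⟨(hf.pow_const 2).aestronglyMeasurable, by
      rw [hasFiniteIntegral_iff_ofReal (ae_of_all _ fun x => sq_nonneg _)]
      exact h⟩
  refine ⟨(h2.add (integrable_const (1 : ℝ))).mono' hf.aestronglyMeasurable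
    (ae_of_all _ fun x => ?_), h2⟩
  simp only [Pi.add_apply, Real.norm_eq_abs]
  nlinarith [sq_abs (f x), sq_nonneg (|f x| - 1), abs_nonneg (f x)]

/-- From mean square to mean, by |u| ≤ η + u²/η with η = ε/2. -/
theorem Chaos.tendsto_lln_norm {H : Type*} [NormedAddCommGroup H] [InnerProductSpace ℝ H]
    [CompleteSpace H] [MeasurableSpace H] [BorelSpace H] [SecondCountableTopology H]
    (hB : IsInteraction B₀ B) (hμ₀ : μ₀ ≪ volume) (hν : ν ≪ volume)
    (hch : Chaos P γ B₀ B μ₀ ν Z A t)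
    (hZ : ∀ n i t, Measurable (Z n i t)) (hA : ∀ n i j t, Measurable (A n i j t))
    {f : Traj Bool t → Traj (Opinion d) t → Traj (Opinion d) t → H}
    (hf : ∀ a, Measurable fun p : Traj (Opinion d) t × Traj (Opinion d) t => f a p.1 p.2)
    {M : ℝ} (hM : ∀ a x y, ‖f a x y‖ ≤ M)
    (hfc : ∀ a, ∀ᵐ p ∂((limLaw γ B₀ B μ₀ ν t).prod (limLaw γ B₀ B μ₀ ν t)),
      ContinuousAt (fun p : Traj (Opinion d) t × Traj (Opinion d) t => f a p.1 p.2) p)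
    (i : (m : ℕ) → Fin (m + 1)) :
    (∀ m : ℕ, Integrable (fun ω => ((m : ℝ) + 1)⁻¹ • ∑ j, f (traj (A (m + 1) (i m) j) t ω)
        (traj (Z (m + 1) (i m)) t ω) (traj (Z (m + 1) j) t ω) -
        pairMean B₀ B t (limLaw γ B₀ B μ₀ ν t) f (traj (Z (m + 1) (i m)) t ω)) P) ∧
    Tendsto (fun m : ℕ => ∫ ω, ‖((m : ℝ) + 1)⁻¹ • ∑ j, f (traj (A (m + 1) (i m) j) t ω)
        (traj (Z (m + 1) (i m)) t ω) (traj (Z (m + 1) j) t ω) -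
        pairMean B₀ B t (limLaw γ B₀ B μ₀ ν t) f (traj (Z (m + 1) (i m)) t ω)‖ ∂P) atTop
      (𝓝 0) := by
  have := isProbabilityMeasure_limLaw (γ := γ) (μ₀ := μ₀) (ν := ν) hB t
  have hT : ∀ n i, Measurable (traj (Z n i) t) := fun n i => measurable_traj (hZ n i) t
  have hTA : ∀ n i j, Measurable (traj (A n i j) t) := fun n i j => measurable_traj (hA n i j) t
  have hfall : Measurable fun p : Traj Bool t × (Traj (Opinion d) t × Traj (Opinion d) t) =>
      f p.1 p.2.1 p.2.2 := measurable_from_prod_countable_right fun a => hf a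
  let U : ℕ → Ω → H := fun m ω => ((m : ℝ) + 1)⁻¹ • ∑ j, f (traj (A (m + 1) (i m) j) t ω)
        (traj (Z (m + 1) (i m)) t ω) (traj (Z (m + 1) j) t ω) -
        pairMean B₀ B t (limLaw γ B₀ B μ₀ ν t) f (traj (Z (m + 1) (i m)) t ω)
  have hUm : ∀ m, Measurable (U m) := fun m =>
    ((Finset.measurable_sum _ fun j _ => hfall.comp ((hTA _ _ _).prodMk
      ((hT _ _).prodMk (hT _ _)))).const_smul _).sub ((measurable_pairMean hB hf).comp (hT _ _))
  have hUb : ∀ m ω, ‖U m ω‖ ≤ M + M := by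
    intro m ω
    refine (norm_sub_le _ _).trans (add_le_add ?_ (norm_pairMean_le hB hM _))
    rw [norm_smul, norm_inv, Real.norm_eq_abs, abs_of_pos (by positivity : (0 : ℝ) < m + 1),
      inv_mul_le_iff₀ (by positivity)]
    refine (norm_sum_le_of_le _ fun j _ => hM _ _ _).trans ?_
    simp
  have hUi : ∀ m, Integrable (U m) P := fun m =>
    Integrable.of_bound (hUm m).aestronglyMeasurable _ (ae_of_all _ (hUb m))
  have hUi2 : ∀ m, Integrable (fun ω => ‖U m ω‖ ^ 2) P := fun m =>
    Integrable.of_bound ((hUm m).norm.pow_const 2).aestronglyMeasurable ((M + M) ^ 2)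
      (ae_of_all _ fun ω => by
        rw [norm_pow, norm_norm]
        exact pow_le_pow_left₀ (norm_nonneg _) (hUb m ω) 2)
  refine ⟨hUi, tendsto_zero_of_forall_eventually_le
    (fun m => integral_nonneg fun ω => norm_nonneg _) fun ε hε => ?_⟩
  have hlln : Tendsto (fun m => ∫ ω, ‖U m ω‖ ^ 2 ∂P) atTop (𝓝 0) :=
    hch.tendsto_lln hB hμ₀ hν hZ hA hf hM hfc i
  have hη : 0 < ε / 2 := by positivity
  filter_upwards [hlln.eventually_lt_const (by positivity : 0 < ε / 2 * (ε / 2))] with m hm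
  calc ∫ ω, ‖U m ω‖ ∂P ≤ ∫ ω, (ε / 2 + (ε / 2)⁻¹ * ‖U m ω‖ ^ 2) ∂P := by
        refine integral_mono (hUi m).norm ((integrable_const _).add ((hUi2 m).const_mul _))
          fun ω => ?_
        have h0 := norm_nonneg (U m ω)
        have h1 : (ε / 2) * ‖U m ω‖ ≤ (ε / 2) * (ε / 2) + ‖U m ω‖ ^ 2 := by
          nlinarith [sq_nonneg (‖U m ω‖ - ε / 2), mul_nonneg hη.le h0]
        simp only
        rw [← mul_le_mul_iff_of_pos_left hη, mul_add, mul_inv_cancel_left₀ hη.ne']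
        exact h1
    _ = ε / 2 + (ε / 2)⁻¹ * ∫ ω, ‖U m ω‖ ^ 2 ∂P := by
        rw [integral_add (integrable_const _) ((hUi2 m).const_mul _), integral_const_mul]
        simp
    _ ≤ ε / 2 + (ε / 2)⁻¹ * (ε / 2 * (ε / 2)) := by gcongr
    _ = ε := by
        rw [inv_mul_cancel_left₀ hη.ne']
        ring

end Chaos

/-! ### The limiting neighbourhood mean: positivity of its denominator and continuity -/

section LimitMean

variable {d : ℕ} {γ : ℝ} {B₀ : Opinion d → Opinion d → ℝ} {B : Bool → Opinion d → Opinion d → ℝ}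
  {μ₀ ν : Measure (Opinion d)} [IsProbabilityMeasure μ₀] [IsProbabilityMeasure ν] {t : ℕ}

/-- Whether the last edge of the path `a` is present. -/
def lastEdge {d t : ℕ} (a : Traj Bool t) (_ _ : Traj (Opinion d) t) : ℝ := edgeVal (a (Fin.last t))

/-- The last opinion of `y`, if the last edge of the path `a` is present. -/
noncomputable def lastOpinion {d t : ℕ} (a : Traj Bool t) (_ y : Traj (Opinion d) t) : Opinion d :=
  edgeVal (a (Fin.last t)) • y (Fin.last t)

theorem norm_edgeVal_smul_le {E : Type*} [NormedAddCommGroup E] [NormedSpace ℝ E] (b : Bool)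
    (x : E) : ‖edgeVal b • x‖ ≤ ‖x‖ := by
  rw [norm_smul, Real.norm_eq_abs, abs_of_nonneg (edgeVal_mem b).1]
  exact mul_le_of_le_one_left (norm_nonneg _) (edgeVal_mem b).2

theorem pairMean_lastEdge (μ : Measure (Traj (Opinion d) t)) (x : Traj (Opinion d) t) :
    pairMean B₀ B t μ lastEdge x = ∫ y, linkFn B₀ B t x y ∂μ := by
  simp only [pairMean, lastEdge, smul_eq_mul, ← sum_edgeVal_mul_edgeLaw, mul_comm]

theorem pairMean_lastOpinion (μ : Measure (Traj (Opinion d) t)) (x : Traj (Opinion d) t) :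
    pairMean B₀ B t μ lastOpinion x = ∫ y, linkFn B₀ B t x y • y (Fin.last t) ∂μ := by
  simp only [pairMean, lastOpinion, smul_smul, ← sum_edgeVal_mul_edgeLaw, Finset.sum_smul, mul_comm]

theorem limitMean_eq (μ : Measure (Traj (Opinion d) t)) (x : Traj (Opinion d) t) :
    limitMean B₀ B t μ x =
      (pairMean B₀ B t μ lastEdge x)⁻¹ • pairMean B₀ B t μ lastOpinion x := by
  rw [pairMean_lastEdge, pairMean_lastOpinion, limitMean]

/-- This is all that the denominators need from the two alternative bounds: under exponential decay
positivity is global, and under finite range it follows from positivity and continuity on the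
diagonal. -/
theorem eventually_pos_of_bounds (hB : IsInteraction B₀ B)
    (hint : ExpDecay B₀ B ∨ FiniteRange B₀ B) (z : Opinion d) :
    ∀ᶠ y in 𝓝 z, 0 < B₀ z y ∧ ∀ a, 0 < B a z y := by
  rcases hint with hE | ⟨_, hF⟩
  · obtain ⟨C, -, c, hc, h0, h1⟩ := hE.exists_lower hB
    exact Eventually.of_forall fun y => ⟨(mul_pos hc (Real.exp_pos _)).trans_le (h0 z y), fun a =>
      (mul_pos hc (Real.exp_pos _)).trans_le (h1 a z y)⟩
  · have hz : Tendsto (fun y : Opinion d => (z, y)) (𝓝 z) (𝓝 (z, z)) :=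
      (Continuous.prodMk_right z).continuousAt
    refine ((hF true z).2.2.1.tendsto.comp hz |>.eventually_const_lt (hF true z).1).and
      (eventually_all.2 fun a => ?_)
    exact ((hF a z).2.2.2.tendsto.comp hz).eventually_const_lt (hF a z).2.1

theorem eventually_linkFn_pos (hB : IsInteraction B₀ B)
    (hint : ExpDecay B₀ B ∨ FiniteRange B₀ B) (z : Traj (Opinion d) t) :
    ∀ᶠ y in 𝓝 z, 0 < linkFn B₀ B t z y := by
  have h : ∀ s, ∀ᶠ y in 𝓝 z, 0 < B₀ (z s) (y s) ∧ ∀ a, 0 < B a (z s) (y s) := fun s =>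
    (continuous_apply s).continuousAt.eventually (eventually_pos_of_bounds hB hint (z s))
  cases t with
  | zero => filter_upwards [h 0] with y hy using hy.1
  | succ t =>
    filter_upwards [h (Fin.last (t + 1))] with y hy
    obtain ⟨hp0, hp1⟩ := linkFn_mem hB t (fun r => z r.castSucc) (fun r => y r.castSucc)
    simp only [linkFn, mixedProb]
    -- The link function is a convex combination of `B true` and `B false`, and at least one weight
    -- is positive.
    rcases hp0.eq_or_lt with h0 | h0
    · rw [← h0]
      simpa using hy.2 false
    · exact add_pos_of_pos_of_nonneg (mul_pos h0 (hy.2 true))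
        (mul_nonneg (by linarith) (hy.2 false).le)

theorem pairMean_lastEdge_nonneg (hB : IsInteraction B₀ B) (μ : Measure (Traj (Opinion d) t))
    (x : Traj (Opinion d) t) : 0 ≤ pairMean B₀ B t μ lastEdge x := by
  rw [pairMean_lastEdge]
  exact integral_nonneg fun y => (linkFn_mem hB t x y).1

/-- Almost every trajectory lies in the support of its law, so an independent copy lands with
positive probability in the neighbourhood where the link function is positive. -/
theorem ae_pairMean_lastEdge_pos (hB : IsInteraction B₀ B)
    (hint : ExpDecay B₀ B ∨ FiniteRange B₀ B) (μ : Measure (Traj (Opinion d) t))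
    [IsProbabilityMeasure μ] : ∀ᵐ x ∂μ, 0 < pairMean B₀ B t μ lastEdge x := by
  filter_upwards [Measure.support_mem_ae (μ := μ)] with x hx
  have hi : Integrable (fun y => linkFn B₀ B t x y) μ :=
    integrable_bounded (M := 1) ((measurable_linkFn hB t).comp measurable_prodMk_left) fun y => by
      rw [abs_of_nonneg (linkFn_mem hB t x y).1]
      exact (linkFn_mem hB t x y).2
  rw [pairMean_lastEdge, integral_pos_iff_support_of_nonneg
    (fun y => (linkFn_mem hB t x y).1) hi]
  refine ((Measure.mem_support_iff_forall x).1 hx _ (eventually_linkFn_pos hB hint x)).trans_le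
    (measure_mono fun y hy => ?_)
  exact (show 0 < linkFn B₀ B t x y from hy).ne'

theorem measurable_lastEdge (a : Traj Bool t) :
    Measurable fun p : Traj (Opinion d) t × Traj (Opinion d) t => lastEdge a p.1 p.2 :=
  measurable_const

theorem measurable_lastOpinion (a : Traj Bool t) :
    Measurable fun p : Traj (Opinion d) t × Traj (Opinion d) t => lastOpinion a p.1 p.2 := by
  unfold lastOpinion
  fun_prop

theorem norm_lastEdge_le (a : Traj Bool t) (x y : Traj (Opinion d) t) : ‖lastEdge a x y‖ ≤ 1 := by
  rw [lastEdge, Real.norm_eq_abs, abs_of_nonneg (edgeVal_mem _).1]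
  exact (edgeVal_mem _).2

/-- A quotient of almost everywhere continuous functions with almost everywhere positive
denominator. The numerator is dominated by the norm of the last opinion, whence the integrability
assumption. -/
theorem ae_continuousAt_limitMean (hB : IsInteraction B₀ B) (hμ₀ : μ₀ ≪ volume) (hν : ν ≪ volume)
    (hint : ExpDecay B₀ B ∨ FiniteRange B₀ B)
    (hi : Integrable (fun z => ‖z (Fin.last t)‖) (limLaw γ B₀ B μ₀ ν t)) :
    ∀ᵐ x ∂limLaw γ B₀ B μ₀ ν t,
      ContinuousAt (limitMean B₀ B t (limLaw γ B₀ B μ₀ ν t)) x := by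
  have := isProbabilityMeasure_limLaw (γ := γ) (μ₀ := μ₀) (ν := ν) hB t
  filter_upwards [ae_pairMean_lastEdge_pos hB hint (limLaw γ B₀ B μ₀ ν t),
    ae_continuousAt_pairMean hB hμ₀ hν measurable_lastEdge (integrable_const (1 : ℝ))
      norm_lastEdge_le fun a => ae_of_all _ fun p => continuous_const.continuousAt,
    ae_continuousAt_pairMean hB hμ₀ hν measurable_lastOpinion hi
      (fun a x y => norm_edgeVal_smul_le _ _) fun a => ae_of_all _ fun p =>
        Continuous.continuousAt (by unfold lastOpinion; fun_prop)] with x h0 h1 h2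
  rw [funext (limitMean_eq (limLaw γ B₀ B μ₀ ν t))]
  exact (h1.inv₀ h0.ne').smul h2

end LimitMean

/-! ### Small degrees and unbounded numerators -/

section Chaos

variable {Ω : Type*} [MeasurableSpace Ω] {P : Measure Ω} [IsProbabilityMeasure P] {d : ℕ} {γ : ℝ}
  {B₀ : Opinion d → Opinion d → ℝ} {B : Bool → Opinion d → Opinion d → ℝ}
  {Z : (n : ℕ) → Fin n → ℕ → Ω → Opinion d}
  {A : (n : ℕ) → Fin n → Fin n → ℕ → Ω → Bool} {μ₀ ν : Measure (Opinion d)}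
  [IsProbabilityMeasure μ₀] [IsProbabilityMeasure ν] {t : ℕ}

theorem neighbourMean_eq_ratio (m : ℕ) (i : Fin (m + 1)) (ω : Ω) :
    neighbourMean (Z (m + 1)) (A (m + 1)) i t ω =
      (((m : ℝ) + 1)⁻¹ • ∑ j, lastEdge (traj (A (m + 1) i j) t ω)
        (traj (Z (m + 1) i) t ω) (traj (Z (m + 1) j) t ω))⁻¹ •
      ((m : ℝ) + 1)⁻¹ • ∑ j, lastOpinion (traj (A (m + 1) i j) t ω)
        (traj (Z (m + 1) i) t ω) (traj (Z (m + 1) j) t ω) := by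
  have hm : ((m : ℝ) + 1) ≠ 0 := by positivity
  rw [smul_eq_mul, mul_inv, inv_inv, smul_smul, mul_right_comm, mul_inv_cancel₀ hm, one_mul]
  simp [neighbourMean, lastEdge, lastOpinion, traj]

/-- The level δ is chosen under the limit law, where the integral tends to zero with δ because the
limiting degree is almost surely positive. For this δ the integrand is bounded and almost everywhere
continuous, so chaos transfers the bound to large systems. -/
theorem Chaos.eventually_lowDegree_le (hB : IsInteraction B₀ B) (hμ₀ : μ₀ ≪ volume)
    (hν : ν ≪ volume) (hch : Chaos P γ B₀ B μ₀ ν Z A t)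
    (hint : ExpDecay B₀ B ∨ FiniteRange B₀ B) {ε : ℝ} (hε : 0 < ε) (i : (m : ℕ) → Fin (m + 1)) :
    ∃ δ > 0, ∀ᶠ m in atTop, ∫ ω, max 0 (1 - pairMean B₀ B t (limLaw γ B₀ B μ₀ ν t) lastEdge
      (traj (Z (m + 1) (i m)) t ω) / (4 * δ)) ∂P ≤ ε := by
  have := isProbabilityMeasure_limLaw (γ := γ) (μ₀ := μ₀) (ν := ν) hB t
  set μ := limLaw γ B₀ B μ₀ ν t with hμ
  let D := pairMean B₀ B t μ (lastEdge (d := d) (t := t))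
  let G : ℝ → Traj (Opinion d) t → ℝ := fun δ z => max 0 (1 - D z / (4 * δ))
  have hDm : Measurable D := measurable_pairMean hB measurable_lastEdge
  have hGm : ∀ δ, Measurable (G δ) := fun δ =>
    measurable_const.max (measurable_const.sub (hDm.div_const _))
  have hGb : ∀ δ > 0, ∀ z, |G δ z| ≤ 1 := fun δ hδ z => by
    rw [abs_of_nonneg (le_max_left _ _)]
    have : 0 ≤ D z / (4 * δ) := div_nonneg (pairMean_lastEdge_nonneg hB μ z) (by positivity)
    exact max_le zero_le_one (by linarith)
  have hlim : Tendsto (fun n : ℕ => ∫ z, G (1 / ((n : ℝ) + 1)) z ∂μ) atTop (𝓝 (∫ _, (0 : ℝ) ∂μ)) := by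
    refine tendsto_integral_of_dominated_convergence (fun _ => 1)
      (fun n => (hGm _).aestronglyMeasurable) (integrable_const _)
      (fun n => ae_of_all _ fun z => (hGb _ (by positivity) z)) ?_
    filter_upwards [ae_pairMean_lastEdge_pos hB hint μ] with z hz
    refine tendsto_const_nhds.congr' ?_
    have h4 : Tendsto (fun n : ℕ => 4 * (1 / ((n : ℝ) + 1))) atTop (𝓝 (4 * 0)) :=
      tendsto_one_div_add_atTop_nhds_zero_nat.const_mul 4
    rw [mul_zero] at h4
    filter_upwards [h4.eventually_lt_const hz] with n hn
    refine (max_eq_left ?_).symm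
    have h5 : (0 : ℝ) < 4 * (1 / ((n : ℝ) + 1)) := by positivity
    have : 1 ≤ D z / (4 * (1 / ((n : ℝ) + 1))) := by
      rw [le_div_iff₀ h5, one_mul]
      exact hn.le
    linarith
  rw [integral_zero] at hlim
  obtain ⟨n, hn⟩ := (hlim.eventually_lt_const hε).exists
  refine ⟨1 / ((n : ℝ) + 1), by positivity, ?_⟩
  have hGc : ∀ᵐ z ∂μ, ContinuousAt (G (1 / ((n : ℝ) + 1))) z := by
    filter_upwards [ae_continuousAt_pairMean hB hμ₀ hν measurable_lastEdge
      (integrable_const (1 : ℝ)) norm_lastEdge_le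
      fun a => ae_of_all _ fun p => continuous_const.continuousAt] with z hz
    exact continuousAt_const.max (continuousAt_const.sub (hz.div_const _))
  filter_upwards [(hch.tendsto_integral_single hB (hGm _) (hGb _ (by positivity)) hGc
    i).eventually_lt_const hn] with m hm using hm.le

/-- The law of large numbers holds for bounded functions only. Soft truncation at R is continuous
and costs at most |y|²/R, hence K/R in mean, both in the particle system and under the limit law. -/
theorem Chaos.tendsto_mean_lastOpinion (hB : IsInteraction B₀ B) (hμ₀ : μ₀ ≪ volume)
    (hν : ν ≪ volume) (hch : Chaos P γ B₀ B μ₀ ν Z A t)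
    (hZ : ∀ n i t, Measurable (Z n i t)) (hA : ∀ n i j t, Measurable (A n i j t))
    (hmom : MomentBound P Z t) (i : (m : ℕ) → Fin (m + 1)) :
    Tendsto (fun m : ℕ => ∫⁻ ω, ENNReal.ofReal ‖((m : ℝ) + 1)⁻¹ • ∑ j,
        lastOpinion (traj (A (m + 1) (i m) j) t ω)
        (traj (Z (m + 1) (i m)) t ω) (traj (Z (m + 1) j) t ω) -
        pairMean B₀ B t (limLaw γ B₀ B μ₀ ν t) lastOpinion (traj (Z (m + 1) (i m)) t ω)‖ ∂P) atTop
      (𝓝 0) := by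
  have := isProbabilityMeasure_limLaw (γ := γ) (μ₀ := μ₀) (ν := ν) hB t
  set μ := limLaw γ B₀ B μ₀ ν t with hμ
  obtain ⟨K, hK, hev⟩ := hmom.exists_sq
  have hsq := hch.lintegral_sq_le hB hK hev hZ
  obtain ⟨hi1, hi2⟩ := integrable_norm_of_lintegral_sq (μ := μ)
    (f := fun z : Traj (Opinion d) t => ‖z (Fin.last t)‖) (by fun_prop)
    (hsq.trans_lt ENNReal.ofReal_lt_top)
  have hsqi : ∫ z, ‖z (Fin.last t)‖ ^ 2 ∂μ ≤ K := by
    rw [integral_eq_lintegral_of_nonneg_ae (ae_of_all _ fun z => sq_nonneg _)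
      hi2.aestronglyMeasurable]
    exact ENNReal.toReal_le_of_le_ofReal hK hsq
  have hTZ : ∀ n i, Measurable (traj (Z n i) t) := fun n i => measurable_traj (hZ n i) t
  have hTA : ∀ n i j, Measurable (traj (A n i j) t) := fun n i j => measurable_traj (hA n i j) t
  let T : ℝ → Traj Bool t → Traj (Opinion d) t → Traj (Opinion d) t → Opinion d :=
    fun R a _ y => edgeVal (a (Fin.last t)) • softTruncation R (y (Fin.last t))
  have hTc : ∀ R > 0, ∀ a, Continuous fun p : Traj (Opinion d) t × Traj (Opinion d) t =>
      T R a p.1 p.2 := fun R hR a =>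
    ((continuous_softTruncation hR).comp (by fun_prop : Continuous fun p :
      Traj (Opinion d) t × Traj (Opinion d) t => p.2 (Fin.last t))).const_smul (edgeVal (a (Fin.last t)))
  have hTb : ∀ R > 0, ∀ a x y, ‖T R a x y‖ ≤ R := fun R hR a x y =>
    (norm_edgeVal_smul_le _ _).trans (norm_softTruncation_le hR _)
  have hTd : ∀ R > 0, ∀ a x y, ‖lastOpinion a x y - T R a x y‖ ≤ ‖y (Fin.last t)‖ ^ 2 / R :=
    fun R hR a x y => by
      simp only [lastOpinion, T, ← smul_sub]
      exact (norm_edgeVal_smul_le _ _).trans (norm_sub_softTruncation_le hR _)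
  have hmean : ∀ R > 0, ∀ x, ‖pairMean B₀ B t μ lastOpinion x - pairMean B₀ B t μ (T R) x‖ ≤
      K / R := by
    intro R hR x
    have e1 : Integrable (fun y => ∑ a, edgeLaw B₀ B t x y a • lastOpinion a x y) μ :=
      hi1.mono' ((measurable_sum_edgeLaw_smul hB measurable_lastOpinion).comp
        measurable_prodMk_left).aestronglyMeasurable
        (ae_of_all _ fun y => norm_sum_edgeLaw_smul_le hB fun a => norm_edgeVal_smul_le _ _)
    have e2 : Integrable (fun y => ∑ a, edgeLaw B₀ B t x y a • T R a x y) μ :=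
      Integrable.of_bound ((measurable_sum_edgeLaw_smul hB fun a =>
        (hTc R hR a).measurable).comp measurable_prodMk_left).aestronglyMeasurable R
        (ae_of_all _ fun y => norm_sum_edgeLaw_smul_le hB fun a => hTb R hR a x y)
    unfold pairMean
    rw [← integral_sub e1 e2]
    calc _ ≤ ∫ y, ‖y (Fin.last t)‖ ^ 2 / R ∂μ := by
          refine norm_integral_le_of_norm_le (hi2.div_const R) (ae_of_all _ fun y => ?_)
          rw [← Finset.sum_sub_distrib]
          simp only [← smul_sub]
          exact norm_sum_edgeLaw_smul_le (f := fun a x y => lastOpinion a x y - T R a x y) hB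
            fun a => hTd R hR a x y
      _ ≤ K / R := by
          rw [integral_div]
          gcongr
  refine ENNReal.tendsto_nhds_zero.2 fun ε hε => ?_
  obtain ⟨η, hη, hηε⟩ : ∃ η : ℝ, 0 < η ∧ ENNReal.ofReal η ≤ ε := by
    rcases eq_or_ne ε ⊤ with rfl | h
    · exact ⟨1, one_pos, le_top⟩
    · exact ⟨ε.toReal, ENNReal.toReal_pos hε.ne' h, ENNReal.ofReal_toReal_le⟩
  -- This makes K/R ≤ η/3; the summand 1 keeps `R` positive when K = 0.
  let R := 3 * (K + 1) / η
  have hR : 0 < R := by positivity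
  have hKR : K / R ≤ η / 3 := by
    rw [div_le_iff₀ hR]
    have : η / 3 * R = K + 1 := by simp only [R]; field_simp
    linarith
  obtain ⟨hUi, hU⟩ := hch.tendsto_lln_norm hB hμ₀ hν hZ hA (fun a => (hTc R hR a).measurable)
    (hTb R hR) (fun a => ae_of_all _ fun p => (hTc R hR a).continuousAt) i
  filter_upwards [hev, hU.eventually_lt_const (by positivity : 0 < η / 3)] with m hm hUm
  refine le_trans ?_ hηε
  have hm0 : (0 : ℝ) < (m : ℝ) + 1 := by positivity
  -- Three errors, each at most η/3 in mean: truncating the empirical average, the law of large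
  -- numbers for the truncated function, and truncating the limiting mean.
  have hpt : ∀ ω, ENNReal.ofReal ‖((m : ℝ) + 1)⁻¹ • ∑ j,
        lastOpinion (traj (A (m + 1) (i m) j) t ω)
        (traj (Z (m + 1) (i m)) t ω) (traj (Z (m + 1) j) t ω) -
        pairMean B₀ B t μ lastOpinion (traj (Z (m + 1) (i m)) t ω)‖ ≤
      (∑ j, ENNReal.ofReal (((m : ℝ) + 1)⁻¹ * R⁻¹) * ENNReal.ofReal (‖Z (m + 1) j t ω‖ ^ 2) +
        ENNReal.ofReal ‖((m : ℝ) + 1)⁻¹ • ∑ j, T R (traj (A (m + 1) (i m) j) t ω)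
          (traj (Z (m + 1) (i m)) t ω) (traj (Z (m + 1) j) t ω) -
          pairMean B₀ B t μ (T R) (traj (Z (m + 1) (i m)) t ω)‖) + ENNReal.ofReal (η / 3) := by
    intro ω
    simp_rw [← ENNReal.ofReal_mul (by positivity : 0 ≤ ((m : ℝ) + 1)⁻¹ * R⁻¹)]
    rw [← ENNReal.ofReal_sum_of_nonneg fun j _ => by positivity, ← ENNReal.ofReal_add
      (Finset.sum_nonneg fun j _ => by positivity) (norm_nonneg _),
      ← ENNReal.ofReal_add (add_nonneg (Finset.sum_nonneg fun j _ => by positivity)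
      (norm_nonneg _)) (by positivity)]
    refine ENNReal.ofReal_le_ofReal ?_
    set S1 := ∑ j, lastOpinion (traj (A (m + 1) (i m) j) t ω)
        (traj (Z (m + 1) (i m)) t ω) (traj (Z (m + 1) j) t ω) with hS1
    set S2 := ∑ j, T R (traj (A (m + 1) (i m) j) t ω)
        (traj (Z (m + 1) (i m)) t ω) (traj (Z (m + 1) j) t ω) with hS2
    set p1 := pairMean B₀ B t μ lastOpinion (traj (Z (m + 1) (i m)) t ω)
    set p2 := pairMean B₀ B t μ (T R) (traj (Z (m + 1) (i m)) t ω)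
    have hp : ‖p1 - p2‖ ≤ η / 3 := (hmean R hR _).trans hKR
    have hS : ‖((m : ℝ) + 1)⁻¹ • (S1 - S2)‖ ≤
        ∑ j, ((m : ℝ) + 1)⁻¹ * R⁻¹ * ‖Z (m + 1) j t ω‖ ^ 2 := by
      rw [norm_smul, norm_inv, Real.norm_eq_abs, abs_of_pos hm0, hS1, hS2,
        ← Finset.sum_sub_distrib]
      simp_rw [mul_assoc]
      rw [← Finset.mul_sum]
      refine mul_le_mul_of_nonneg_left (norm_sum_le_of_le _ fun j _ => ?_) (by positivity)
      rw [inv_mul_eq_div]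
      exact hTd R hR _ _ _
    have e : ((m : ℝ) + 1)⁻¹ • S1 - p1 =
        ((m : ℝ) + 1)⁻¹ • (S1 - S2) + (((m : ℝ) + 1)⁻¹ • S2 - p2) - (p1 - p2) := by
      rw [smul_sub]
      abel
    rw [e]
    exact (norm_sub_le _ _).trans (add_le_add ((norm_add_le _ _).trans (add_le_add_left hS _)) hp)
  refine (lintegral_mono hpt).trans ?_
  have hmeasZ : ∀ j, Measurable fun ω => ENNReal.ofReal (‖Z (m + 1) j t ω‖ ^ 2) := fun j =>
    ((hZ _ j t).norm.pow_const 2).ennreal_ofReal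
  rw [lintegral_add_right _ measurable_const, lintegral_add_left (Finset.measurable_sum _ fun j _ =>
    (hmeasZ j).const_mul _), lintegral_finsetSum _ fun j _ => (hmeasZ j).const_mul _]
  simp_rw [lintegral_const_mul _ (hmeasZ _)]
  have h1 : ∑ j : Fin (m + 1), ENNReal.ofReal (((m : ℝ) + 1)⁻¹ * R⁻¹) *
      ∫⁻ ω, ENNReal.ofReal (‖Z (m + 1) j t ω‖ ^ 2) ∂P ≤ ENNReal.ofReal (η / 3) := by
    calc _ ≤ ∑ j : Fin (m + 1), ENNReal.ofReal (((m : ℝ) + 1)⁻¹ * R⁻¹) * ENNReal.ofReal K :=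
          Finset.sum_le_sum fun j _ => mul_le_mul_right (hm j) _
      _ = ENNReal.ofReal (K / R) := by
          simp_rw [← ENNReal.ofReal_mul (by positivity : 0 ≤ ((m : ℝ) + 1)⁻¹ * R⁻¹)]
          rw [← ENNReal.ofReal_sum_of_nonneg fun j _ => by positivity]
          congr 1
          simp
          field_simp
      _ ≤ _ := ENNReal.ofReal_le_ofReal hKR
  have h2 : ∫⁻ ω, ENNReal.ofReal ‖((m : ℝ) + 1)⁻¹ • ∑ j, T R (traj (A (m + 1) (i m) j) t ω)
          (traj (Z (m + 1) (i m)) t ω) (traj (Z (m + 1) j) t ω) -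
          pairMean B₀ B t μ (T R) (traj (Z (m + 1) (i m)) t ω)‖ ∂P ≤ ENNReal.ofReal (η / 3) := by
    rw [← ofReal_integral_eq_lintegral_ofReal (hUi m).norm (ae_of_all _ fun ω => norm_nonneg _)]
    exact ENNReal.ofReal_le_ofReal hUm.le
  refine (add_le_add_left (add_le_add h1 h2) _).trans ?_
  rw [lintegral_const, measure_univ, mul_one, ← ENNReal.ofReal_add (by positivity) (by positivity),
    ← ENNReal.ofReal_add (by positivity) (by positivity)]
  exact ENNReal.ofReal_le_ofReal (by linarith)

end Chaos

section Chaos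

variable {Ω : Type*} [MeasurableSpace Ω] {P : Measure Ω} [IsProbabilityMeasure P] {d : ℕ} {γ : ℝ}
  {B₀ : Opinion d → Opinion d → ℝ} {B : Bool → Opinion d → Opinion d → ℝ}
  {Z : (n : ℕ) → Fin n → ℕ → Ω → Opinion d}
  {A : (n : ℕ) → Fin n → Fin n → ℕ → Ω → Bool} {μ₀ ν : Measure (Opinion d)}
  [IsProbabilityMeasure μ₀] [IsProbabilityMeasure ν] {t : ℕ}

theorem Chaos.integrable_norm_last (hB : IsInteraction B₀ B) (hch : Chaos P γ B₀ B μ₀ ν Z A t)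
    (hZ : ∀ n i t, Measurable (Z n i t)) (hmom : MomentBound P Z t) :
    Integrable (fun z => ‖z (Fin.last t)‖) (limLaw γ B₀ B μ₀ ν t) := by
  have := isProbabilityMeasure_limLaw (γ := γ) (μ₀ := μ₀) (ν := ν) hB t
  obtain ⟨K, hK, hev⟩ := hmom.exists_sq
  exact (integrable_norm_of_lintegral_sq (f := fun z : Traj (Opinion d) t => ‖z (Fin.last t)‖)
    (by fun_prop) ((hch.lintegral_sq_le hB hK hev hZ).trans_lt ENNReal.ofReal_lt_top)).1

/-- Numerator and denominator converge in mean, and `min_norm_sub_ratio_le` combines them. The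
truncation by 1 absorbs the event of a small degree. -/
theorem Chaos.tendsto_neighbourMean (hB : IsInteraction B₀ B) (hμ₀ : μ₀ ≪ volume)
    (hν : ν ≪ volume) (hch : Chaos P γ B₀ B μ₀ ν Z A t)
    (hZ : ∀ n i t, Measurable (Z n i t)) (hA : ∀ n i j t, Measurable (A n i j t))
    (hmom : MomentBound P Z t) (hint : ExpDecay B₀ B ∨ FiniteRange B₀ B)
    (i : (m : ℕ) → Fin (m + 1)) :
    Tendsto (fun m => ∫ ω, min 1 ‖neighbourMean (Z (m + 1)) (A (m + 1)) (i m) t ω -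
      limitMean B₀ B t (limLaw γ B₀ B μ₀ ν t) (traj (Z (m + 1) (i m)) t ω)‖ ∂P) atTop (𝓝 0) := by
  have := isProbabilityMeasure_limLaw (γ := γ) (μ₀ := μ₀) (ν := ν) hB t
  have hi1 := hch.integrable_norm_last hB hZ hmom
  set μ := limLaw γ B₀ B μ₀ ν t with hμ
  have hT : ∀ n i, Measurable (traj (Z n i) t) := fun n i => measurable_traj (hZ n i) t
  let W : ℕ → Ω → ℝ := fun m ω => ‖neighbourMean (Z (m + 1)) (A (m + 1)) (i m) t ω -
      limitMean B₀ B t μ (traj (Z (m + 1) (i m)) t ω)‖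
  have hW : ∀ m, Measurable (W m) := fun m => ((measurable_neighbourMean (hZ _) (hA _) _ t).sub
    ((measurable_limitMean hB t μ).comp (hT _ _))).norm
  have hW0 : ∀ m ω, 0 ≤ min 1 (W m ω) := fun m ω => le_min zero_le_one (norm_nonneg _)
  suffices h : Tendsto (fun m => ∫⁻ ω, ENNReal.ofReal (min 1 (W m ω)) ∂P) atTop (𝓝 0) by
    refine ((ENNReal.tendsto_toReal ENNReal.zero_ne_top).comp h).congr fun m => ?_
    exact (integral_eq_lintegral_of_nonneg_ae (ae_of_all _ (hW0 m))
      (measurable_const.min (hW m)).aestronglyMeasurable).symm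
  obtain ⟨hDi, hD⟩ := hch.tendsto_lln_norm hB hμ₀ hν hZ hA (measurable_lastEdge (d := d))
    norm_lastEdge_le (fun a => ae_of_all _ fun p => continuous_const.continuousAt) i
  have hN := hch.tendsto_mean_lastOpinion hB hμ₀ hν hZ hA hmom i
  let K := ∫ y, ‖y (Fin.last t)‖ ∂μ
  have hNb : ∀ x, ‖pairMean B₀ B t μ lastOpinion x‖ ≤ K := fun x =>
    norm_integral_le_of_norm_le hi1 (ae_of_all _ fun y => norm_sum_edgeLaw_smul_le hB
      fun a => norm_edgeVal_smul_le _ _)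
  have hK : 0 ≤ K := integral_nonneg fun y => norm_nonneg _
  refine ENNReal.tendsto_nhds_zero.2 fun ε hε => ?_
  obtain ⟨η, hη, hηε⟩ : ∃ η : ℝ, 0 < η ∧ ENNReal.ofReal η ≤ ε := by
    rcases eq_or_ne ε ⊤ with rfl | h
    · exact ⟨1, one_pos, le_top⟩
    · exact ⟨ε.toReal, ENNReal.toReal_pos hε.ne' h, ENNReal.ofReal_toReal_le⟩
  -- The low degree term enters with the factor 2, so η/6 leaves η/3 for each of the three
  -- contributions.
  obtain ⟨δ, hδ, hlow⟩ := hch.eventually_lowDegree_le hB hμ₀ hν hint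
    (by positivity : 0 < η / 6) i
  have hN' : Tendsto (fun m : ℕ => ENNReal.ofReal δ⁻¹ * ∫⁻ ω, ENNReal.ofReal ‖((m : ℝ) + 1)⁻¹ • ∑ j,
        lastOpinion (traj (A (m + 1) (i m) j) t ω)
        (traj (Z (m + 1) (i m)) t ω) (traj (Z (m + 1) j) t ω) -
        pairMean B₀ B t μ lastOpinion (traj (Z (m + 1) (i m)) t ω)‖ ∂P) atTop (𝓝 0) := by
    simpa using ENNReal.Tendsto.const_mul hN (Or.inr ENNReal.ofReal_ne_top)
  have hD' := hD.const_mul (δ⁻¹ + K * (δ ^ 2)⁻¹)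
  rw [mul_zero] at hD'
  have hη3 : 0 < η / 3 := by positivity
  filter_upwards [hlow, hN'.eventually_lt_const (ENNReal.ofReal_pos.2 hη3),
    hD'.eventually_lt_const hη3] with m h1 h2 h3
  refine le_trans ?_ hηε
  let D : Ω → ℝ := fun ω => ((m : ℝ) + 1)⁻¹ • ∑ j, lastEdge (traj (A (m + 1) (i m) j) t ω)
        (traj (Z (m + 1) (i m)) t ω) (traj (Z (m + 1) j) t ω) -
        pairMean B₀ B t μ lastEdge (traj (Z (m + 1) (i m)) t ω)
  let N : Ω → Opinion d := fun ω => ((m : ℝ) + 1)⁻¹ • ∑ j,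
        lastOpinion (traj (A (m + 1) (i m) j) t ω)
        (traj (Z (m + 1) (i m)) t ω) (traj (Z (m + 1) j) t ω) -
        pairMean B₀ B t μ lastOpinion (traj (Z (m + 1) (i m)) t ω)
  let L : Ω → ℝ := fun ω =>
    max 0 (1 - pairMean B₀ B t μ lastEdge (traj (Z (m + 1) (i m)) t ω) / (4 * δ))
  have hLm : Measurable L := measurable_const.max (measurable_const.sub
    (((measurable_pairMean hB measurable_lastEdge).comp (hT _ _)).div_const _))
  have hLi : Integrable L P := integrable_bounded (M := 1) hLm fun ω => by
    rw [abs_of_nonneg (le_max_left _ _)]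
    have : 0 ≤ pairMean B₀ B t μ lastEdge (traj (Z (m + 1) (i m)) t ω) / (4 * δ) :=
      div_nonneg (pairMean_lastEdge_nonneg hB μ _) (by positivity)
    exact max_le zero_le_one (by linarith)
  have hDi' : Integrable D P := hDi m
  have hpt : ∀ ω, ENNReal.ofReal (min 1 (W m ω)) ≤
      ENNReal.ofReal (2 * L ω + (δ⁻¹ + K * (δ ^ 2)⁻¹) * |D ω|) +
        ENNReal.ofReal δ⁻¹ * ENNReal.ofReal ‖N ω‖ := by
    intro ω
    have hc : 0 ≤ δ⁻¹ + K * (δ ^ 2)⁻¹ := by positivity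
    rw [← ENNReal.ofReal_mul (by positivity), ← ENNReal.ofReal_add (add_nonneg
      (mul_nonneg zero_le_two (le_max_left _ _)) (mul_nonneg hc (abs_nonneg _))) (by positivity)]
    refine ENNReal.ofReal_le_ofReal ?_
    have h := min_norm_sub_ratio_le
      (D := ((m : ℝ) + 1)⁻¹ • ∑ j, lastEdge (traj (A (m + 1) (i m) j) t ω)
        (traj (Z (m + 1) (i m)) t ω) (traj (Z (m + 1) j) t ω))
      (N := ((m : ℝ) + 1)⁻¹ • ∑ j, lastOpinion (traj (A (m + 1) (i m) j) t ω)
        (traj (Z (m + 1) (i m)) t ω) (traj (Z (m + 1) j) t ω))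
      (D' := pairMean B₀ B t μ lastEdge (traj (Z (m + 1) (i m)) t ω)) hδ
      (hNb (traj (Z (m + 1) (i m)) t ω))
    rw [← neighbourMean_eq_ratio, ← limitMean_eq] at h
    refine h.trans (le_of_eq ?_)
    simp only [D, N]
    ring
  have hcongr : ∫⁻ ω, ENNReal.ofReal δ⁻¹ * ENNReal.ofReal ‖N ω‖ ∂P ≤ ENNReal.ofReal (η / 3) := by
    rw [lintegral_const_mul' _ _ ENNReal.ofReal_ne_top]
    exact h2.le
  have hI : Integrable (fun ω => 2 * L ω + (δ⁻¹ + K * (δ ^ 2)⁻¹) * |D ω|) P :=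
    (hLi.const_mul 2).add (hDi'.abs.const_mul _)
  refine (lintegral_mono hpt).trans ?_
  rw [lintegral_add_left' hI.aemeasurable.ennreal_ofReal, ← ofReal_integral_eq_lintegral_ofReal hI
    (ae_of_all _ fun ω => add_nonneg (mul_nonneg zero_le_two (le_max_left _ _))
      (mul_nonneg (by positivity) (abs_nonneg _))),
    integral_add (hLi.const_mul 2) (hDi'.abs.const_mul _), integral_const_mul, integral_const_mul]
  refine (add_le_add (ENNReal.ofReal_le_ofReal (add_le_add
    (mul_le_mul_of_nonneg_left h1 zero_le_two) h3.le)) hcongr).trans ?_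
  rw [← ENNReal.ofReal_add (by positivity) (by positivity)]
  exact ENNReal.ofReal_le_ofReal (by linarith)

end Chaos

/-! ### One step of the dynamics -/

theorem traj_succ {Ω X : Type*} (x : ℕ → Ω → X) (t : ℕ) (ω : Ω) :
    traj x (t + 1) ω = Fin.snoc (α := fun _ => X) (traj x t ω) (x (t + 1) ω) := by
  funext s
  refine Fin.lastCases ?_ (fun r => ?_) s
  · simp [traj]
  · simp [traj]

theorem same_traj_succ {Ω X : Type*} [DecidableEq X] (x : ℕ → Ω → X) (t : ℕ) (ω : Ω)
    (a : Traj X (t + 1)) : same (traj x (t + 1) ω) a =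
      same (traj x t ω) (fun r => a r.castSucc) * same (x (t + 1) ω) (a (Fin.last (t + 1))) := by
  have h : traj x (t + 1) ω = a ↔
      traj x t ω = (fun r => a r.castSucc) ∧ x (t + 1) ω = a (Fin.last (t + 1)) := by
    rw [funext_iff, Fin.forall_fin_succ', funext_iff]
    simp [traj]
  by_cases h1 : traj x t ω = (fun r => a r.castSucc) <;>
    by_cases h2 : x (t + 1) ω = a (Fin.last (t + 1)) <;> simp [same, h, h1, h2]

theorem same_traj_zero {Ω X : Type*} [DecidableEq X] (x : ℕ → Ω → X) (ω : Ω)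
    (a : Traj X 0) : same (traj x 0 ω) a = same (x 0 ω) (a 0) := by
  have h : traj x 0 ω = a ↔ x 0 ω = a 0 := by
    rw [funext_iff, Fin.forall_fin_one]
    simp [traj]
  simp [same, h]

section Network

variable {Ω ι : Type*} {d : ℕ} [MeasurableSpace Ω] {P : Measure Ω} [IsProbabilityMeasure P]
  [LinearOrder ι] {B₀ : Opinion d → Opinion d → ℝ} {B : Bool → Opinion d → Opinion d → ℝ}
  {Z : ι → ℕ → Ω → Opinion d} {A : ι → ι → ℕ → Ω → Bool} {k r : ℕ} {p q : Fin r → Fin k}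
  {J : Fin k → ι}

theorem integral_mul_edgePath_zero (hN : IsNetwork P B₀ B Z A) (hZ : ∀ i t, Measurable (Z i t))
    (hpq : IsSimpleFamily p q) (hJ : Function.Injective J) (a : Fin r → Traj Bool 0)
    {G : (Fin k → Traj (Opinion d) 0) → ℝ} (hG : Measurable G) {M : ℝ} (hM : ∀ z, |G z| ≤ M) :
    ∫ ω, G (fun i => traj (Z (J i)) 0 ω) * ∏ e, same (traj (A (J (p e)) (J (q e))) 0 ω) (a e) ∂P =
      ∫ ω, G (fun i => traj (Z (J i)) 0 ω) *
        ∏ e, edgeLaw B₀ B 0 (traj (Z (J (p e))) 0 ω) (traj (Z (J (q e))) 0 ω) (a e) ∂P := by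
  simp only [same_traj_zero]
  refine (integral_mul_prod_edge hN hZ (hpq.comp_injective hJ) (fun e => a e 0) 0
    (F := fun ω => G fun i => traj (Z (J i)) 0 ω) ?_ fun ω => hM _).trans rfl
  exact hG.comp (@measurable_pi_lambda _ _ _ (preEdgeHistory Z A 0) _ _
    fun i => measurable_pre_traj Z A 0 (J i))

/-- Only the newest edges are integrated out. The older part of the path indicator is known and
stays, and on its event the previous edges equal the prescribed ones, so the edge probabilities
become functions of the opinions alone. -/
theorem integral_mul_edgePath_succ (hN : IsNetwork P B₀ B Z A) (hZ : ∀ i t, Measurable (Z i t))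
    (hpq : IsSimpleFamily p q) (hJ : Function.Injective J) (t : ℕ) (a : Fin r → Traj Bool (t + 1))
    {G : (Fin k → Traj (Opinion d) (t + 1)) → ℝ} (hG : Measurable G) {M : ℝ}
    (hM : ∀ z, |G z| ≤ M) :
    ∫ ω, G (fun i => traj (Z (J i)) (t + 1) ω) *
        ∏ e, same (traj (A (J (p e)) (J (q e))) (t + 1) ω) (a e) ∂P =
      ∫ ω, (G (fun i => traj (Z (J i)) (t + 1) ω) *
        ∏ e, ber (B (a e (Fin.last t).castSucc) (Z (J (p e)) (t + 1) ω) (Z (J (q e)) (t + 1) ω))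
          (a e (Fin.last (t + 1)))) *
        ∏ e, same (traj (A (J (p e)) (J (q e))) t ω) (fun s => a e s.castSucc) ∂P := by
  simp only [same_traj_succ, Finset.prod_mul_distrib, ← mul_assoc]
  refine (integral_mul_prod_edge hN hZ (hpq.comp_injective hJ)
    (fun e => a e (Fin.last (t + 1))) (t + 1) (M := M)
    (F := fun ω => G (fun i => traj (Z (J i)) (t + 1) ω) *
      ∏ e, same (traj (A (J (p e)) (J (q e))) t ω) (fun s => a e s.castSucc)) ?_ fun ω => ?_).trans ?_
  · let _ : MeasurableSpace Ω := preEdgeHistory Z A (t + 1)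
    exact (hG.comp (measurable_pi_lambda _ fun i => measurable_pre_traj Z A (t + 1) (J i))).mul
      (Finset.measurable_prod _ fun e _ => measurable_same (measurable_pre_edgeTraj Z A t _ _) _)
  · exact abs_mul_le_of_mem_Icc (hM _) (prod_mem_Icc fun e => same_mem _ _)
  · refine integral_congr_ae (ae_of_all _ fun ω => ?_)
    simp only
    rw [mul_assoc, mul_assoc, mul_comm (∏ e, ber _ _), ← Finset.prod_mul_distrib,
      ← Finset.prod_mul_distrib]
    congr 1
    refine Finset.prod_congr rfl fun e _ => ?_
    -- Off this event both sides vanish, so the state of the previous edge may be replaced in either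
    -- case.
    by_cases h : traj (A (J (p e)) (J (q e))) t ω = fun s => a e s.castSucc
    · have := congrFun h (Fin.last t)
      simp only [traj, Fin.val_last] at this
      simp only [edgeProb, Function.comp_apply, this]
    · simp [same, h]

end Network

section Step

variable {Ω : Type*} [MeasurableSpace Ω] {P : Measure Ω} [IsProbabilityMeasure P] {d : ℕ} {γ : ℝ}
  {B₀ : Opinion d → Opinion d → ℝ} {B : Bool → Opinion d → Opinion d → ℝ}
  {μ₀ ν : Measure (Opinion d)} [IsProbabilityMeasure μ₀] [IsProbabilityMeasure ν]
  {t k r : ℕ} {p q : Fin r → Fin k}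

/-- The expectation of `f` after one step of the limiting dynamics started from `z`. -/
noncomputable def stepMean (γ : ℝ) (B₀ : Opinion d → Opinion d → ℝ)
    (B : Bool → Opinion d → Opinion d → ℝ) (ν : Measure (Opinion d)) (t : ℕ)
    (μ : Measure (Traj (Opinion d) t)) (f : (Fin k → Traj (Opinion d) (t + 1)) → ℝ)
    (z : Fin k → Traj (Opinion d) t) : ℝ :=
  ∫ x, f (fun i => limStep γ B₀ B t μ (z i, x i)) ∂Measure.pi fun _ : Fin k => ν

theorem measurable_pi_limStep (hB : IsInteraction B₀ B) (μ : Measure (Traj (Opinion d) t))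
    [SFinite μ] : Measurable fun p : (Fin k → Traj (Opinion d) t) × (Fin k → Opinion d) =>
      fun i => limStep γ B₀ B t μ (p.1 i, p.2 i) :=
  measurable_pi_lambda _ fun i => (measurable_limStep γ hB t μ).comp (by fun_prop)

theorem measurable_stepMean (hB : IsInteraction B₀ B) (μ : Measure (Traj (Opinion d) t))
    [SFinite μ] {f : (Fin k → Traj (Opinion d) (t + 1)) → ℝ} (hf : Measurable f) :
    Measurable (stepMean γ B₀ B ν t μ f) :=
  measurable_integral_left (ν := Measure.pi fun _ : Fin k => ν)
    (F := fun (z : Fin k → Traj (Opinion d) t) (x : Fin k → Opinion d) =>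
      f fun i => limStep γ B₀ B t μ (z i, x i)) (hf.comp (measurable_pi_limStep hB μ))

theorem abs_stepMean_le (μ : Measure (Traj (Opinion d) t))
    {f : (Fin k → Traj (Opinion d) (t + 1)) → ℝ} {M : ℝ} (hM : ∀ z, |f z| ≤ M)
    (z : Fin k → Traj (Opinion d) t) : |stepMean γ B₀ B ν t μ f z| ≤ M := by
  have := norm_integral_le_of_norm_le_const (μ := Measure.pi fun _ : Fin k => ν)
    (f := fun x => f (fun i => limStep γ B₀ B t μ (z i, x i))) (ae_of_all _ fun x => hM _)
  simpa [stepMean] using this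

theorem continuousAt_limStep {μ : Measure (Traj (Opinion d) t)} {z : Traj (Opinion d) t}
    (h : ContinuousAt (limitMean B₀ B t μ) z) (x : Opinion d) :
    ContinuousAt (fun z => limStep γ B₀ B t μ (z, x)) z := by
  refine ContinuousAt.finSnoc (A := fun _ => Opinion d) (f := fun z => z) continuousAt_id ?_
  exact (((continuous_apply (Fin.last t)).continuousAt.const_smul (1 - γ)).add
    (h.const_smul γ)).add continuousAt_const

theorem ae_pi_of_ae {X : Type*} [MeasurableSpace X] {μ : Measure X} [IsProbabilityMeasure μ]
    {s : X → Prop} (h : ∀ᵐ x ∂μ, s x) :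
    ∀ᵐ z ∂(Measure.pi fun _ : Fin k => μ), ∀ i, s (z i) :=
  ae_all_iff.2 fun i =>
    (measurePreserving_eval (fun _ : Fin k => μ) i).quasiMeasurePreserving.ae h

/-- For each value of the noise the step is continuous wherever `limitMean` is, and dominated
convergence integrates over the noise. This makes `stepMean` an admissible test function for chaos
at time t. -/
theorem ae_continuousAt_stepMean (hB : IsInteraction B₀ B) {μ : Measure (Traj (Opinion d) t)}
    [IsProbabilityMeasure μ] (hμ : ∀ᵐ z ∂μ, ContinuousAt (limitMean B₀ B t μ) z)
    {f : (Fin k → Traj (Opinion d) (t + 1)) → ℝ} (hf : Continuous f) {M : ℝ}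
    (hM : ∀ z, |f z| ≤ M) :
    ∀ᵐ z ∂(Measure.pi fun _ : Fin k => μ), ContinuousAt (stepMean γ B₀ B ν t μ f) z := by
  filter_upwards [ae_pi_of_ae hμ] with z hz
  refine continuousAt_of_dominated (bound := fun _ => M) (Eventually.of_forall fun z' =>
    ((hf.measurable.comp (measurable_pi_limStep hB μ)).comp
      measurable_prodMk_left).aestronglyMeasurable)
    (Eventually.of_forall fun z' => ae_of_all _ fun x => hM _) (integrable_const _)
    (ae_of_all _ fun x => ?_)
  refine hf.continuousAt.comp (continuousAt_pi.2 fun i => ?_)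
  exact ContinuousAt.comp (f := fun z : Fin k → Traj (Opinion d) t => z i) (x := z)
    (g := fun z => limStep γ B₀ B t μ (z, x i)) (continuousAt_limStep (hz i) (x i))
    (continuous_apply i).continuousAt

/-- The noise is independent of trajectories and edge paths jointly, so it can be integrated out
although the path indicators are present. -/
theorem integral_limStep_mul (hB : IsInteraction B₀ B) (μ : Measure (Traj (Opinion d) t))
    [SFinite μ] {X : Ω → Fin k → Traj (Opinion d) t} {b : Ω → Fin r → Traj Bool t}
    {ξ : Ω → Fin k → Opinion d} (hX : Measurable X) (hb : Measurable b) (hξ : Measurable ξ)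
    (hind : IndepFun (fun ω => (X ω, b ω)) ξ P) (hlaw : P.map ξ = Measure.pi fun _ => ν)
    {f : (Fin k → Traj (Opinion d) (t + 1)) → ℝ} (hf : Measurable f) {M : ℝ}
    (hM : ∀ z, |f z| ≤ M) (a : Fin r → Traj Bool t) :
    ∫ ω, f (fun i => limStep γ B₀ B t μ (X ω i, ξ ω i)) * ∏ e, same (b ω e) (a e) ∂P =
      ∫ ω, stepMean γ B₀ B ν t μ f (X ω) * ∏ e, same (b ω e) (a e) ∂P := by
  have h := integral_indep_prod (hX.prodMk hb) hξ hind (M := M)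
    (F := fun p : ((Fin k → Traj (Opinion d) t) × (Fin r → Traj Bool t)) × (Fin k → Opinion d) =>
      f (fun i => limStep γ B₀ B t μ (p.1.1 i, p.2 i)) * ∏ e, same (p.1.2 e) (a e))
    ((hf.comp ((measurable_pi_limStep hB μ).comp (by fun_prop : Measurable fun p :
      ((Fin k → Traj (Opinion d) t) × (Fin r → Traj Bool t)) × (Fin k → Opinion d) =>
        (p.1.1, p.2)))).mul (Finset.measurable_prod _ fun e _ => measurable_same (by fun_prop) _))
    fun p => abs_mul_le_of_mem_Icc (hM _) (prod_mem_Icc fun e => same_mem _ _)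
  simp only [hlaw, integral_mul_const] at h
  exact h

/-- The counterpart of `integral_limStep_mul` under the limit law: the weight involves only times up
to t and is unaffected by integrating over the noise. -/
theorem integral_pi_limLaw_succ (hB : IsInteraction B₀ B)
    {f : (Fin k → Traj (Opinion d) (t + 1)) → ℝ} (hf : Measurable f) {M : ℝ}
    (hM : ∀ z, |f z| ≤ M) (a : Fin r → Traj Bool t) :
    ∫ z, f z * ∏ e, edgeLaw B₀ B t (fun s => z (p e) s.castSucc) (fun s => z (q e) s.castSucc) (a e)
        ∂(Measure.pi fun _ : Fin k => limLaw γ B₀ B μ₀ ν (t + 1)) =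
      ∫ z, stepMean γ B₀ B ν t (limLaw γ B₀ B μ₀ ν t) f z *
        ∏ e, edgeLaw B₀ B t (z (p e)) (z (q e)) (a e)
        ∂(Measure.pi fun _ : Fin k => limLaw γ B₀ B μ₀ ν t) := by
  have := isProbabilityMeasure_limLaw (γ := γ) (μ₀ := μ₀) (ν := ν) hB t
  have hv : Measurable fun z : Fin k → Traj (Opinion d) (t + 1) =>
      ∏ e, edgeLaw B₀ B t (fun s => z (p e) s.castSucc) (fun s => z (q e) s.castSucc) (a e) :=
    Finset.measurable_prod _ fun e _ => (measurable_edgeLaw hB t (a e)).comp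
      (f := fun z : Fin k → Traj (Opinion d) (t + 1) =>
        ((fun s : Fin (t + 1) => z (p e) s.castSucc), (fun s : Fin (t + 1) => z (q e) s.castSucc)))
      (by fun_prop)
  have hfv : Measurable fun z : Fin k → Traj (Opinion d) (t + 1) => f z *
      ∏ e, edgeLaw B₀ B t (fun s => z (p e) s.castSucc) (fun s => z (q e) s.castSucc) (a e) :=
    hf.mul hv
  have hS := measurable_pi_limStep (k := k) (γ := γ) hB (limLaw γ B₀ B μ₀ ν t)
  rw [pi_limLaw_succ hB t k, integral_map hS.aemeasurable hfv.aestronglyMeasurable,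
    integral_prod]
  · refine integral_congr_ae (ae_of_all _ fun z => ?_)
    simp only [limStep, Fin.snoc_castSucc]
    rw [integral_mul_const]
    rfl
  · refine integrable_bounded (M := M) (hfv.comp hS) fun p => ?_
    exact abs_mul_le_of_mem_Icc (hM _) (prod_mem_Icc fun e => edgeLaw_mem hB _ _ _ _)

theorem ae_continuousAt_mul_prod {X : Type*} [TopologicalSpace X] [MeasurableSpace X]
    {μ : Measure X} [IsProbabilityMeasure μ] {p q : Fin r → Fin k} (hpq : ∀ e, p e ≠ q e)
    {G : (Fin k → X) → ℝ} (hG : ∀ᵐ z ∂(Measure.pi fun _ : Fin k => μ), ContinuousAt G z)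
    {g : Fin r → X → X → ℝ}
    (hg : ∀ e, ∀ᵐ x ∂μ.prod μ, ContinuousAt (fun x : X × X => g e x.1 x.2) x) :
    ∀ᵐ z ∂(Measure.pi fun _ : Fin k => μ),
      ContinuousAt (fun z => G z * ∏ e, g e (z (p e)) (z (q e))) z := by
  have h : ∀ᵐ z ∂(Measure.pi fun _ : Fin k => μ), ∀ e,
      ContinuousAt (fun x : X × X => g e x.1 x.2) (z (p e), z (q e)) :=
    ae_all_iff.2 fun e =>
      (measurePreserving_eval_pair (κ := Fin k) μ (hpq e)).quasiMeasurePreserving.ae (hg e)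
  filter_upwards [hG, h] with z h1 h2
  refine h1.mul (tendsto_finsetProd _ fun e _ => ?_)
  exact ContinuousAt.comp (f := fun z : Fin k → X => (z (p e), z (q e))) (x := z) (h2 e)
    (by fun_prop)

end Step

/-! ### Propagation of chaos by induction on time -/

section Chaos

variable {Ω : Type*} [MeasurableSpace Ω] {P : Measure Ω} [IsProbabilityMeasure P] {d : ℕ} {γ : ℝ}
  {B₀ : Opinion d → Opinion d → ℝ} {B : Bool → Opinion d → Opinion d → ℝ}
  {ξ : ℕ → ℕ → Ω → Opinion d} {Z : (n : ℕ) → Fin n → ℕ → Ω → Opinion d}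
  {A : (n : ℕ) → Fin n → Fin n → ℕ → Ω → Bool} {μ₀ ν : Measure (Opinion d)}
  [IsProbabilityMeasure μ₀] [IsProbabilityMeasure ν] {t k r : ℕ} {p q : Fin r → Fin k}

theorem pi_limLaw_zero : (Measure.pi fun _ : Fin k => limLaw γ B₀ B μ₀ ν 0) =
    (Measure.pi fun _ : Fin k => μ₀).map fun x i _ => x i := by
  have hc : Measurable fun (x : Opinion d) (_ : Fin (0 + 1)) => x := by fun_prop
  have := Measure.isProbabilityMeasure_map (μ := μ₀) hc.aemeasurable
  exact (Measure.pi_map_pi (μ := fun _ : Fin k => μ₀)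
    (f := fun _ (x : Opinion d) (_ : Fin (0 + 1)) => x) (fun _ => hc.aemeasurable)).symm

theorem tendsto_integral_initial_traj (hinit : IsInitial P (fun n i => Z n i 0) μ₀)
    {J : (m : ℕ) → Fin k → Fin (m + 1)} (hJ : ∀ᶠ m in atTop, Function.Injective (J m))
    {f : (Fin k → Traj (Opinion d) 0) → ℝ} (hf : Continuous f) {M : ℝ} (hM : ∀ x, |f x| ≤ M) :
    Tendsto (fun m => ∫ ω, f (fun i => traj (Z (m + 1) (J m i)) 0 ω) ∂P) atTop
      (𝓝 (∫ z, f z ∂Measure.pi fun _ : Fin k => limLaw γ B₀ B μ₀ ν 0)) := by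
  have hc : Continuous fun (x : Fin k → Opinion d) (i : Fin k) (_ : Fin (0 + 1)) => x i := by
    fun_prop
  have e : ∀ m ω, (fun i => traj (Z (m + 1) (J m i)) 0 ω) =
      fun i (_ : Fin (0 + 1)) => Z (m + 1) (J m i) 0 ω := fun m ω => by
    funext i s
    rw [Fin.fin_one_eq_zero s]
    rfl
  rw [pi_limLaw_zero, integral_map hc.measurable.aemeasurable hf.measurable.aestronglyMeasurable]
  simp only [e]
  exact tendsto_integral_initial hinit hJ (hf.comp hc) fun x => hM _

/-- Integrating out the initial edges leaves an almost everywhere continuous function of the initial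
opinions, whose weak convergence is an assumption; the weights in the portmanteau argument are
trivial. -/
theorem chaos_zero (hB : IsInteraction B₀ B) (hsys : IsParticleSystem P γ B₀ B ξ Z A)
    (hinit : IsInitial P (fun n i => Z n i 0) μ₀) (hν : ν ≪ volume) :
    Chaos P γ B₀ B μ₀ ν Z A 0 := by
  intro k r p q hpq J hJ a G M hG hM hGc
  have := isProbabilityMeasure_limLaw (γ := γ) (μ₀ := μ₀) (ν := ν) hB 0
  have hv : Measurable fun z : Fin k → Traj (Opinion d) 0 =>
      ∏ e, edgeLaw B₀ B 0 (z (p e)) (z (q e)) (a e) :=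
    Finset.measurable_prod _ fun e _ => (measurable_edgeLaw hB 0 (a e)).comp
      (f := fun z : Fin k → Traj (Opinion d) 0 => (z (p e), z (q e))) (by fun_prop)
  let G' : (Fin k → Traj (Opinion d) 0) → ℝ := fun z =>
    G z * ∏ e, edgeLaw B₀ B 0 (z (p e)) (z (q e)) (a e)
  have hG' : Measurable G' := hG.mul hv
  have hGb' : ∀ z, |G' z| ≤ M := fun z =>
    abs_mul_le_of_mem_Icc (hM z) (prod_mem_Icc fun e => edgeLaw_mem hB 0 _ _ _)
  have hGc' : ∀ᵐ z ∂(Measure.pi fun _ : Fin k => limLaw γ B₀ B μ₀ ν 0), ContinuousAt G' z :=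
    ae_continuousAt_mul_prod (g := fun e z z' => edgeLaw B₀ B 0 z z' (a e)) hpq.ne hGc
      fun e => ae_continuousAt_edgeLaw hB hinit.ac hν 0 (a e)
  have h := tendsto_integral_mul_of_lipschitz (P := P)
    (m := Measure.pi fun _ : Fin k => limLaw γ B₀ B μ₀ ν 0)
    (x := fun m ω i => traj (Z (m + 1) (J m i)) 0 ω)
    (fun m => measurable_pi_lambda _ fun i => measurable_traj (hsys.measurable_opinion _ _) 0)
    (w := fun _ _ => 1) (fun _ => measurable_const) (fun _ _ => ⟨zero_le_one, le_rfl⟩)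
    (v := fun _ => 1) measurable_const (fun _ => ⟨zero_le_one, le_rfl⟩) (fun f M' hM' K hf => by
      simp only [mul_one]
      exact tendsto_integral_initial_traj hinit hJ hf.continuous hM')
    hG' hGb' hGc'
  simp only [mul_one] at h
  refine h.congr' ?_
  filter_upwards [hJ] with m hm
  exact (integral_mul_edgePath_zero (hsys.network (m + 1)) (hsys.measurable_opinion _) hpq hm a hG
    hM).symm

theorem dist_snoc_le {X : Type*} [PseudoMetricSpace X] (z : Traj X t) (x y : X) :
    dist (Fin.snoc (α := fun _ => X) z x : Traj X (t + 1)) (Fin.snoc (α := fun _ => X) z y) ≤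
      dist x y := by
  refine (dist_pi_le_iff dist_nonneg).2 fun s => Fin.lastCases ?_ (fun i => ?_) s
  · simp
  · simp [dist_nonneg]

/-- Joint independence from trajectories and edge paths: both are measurable for the full history,
which includes the edges at time t. -/
theorem indepFun_noise (hsys : IsParticleSystem P γ B₀ B ξ Z A) (m t : ℕ)
    (J : Fin k → Fin (m + 1)) (p q : Fin r → Fin k) :
    IndepFun (fun ω => ((fun i => traj (Z (m + 1) (J i)) t ω),
      (fun e => traj (A (m + 1) (J (p e)) (J (q e))) t ω))) (fun ω i => ξ (J i) t ω) P := by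
  rw [IndepFun_iff_Indep]
  refine indep_of_indep_of_le_left (indep_of_indep_of_le_right (hsys.noise_indep_past t).symm ?_) ?_
  · refine Measurable.comap_le ?_
    let _ : MeasurableSpace Ω := ⨆ i, MeasurableSpace.comap (ξ i t) inferInstance
    exact measurable_pi_lambda _ fun i => (comap_measurable (ξ (J i) t)).mono
      (le_iSup (fun i => MeasurableSpace.comap (ξ i t) inferInstance) (J i : ℕ)) le_rfl
  · refine le_trans ?_ (le_iSup (fun n => fullHistory (Z n) (A n) t) (m + 1))
    refine Measurable.comap_le ?_
    let _ : MeasurableSpace Ω := fullHistory (Z (m + 1)) (A (m + 1)) t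
    exact (measurable_pi_lambda _ fun i => measurable_full_traj _ _ t _).prodMk
      (measurable_pi_lambda _ fun e => measurable_full_edgeTraj _ _ t _ _)

theorem map_noise (hsys : IsParticleSystem P γ B₀ B ξ Z A) (hν : P.map (ξ 0 0) = ν) (m t : ℕ)
    {J : Fin k → Fin (m + 1)} (hJ : Function.Injective J) :
    P.map (fun ω i => ξ (J i) t ω) = Measure.pi fun _ => ν := by
  have h := hsys.noise_indep.precomp (g := fun i : Fin k => ((J i : ℕ), t)) fun i j hij =>
    hJ (Fin.ext (Prod.mk.inj hij).1)
  rw [(iIndepFun_iff_map_fun_eq_pi_map fun i => (hsys.measurable_noise _ _).aemeasurable).1 h]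
  congr 1
  funext i
  rw [← hν]
  exact (hsys.noise_identDistrib (J i) t).map_eq

/-- Replace the true step `X` by the step `Y` in which the neighbourhood mean is `limitMean`, with
the same noise. The Lipschitz property controls the difference by the truncated errors of
`Chaos.tendsto_neighbourMean`, and after integrating out the noise, `Y` is covered by chaos at time
t. The edge weights here end at time t, since the later edges are drawn after the step. -/
theorem tendsto_integral_lipschitz_succ (hγ : γ ∈ Set.Ioo (0 : ℝ) 1) (hB : IsInteraction B₀ B)
    (hsys : IsParticleSystem P γ B₀ B ξ Z A) (hνξ : P.map (ξ 0 0) = ν) (hμ₀ : μ₀ ≪ volume)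
    (hν : ν ≪ volume) (hint : ExpDecay B₀ B ∨ FiniteRange B₀ B)
    (hmom : MomentBound P Z t) (hch : Chaos P γ B₀ B μ₀ ν Z A t) (hpq : IsSimpleFamily p q)
    {J : (m : ℕ) → Fin k → Fin (m + 1)} (hJ : ∀ᶠ m in atTop, Function.Injective (J m))
    (a : Fin r → Traj Bool t) {f : (Fin k → Traj (Opinion d) (t + 1)) → ℝ} {M : ℝ}
    (hM : ∀ z, |f z| ≤ M) {K : NNReal} (hf : LipschitzWith K f) :
    Tendsto (fun m => ∫ ω, f (fun i => traj (Z (m + 1) (J m i)) (t + 1) ω) *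
      ∏ e, same (traj (A (m + 1) (J m (p e)) (J m (q e))) t ω) (a e) ∂P) atTop
      (𝓝 (∫ z, f z * ∏ e, edgeLaw B₀ B t (fun s => z (p e) s.castSucc)
        (fun s => z (q e) s.castSucc) (a e)
        ∂(Measure.pi fun _ : Fin k => limLaw γ B₀ B μ₀ ν (t + 1)))) := by
  have := isProbabilityMeasure_limLaw (γ := γ) (μ₀ := μ₀) (ν := ν) hB t
  have hZ := hsys.measurable_opinion
  have hA : ∀ n i j t, Measurable (A n i j t) := fun n => (hsys.network n).measurable
  have hL := ae_continuousAt_limitMean hB hμ₀ hν hint (hch.integrable_norm_last hB hZ hmom)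
  have hnm := fun i => hch.tendsto_neighbourMean hB hμ₀ hν hZ hA hmom hint (fun m => J m i)
  set μ := limLaw γ B₀ B μ₀ ν t with hμ
  have hT : ∀ n i, Measurable (traj (Z n i) t) := fun n i => measurable_traj (hZ n i) t
  have hTA : ∀ n i j, Measurable (traj (A n i j) t) := fun n i j => measurable_traj (hA n i j) t
  rw [integral_pi_limLaw_succ hB hf.continuous.measurable hM a]
  have h1 := hch k r p q hpq J hJ a (stepMean γ B₀ B ν t μ f) M
    (measurable_stepMean hB μ hf.continuous.measurable) (abs_stepMean_le μ hM)
    (ae_continuousAt_stepMean hB hL hf.continuous hM)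
  let Y : ℕ → Ω → Fin k → Traj (Opinion d) (t + 1) := fun m ω i =>
    limStep γ B₀ B t μ (traj (Z (m + 1) (J m i)) t ω, ξ (J m i) t ω)
  let X : ℕ → Ω → Fin k → Traj (Opinion d) (t + 1) := fun m ω i =>
    traj (Z (m + 1) (J m i)) (t + 1) ω
  let w : ℕ → Ω → ℝ := fun m ω =>
    ∏ e, same (traj (A (m + 1) (J m (p e)) (J m (q e))) t ω) (a e)
  let D : (m : ℕ) → Fin k → Ω → ℝ := fun m i ω =>
    min 1 ‖neighbourMean (Z (m + 1)) (A (m + 1)) (J m i) t ω -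
      limitMean B₀ B t μ (traj (Z (m + 1) (J m i)) t ω)‖
  have hYm : ∀ m, Measurable (Y m) := fun m => measurable_pi_lambda _ fun i =>
    (measurable_limStep γ hB t μ).comp ((hT _ _).prodMk (hsys.measurable_noise _ _))
  have hXm : ∀ m, Measurable (X m) := fun m => measurable_pi_lambda _ fun i =>
    measurable_traj (hZ _ _) (t + 1)
  have hwm : ∀ m, Measurable (w m) := fun m =>
    Finset.measurable_prod _ fun e _ => measurable_same (hTA _ _ _) _
  have hw : ∀ m ω, w m ω ∈ Set.Icc (0 : ℝ) 1 := fun m ω => prod_mem_Icc fun e => same_mem _ _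
  have hDm : ∀ m i, Measurable (D m i) := fun m i => measurable_const.min
    (((measurable_neighbourMean (hZ _) (hA _) _ t).sub
      ((measurable_limitMean hB t μ).comp (hT _ _))).norm)
  have hD0 : ∀ m i ω, 0 ≤ D m i ω := fun m i ω => le_min zero_le_one (norm_nonneg _)
  have hDi : ∀ m i, Integrable (D m i) P := fun m i => integrable_bounded (M := 1) (hDm m i)
    fun ω => by rw [abs_of_nonneg (hD0 m i ω)]; exact min_le_left _ _
  have hMnn : 0 ≤ M := (abs_nonneg _).trans (hM fun _ _ => 0)
  have hIX : ∀ m, Integrable (fun ω => f (X m ω) * w m ω) P := fun m => integrable_bounded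
    ((hf.continuous.measurable.comp (hXm m)).mul (hwm m)) fun ω =>
      abs_mul_le_of_mem_Icc (hM _) (hw m ω)
  have hIY : ∀ m, Integrable (fun ω => f (Y m ω) * w m ω) P := fun m => integrable_bounded
    ((hf.continuous.measurable.comp (hYm m)).mul (hwm m)) fun ω =>
      abs_mul_le_of_mem_Icc (hM _) (hw m ω)
  have hpt : ∀ m, ∀ᵐ ω ∂P, |f (X m ω) * w m ω - f (Y m ω) * w m ω| ≤
      (2 * M + K) * ∑ i, D m i ω := by
    intro m
    filter_upwards [ae_all_iff.2 fun i : Fin k => hsys.opinion_step (m + 1) (J m i) t] with ω hω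
    rw [← sub_mul]
    refine abs_mul_le_of_mem_Icc ?_ (hw m ω)
    let E : Fin k → ℝ := fun i => ‖neighbourMean (Z (m + 1)) (A (m + 1)) (J m i) t ω -
      limitMean B₀ B t μ (traj (Z (m + 1) (J m i)) t ω)‖
    -- If some error is at least 1, the trivial bound 2M suffices; otherwise no truncation is active
    -- and the Lipschitz bound applies. The constant 2M + K covers both cases.
    by_cases h : ∃ i, 1 ≤ E i
    · obtain ⟨i, hi⟩ := h
      have h1 : 1 ≤ ∑ i, D m i ω := (le_min le_rfl hi).trans
        (Finset.single_le_sum (f := fun i => D m i ω) (fun i _ => hD0 m i ω) (Finset.mem_univ i))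
      calc _ ≤ M + M := (abs_sub _ _).trans (add_le_add (hM _) (hM _))
        _ ≤ (2 * M + K) * 1 := by linarith [K.2]
        _ ≤ _ := mul_le_mul_of_nonneg_left h1 (by positivity)
    · push Not at h
      have hDE : ∀ i, D m i ω = E i := fun i => min_eq_right (h i).le
      have hd : dist (X m ω) (Y m ω) ≤ ∑ i, D m i ω := by
        refine (dist_pi_le_iff (Finset.sum_nonneg fun i _ => hD0 m i ω)).2 fun i => ?_
        refine le_trans ?_ (Finset.single_le_sum (f := fun i => D m i ω)
          (fun i _ => hD0 m i ω) (Finset.mem_univ i))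
        simp only [X, Y, limStep]
        rw [traj_succ, hω i, hDE]
        refine (dist_snoc_le _ _ _).trans ?_
        have e : traj (Z (m + 1) (J m i)) t ω (Fin.last t) = Z (m + 1) (J m i) t ω := by simp [traj]
        rw [e, dist_add_right, dist_add_left, dist_smul₀, Real.norm_eq_abs, abs_of_pos hγ.1,
          dist_eq_norm]
        exact mul_le_of_le_one_left (norm_nonneg _) hγ.2.le
      calc _ ≤ K * dist (X m ω) (Y m ω) := by
            rw [← Real.dist_eq]
            exact hf.dist_le_mul _ _
        _ ≤ K * ∑ i, D m i ω := by gcongr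
        _ ≤ _ := mul_le_mul_of_nonneg_right (by linarith)
            (Finset.sum_nonneg fun i _ => hD0 m i ω)
  have hdiff : Tendsto (fun m => ∫ ω, f (X m ω) * w m ω ∂P - ∫ ω, f (Y m ω) * w m ω ∂P) atTop
      (𝓝 0) := by
    have hb : Tendsto (fun m => (2 * M + K) * ∑ i, ∫ ω, D m i ω ∂P) atTop (𝓝 0) := by
      have := (tendsto_finsetSum (Finset.univ : Finset (Fin k)) fun i _ => hnm i).const_mul
        (2 * M + (K : ℝ))
      simpa using this
    refine squeeze_zero_norm (fun m => ?_) hb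
    rw [← integral_sub (hIX m) (hIY m), ← integral_finsetSum _ fun i _ => hDi m i,
      ← integral_const_mul]
    exact norm_integral_le_of_norm_le ((integrable_finsetSum _ fun i _ => hDi m i).const_mul _)
      (hpt m)
  have hYlim : Tendsto (fun m => ∫ ω, f (Y m ω) * w m ω ∂P) atTop
      (𝓝 (∫ z, stepMean γ B₀ B ν t μ f z * ∏ e, edgeLaw B₀ B t (z (p e)) (z (q e)) (a e)
        ∂(Measure.pi fun _ : Fin k => μ))) := by
    refine h1.congr' ?_
    filter_upwards [hJ] with m hm
    exact (integral_limStep_mul hB μ (measurable_pi_lambda _ fun i => hT _ _)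
      (measurable_pi_lambda _ fun e => hTA _ _ _)
      (measurable_pi_lambda _ fun i => hsys.measurable_noise _ _)
      (indepFun_noise hsys m t (J m) p q) (map_noise hsys hνξ m t hm) hf.continuous.measurable hM
      a).symm
  simpa using hdiff.add hYlim

/-- The edges at time t + 1 become Bernoulli factors `g` that are absorbed into the test function,
and the edge paths up to time t are kept as weights. The weighted portmanteau theorem extends the
Lipschitz case to the resulting almost everywhere continuous function. -/
theorem chaos_succ (hγ : γ ∈ Set.Ioo (0 : ℝ) 1) (hB : IsInteraction B₀ B)
    (hsys : IsParticleSystem P γ B₀ B ξ Z A) (hνξ : P.map (ξ 0 0) = ν) (hμ₀ : μ₀ ≪ volume)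
    (hν : ν ≪ volume) (hint : ExpDecay B₀ B ∨ FiniteRange B₀ B)
    (hmom : MomentBound P Z t) (hch : Chaos P γ B₀ B μ₀ ν Z A t) :
    Chaos P γ B₀ B μ₀ ν Z A (t + 1) := by
  intro k r p q hpq J hJ a G M hG hM hGc
  have := isProbabilityMeasure_limLaw (γ := γ) (μ₀ := μ₀) (ν := ν) hB t
  have := isProbabilityMeasure_limLaw (γ := γ) (μ₀ := μ₀) (ν := ν) hB (t + 1)
  have hZ := hsys.measurable_opinion
  have hA : ∀ n i j t, Measurable (A n i j t) := fun n => (hsys.network n).measurable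
  let g : Fin r → Traj (Opinion d) (t + 1) → Traj (Opinion d) (t + 1) → ℝ := fun e z z' =>
    ber (B (a e (Fin.last t).castSucc) (z (Fin.last (t + 1))) (z' (Fin.last (t + 1))))
      (a e (Fin.last (t + 1)))
  have hgm : ∀ e, Measurable fun x : Traj (Opinion d) (t + 1) × Traj (Opinion d) (t + 1) =>
      g e x.1 x.2 := fun e => (continuous_ber _).measurable.comp
    ((hB.measurable (a e (Fin.last t).castSucc)).comp (f := fun x : Traj (Opinion d) (t + 1) ×
      Traj (Opinion d) (t + 1) => (x.1 (Fin.last (t + 1)), x.2 (Fin.last (t + 1)))) (by fun_prop))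
  have hgb : ∀ e z z', g e z z' ∈ Set.Icc (0 : ℝ) 1 := fun e z z' => ber_mem (hB.mem _ _ _) _
  have hgc : ∀ e, ∀ᵐ x ∂(limLaw γ B₀ B μ₀ ν (t + 1)).prod (limLaw γ B₀ B μ₀ ν (t + 1)),
      ContinuousAt (fun x : Traj (Opinion d) (t + 1) × Traj (Opinion d) (t + 1) =>
        g e x.1 x.2) x := by
    intro e
    filter_upwards [ae_continuousAt_B hB hμ₀ hν (t + 1) (a e (Fin.last t).castSucc)] with x hx
    exact (continuous_ber _).continuousAt.comp (ContinuousAt.comp (f := fun x :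
      Traj (Opinion d) (t + 1) × Traj (Opinion d) (t + 1) =>
        (x.1 (Fin.last (t + 1)), x.2 (Fin.last (t + 1)))) (x := x) hx (by fun_prop))
  have hprod : Measurable fun z : Fin k → Traj (Opinion d) (t + 1) =>
      ∏ e, g e (z (p e)) (z (q e)) :=
    Finset.measurable_prod _ fun e _ => (hgm e).comp
      (f := fun z : Fin k → Traj (Opinion d) (t + 1) => (z (p e), z (q e))) (by fun_prop)
  have hv : Measurable fun z : Fin k → Traj (Opinion d) (t + 1) =>
      ∏ e, edgeLaw B₀ B t (fun s => z (p e) s.castSucc) (fun s => z (q e) s.castSucc)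
        (fun s => a e s.castSucc) :=
    Finset.measurable_prod _ fun e _ => (measurable_edgeLaw hB t _).comp
      (f := fun z : Fin k → Traj (Opinion d) (t + 1) => ((fun s : Fin (t + 1) =>
        z (p e) s.castSucc), (fun s : Fin (t + 1) => z (q e) s.castSucc))) (by fun_prop)
  have h := tendsto_integral_mul_of_lipschitz (P := P)
    (m := Measure.pi fun _ : Fin k => limLaw γ B₀ B μ₀ ν (t + 1))
    (x := fun m ω i => traj (Z (m + 1) (J m i)) (t + 1) ω)
    (fun m => measurable_pi_lambda _ fun i => measurable_traj (hZ _ _) (t + 1))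
    (w := fun m ω => ∏ e, same (traj (A (m + 1) (J m (p e)) (J m (q e))) t ω)
      (fun s => a e s.castSucc))
    (fun m => Finset.measurable_prod _ fun e _ => measurable_same (measurable_traj (hA _ _ _) t) _)
    (fun m ω => prod_mem_Icc fun e => same_mem _ _) hv
    (fun z => prod_mem_Icc fun e => edgeLaw_mem hB _ _ _ _)
    (fun f M' hM' K hf => tendsto_integral_lipschitz_succ hγ hB hsys hνξ hμ₀ hν hint hmom hch hpq
      hJ _ hM' hf)
    (hG.mul hprod) (fun z => abs_mul_le_of_mem_Icc (hM z) (prod_mem_Icc fun e => hgb e _ _))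
    (ae_continuousAt_mul_prod hpq.ne hGc hgc)
  have hlim : ∫ z, G z * ∏ e, edgeLaw B₀ B (t + 1) (z (p e)) (z (q e)) (a e)
      ∂(Measure.pi fun _ : Fin k => limLaw γ B₀ B μ₀ ν (t + 1)) =
      ∫ z, G z * (∏ e, g e (z (p e)) (z (q e))) * ∏ e, edgeLaw B₀ B t
        (fun s => z (p e) s.castSucc) (fun s => z (q e) s.castSucc) (fun s => a e s.castSucc)
      ∂(Measure.pi fun _ : Fin k => limLaw γ B₀ B μ₀ ν (t + 1)) := by
    refine integral_congr_ae (ae_of_all _ fun z => ?_)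
    simp only [edgeLaw, Finset.prod_mul_distrib, g]
    ring
  rw [hlim]
  refine h.congr' ?_
  filter_upwards [hJ] with m hm
  refine (Eq.trans ?_ (integral_mul_edgePath_succ (hsys.network (m + 1)) (hZ _) hpq hm t a hG
    hM).symm)
  simp [g, traj]

theorem chaos (hγ : γ ∈ Set.Ioo (0 : ℝ) 1) (hB : IsInteraction B₀ B)
    (hsys : IsParticleSystem P γ B₀ B ξ Z A) (hinit : IsInitial P (fun n i => Z n i 0) μ₀)
    (hbds : HasBounds P B₀ B ξ (fun n i => Z n i 0)) (hνξ : P.map (ξ 0 0) = ν) (t : ℕ) :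
    Chaos P γ B₀ B μ₀ ν Z A t := by
  have hν : ν ≪ volume := hνξ ▸ hsys.noise_ac
  induction t with
  | zero => exact chaos_zero hB hsys hinit hν
  | succ t ih =>
    exact chaos_succ hγ hB hsys hνξ hinit.ac hν hbds.interaction
      (momentBound hγ hB hsys hinit hbds t) ih

end Chaos

/-! ### The law of the limiting process -/

section LimitProcess

variable {Ω : Type*} [MeasurableSpace Ω] {P : Measure Ω} [IsProbabilityMeasure P] {d : ℕ} {γ : ℝ}
  {B₀ : Opinion d → Opinion d → ℝ} {B : Bool → Opinion d → Opinion d → ℝ} {n : ℕ}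
  {ξ Z : Fin n → ℕ → Ω → Opinion d}
  {A : Fin n → Fin n → ℕ → Ω → Bool} {μ₀ ν : Measure (Opinion d)}
  [IsProbabilityMeasure μ₀] [IsProbabilityMeasure ν] {t : ℕ}

/-- At time `t` the law of the trajectories and the edge paths of finitely many agents is the one
given by `limLaw` and `edgeLaw`. -/
def HasLimitLaw (P : Measure Ω) (γ : ℝ) (B₀ : Opinion d → Opinion d → ℝ)
    (B : Bool → Opinion d → Opinion d → ℝ) (μ₀ ν : Measure (Opinion d))
    (Z : Fin n → ℕ → Ω → Opinion d) (A : Fin n → Fin n → ℕ → Ω → Bool) (t : ℕ) : Prop :=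
  ∀ (k r : ℕ) (p q : Fin r → Fin k), IsSimpleFamily p q →
    ∀ J : Fin k → Fin n, Function.Injective J →
    ∀ (a : Fin r → Traj Bool t) (G : (Fin k → Traj (Opinion d) t) → ℝ) (M : ℝ),
    Measurable G → (∀ z, |G z| ≤ M) →
    ∫ ω, G (fun i => traj (Z (J i)) t ω) *
      ∏ e, same (traj (A (J (p e)) (J (q e))) t ω) (a e) ∂P =
      ∫ z, G z * ∏ e, edgeLaw B₀ B t (z (p e)) (z (q e)) (a e)
        ∂(Measure.pi fun _ : Fin k => limLaw γ B₀ B μ₀ ν t)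

/-- One agent and no edges. It identifies the law that appears inside the McKean–Vlasov drift. -/
theorem HasLimitLaw.map_traj (hB : IsInteraction B₀ B) (hZ : ∀ i t, Measurable (Z i t))
    (h : HasLimitLaw P γ B₀ B μ₀ ν Z A t) (i : Fin n) :
    P.map (traj (Z i) t) = limLaw γ B₀ B μ₀ ν t := by
  have := isProbabilityMeasure_limLaw (γ := γ) (μ₀ := μ₀) (ν := ν) hB t
  have hT := measurable_traj (hZ i) t
  have := Measure.isProbabilityMeasure_map (μ := P) hT.aemeasurable
  refine Measure.ext fun s hs => (measureReal_eq_measureReal_iff).1 ?_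
  have hmp := measurePreserving_eval (fun _ : Fin 1 => limLaw γ B₀ B μ₀ ν t) 0
  have hg : Measurable (s.indicator fun _ : Traj (Opinion d) t => (1 : ℝ)) :=
    measurable_const.indicator hs
  have h1 := h 1 0 Fin.elim0 Fin.elim0 ⟨fun e => e.elim0, fun e => e.elim0, fun e => e.elim0⟩
    (fun _ => i) (Function.injective_of_subsingleton _) Fin.elim0
    (fun z => s.indicator (fun _ => (1 : ℝ)) (z 0)) 1 (hg.comp (measurable_pi_apply 0))
    (fun z => by
      by_cases hz : z 0 ∈ s <;> simp [hz])
  simp only [Finset.univ_eq_empty, Finset.prod_empty, mul_one] at h1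
  have h2 := integral_map (μ := P) hT.aemeasurable hg.aestronglyMeasurable
  have h3 := integral_map (measurable_pi_apply 0).aemeasurable
    (μ := Measure.pi fun _ : Fin 1 => limLaw γ B₀ B μ₀ ν t) hg.aestronglyMeasurable
  have h4 : (Measure.pi fun _ : Fin 1 => limLaw γ B₀ B μ₀ ν t).map (fun z => z 0) =
    limLaw γ B₀ B μ₀ ν t := hmp.map_eq
  rw [h4] at h3
  rw [← h3, ← h2, integral_indicator_const _ hs, integral_indicator_const _ hs] at h1
  simpa using h1

theorem hasLimitLaw_zero (hB : IsInteraction B₀ B)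
    (hlim : IsLimitProcess P γ B₀ B μ₀ ν ξ Z A) : HasLimitLaw P γ B₀ B μ₀ ν Z A 0 := by
  intro k r p q hpq J hJ a G M hG hM
  have hZ := hlim.measurable_opinion
  rw [integral_mul_edgePath_zero hlim.network hZ hpq hJ a hG hM]
  have hv : Measurable fun z : Fin k → Traj (Opinion d) 0 =>
      ∏ e, edgeLaw B₀ B 0 (z (p e)) (z (q e)) (a e) :=
    Finset.measurable_prod _ fun e _ => (measurable_edgeLaw hB 0 (a e)).comp
      (f := fun z : Fin k → Traj (Opinion d) 0 => (z (p e), z (q e))) (by fun_prop)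
  let G' : (Fin k → Traj (Opinion d) 0) → ℝ := fun z =>
    G z * ∏ e, edgeLaw B₀ B 0 (z (p e)) (z (q e)) (a e)
  have hG' : Measurable G' := hG.mul hv
  have hc : Measurable fun (x : Fin k → Opinion d) (i : Fin k) (_ : Fin (0 + 1)) => x i := by
    fun_prop
  have hx : Measurable fun ω (i : Fin k) => Z (J i) 0 ω := measurable_pi_lambda _ fun i => hZ _ _
  have hmap : P.map (fun ω i => Z (J i) 0 ω) = Measure.pi fun _ : Fin k => μ₀ := by
    rw [(iIndepFun_iff_map_fun_eq_pi_map fun i => (hZ _ _).aemeasurable).1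
      (hlim.init_indep.precomp hJ)]
    congr 1
    funext i
    exact hlim.init_law (J i)
  have hmap' : P.map (fun ω i => traj (Z (J i)) 0 ω) =
      Measure.pi fun _ : Fin k => limLaw γ B₀ B μ₀ ν 0 := by
    rw [pi_limLaw_zero, ← hmap, Measure.map_map hc hx]
    congr 1
    funext ω i s
    rw [Fin.fin_one_eq_zero s]
    rfl
  rw [← hmap', integral_map (measurable_pi_lambda _ fun i =>
    measurable_traj (hZ _) 0).aemeasurable hG'.aestronglyMeasurable]

/-- The induction step of chaos with equalities: the drift already is `limitMean`, so neither a law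
of large numbers nor continuity is required, and all bounded measurable test functions are allowed.
-/
theorem hasLimitLaw_succ (hB : IsInteraction B₀ B)
    (hlim : IsLimitProcess P γ B₀ B μ₀ ν ξ Z A) (h : HasLimitLaw P γ B₀ B μ₀ ν Z A t) :
    HasLimitLaw P γ B₀ B μ₀ ν Z A (t + 1) := by
  intro k r p q hpq J hJ a G M hG hM
  have := isProbabilityMeasure_limLaw (γ := γ) (μ₀ := μ₀) (ν := ν) hB t
  have hZ := hlim.measurable_opinion
  have hT : ∀ i, Measurable (traj (Z i) t) := fun i => measurable_traj (hZ i) t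
  have hTA : ∀ i j, Measurable (traj (A i j) t) := fun i j =>
    measurable_traj (hlim.network.measurable i j) t
  let g : Fin r → Traj (Opinion d) (t + 1) → Traj (Opinion d) (t + 1) → ℝ := fun e z z' =>
    ber (B (a e (Fin.last t).castSucc) (z (Fin.last (t + 1))) (z' (Fin.last (t + 1))))
      (a e (Fin.last (t + 1)))
  have hgm : ∀ e, Measurable fun x : Traj (Opinion d) (t + 1) × Traj (Opinion d) (t + 1) =>
      g e x.1 x.2 := fun e => (continuous_ber _).measurable.comp
    ((hB.measurable (a e (Fin.last t).castSucc)).comp (f := fun x : Traj (Opinion d) (t + 1) ×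
      Traj (Opinion d) (t + 1) => (x.1 (Fin.last (t + 1)), x.2 (Fin.last (t + 1)))) (by fun_prop))
  let G' : (Fin k → Traj (Opinion d) (t + 1)) → ℝ := fun z => G z * ∏ e, g e (z (p e)) (z (q e))
  have hG' : Measurable G' := hG.mul (Finset.measurable_prod _ fun e _ => (hgm e).comp
      (f := fun z : Fin k → Traj (Opinion d) (t + 1) => (z (p e), z (q e))) (by fun_prop))
  have hGb' : ∀ z, |G' z| ≤ M := fun z => abs_mul_le_of_mem_Icc (hM z)
    (prod_mem_Icc fun e => ber_mem (hB.mem _ _ _) _)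
  have hind : IndepFun (fun ω => ((fun i => traj (Z (J i)) t ω),
      (fun e => traj (A (J (p e)) (J (q e))) t ω))) (fun ω i => ξ (J i) t ω) P := by
    rw [IndepFun_iff_Indep]
    refine indep_of_indep_of_le_left
      (indep_of_indep_of_le_right (hlim.noise_indep_past t).symm ?_) ?_
    · refine Measurable.comap_le ?_
      let _ : MeasurableSpace Ω := ⨆ i, MeasurableSpace.comap (ξ i t) inferInstance
      exact measurable_pi_lambda _ fun i => (comap_measurable (ξ (J i) t)).mono
        (le_iSup (fun i => MeasurableSpace.comap (ξ i t) inferInstance) (J i)) le_rfl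
    · refine Measurable.comap_le ?_
      let _ : MeasurableSpace Ω := fullHistory Z A t
      exact (measurable_pi_lambda _ fun i => measurable_full_traj _ _ t _).prodMk
        (measurable_pi_lambda _ fun e => measurable_full_edgeTraj _ _ t _ _)
  have hmap : P.map (fun ω i => ξ (J i) t ω) = Measure.pi fun _ : Fin k => ν := by
    have h := hlim.noise_indep.precomp (g := fun i : Fin k => (J i, t)) fun i j hij =>
      hJ (Prod.mk.inj hij).1
    rw [(iIndepFun_iff_map_fun_eq_pi_map fun i => (hlim.measurable_noise _ _).aemeasurable).1 h]
    congr 1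
    funext i
    exact hlim.noise_law (J i) t
  calc _ = ∫ ω, G' (fun i => traj (Z (J i)) (t + 1) ω) *
        ∏ e, same (traj (A (J (p e)) (J (q e))) t ω) (fun s => a e s.castSucc) ∂P := by
        rw [integral_mul_edgePath_succ hlim.network hZ hpq hJ t a hG hM]
        simp [G', g, traj]
    _ = ∫ ω, G' (fun i => limStep γ B₀ B t (limLaw γ B₀ B μ₀ ν t)
          (traj (Z (J i)) t ω, ξ (J i) t ω)) *
        ∏ e, same (traj (A (J (p e)) (J (q e))) t ω) (fun s => a e s.castSucc) ∂P := by
        refine integral_congr_ae ?_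
        filter_upwards [ae_all_iff.2 fun i : Fin k => hlim.opinion_step (J i) t] with ω hω
        refine congrArg (fun z => G' z * _) (funext fun i => ?_)
        -- The law in the drift is the candidate law by the induction hypothesis, which resolves the
        -- self-reference of the equation.
        rw [traj_succ, hω i, h.map_traj hB hZ]
        simp [limStep, traj]
    _ = ∫ z, G' z * ∏ e, edgeLaw B₀ B t (fun s => z (p e) s.castSucc)
          (fun s => z (q e) s.castSucc) (fun s => a e s.castSucc)
        ∂(Measure.pi fun _ : Fin k => limLaw γ B₀ B μ₀ ν (t + 1)) := by
        rw [integral_limStep_mul hB (limLaw γ B₀ B μ₀ ν t) (measurable_pi_lambda _ fun i => hT _)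
          (measurable_pi_lambda _ fun e => hTA _ _)
          (measurable_pi_lambda _ fun i => hlim.measurable_noise _ _) hind hmap hG' hGb',
          integral_pi_limLaw_succ hB hG' hGb',
          h k r p q hpq J hJ _ _ M (measurable_stepMean hB _ hG') (abs_stepMean_le _ hGb')]
    _ = _ := by
        refine integral_congr_ae (ae_of_all _ fun z => ?_)
        simp only [edgeLaw, Finset.prod_mul_distrib, g, G']
        ring

theorem hasLimitLaw (hB : IsInteraction B₀ B)
    (hlim : IsLimitProcess P γ B₀ B μ₀ ν ξ Z A) (t : ℕ) : HasLimitLaw P γ B₀ B μ₀ ν Z A t := by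
  induction t with
  | zero => exact hasLimitLaw_zero hB hlim
  | succ t ih => exact hasLimitLaw_succ hB hlim ih

/-- Two agents and one edge; summing over the edge path and Fubini express the expectation through
the conditional mean given the first agent. -/
theorem HasLimitLaw.integral_pair (hB : IsInteraction B₀ B) (hZ : ∀ i t, Measurable (Z i t))
    (hA : ∀ i j t, Measurable (A i j t))
    (h : HasLimitLaw P γ B₀ B μ₀ ν Z A t) {i j : Fin n} (hij : i ≠ j)
    {f : Traj Bool t → Traj (Opinion d) t → Traj (Opinion d) t → ℝ}
    (hf : ∀ a, Measurable fun p : Traj (Opinion d) t × Traj (Opinion d) t => f a p.1 p.2)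
    {M : ℝ} (hM : ∀ a x y, |f a x y| ≤ M) :
    ∫ ω, f (traj (A i j) t ω) (traj (Z i) t ω) (traj (Z j) t ω) ∂P =
      ∫ z, pairMean B₀ B t (limLaw γ B₀ B μ₀ ν t) f z ∂limLaw γ B₀ B μ₀ ν t := by
  have := isProbabilityMeasure_limLaw (γ := γ) (μ₀ := μ₀) (ν := ν) hB t
  have hT : ∀ i, Measurable (traj (Z i) t) := fun i => measurable_traj (hZ i) t
  have hTA : ∀ i j, Measurable (traj (A i j) t) := fun i j => measurable_traj (hA i j) t
  have hfi : ∀ a, Integrable (fun p : Traj (Opinion d) t × Traj (Opinion d) t =>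
      f a p.1 p.2 * edgeLaw B₀ B t p.1 p.2 a)
      ((limLaw γ B₀ B μ₀ ν t).prod (limLaw γ B₀ B μ₀ ν t)) := fun a =>
    integrable_bounded ((hf a).mul (measurable_edgeLaw hB t a)) fun p =>
      abs_mul_le_of_mem_Icc (hM _ _ _) (edgeLaw_mem hB _ _ _ _)
  have hJ : Function.Injective (![i, j] : Fin 2 → Fin n) := by
    intro x y hxy
    fin_cases x <;> fin_cases y <;> simp_all [hij.symm]
  have hmp := measurePreserving_eval_pair (κ := Fin 2) (limLaw γ B₀ B μ₀ ν t)
    (by decide : (0 : Fin 2) ≠ 1)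
  have h1 : ∀ a, ∫ ω, f a (traj (Z i) t ω) (traj (Z j) t ω) * same (traj (A i j) t ω) a ∂P =
      ∫ p, f a p.1 p.2 * edgeLaw B₀ B t p.1 p.2 a
        ∂((limLaw γ B₀ B μ₀ ν t).prod (limLaw γ B₀ B μ₀ ν t)) := by
    intro a
    have := h 2 1 ![0] ![1] ⟨by decide, by decide, by decide⟩ ![i, j] hJ (fun _ => a)
      (fun z => f a (z 0) (z 1)) M ((hf a).comp (f := fun z : Fin 2 → Traj (Opinion d) t =>
        (z 0, z 1)) (by fun_prop)) (fun z => hM _ _ _)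
    rw [← hmp.map_eq, integral_map hmp.measurable.aemeasurable
      (by rw [hmp.map_eq]; exact (hfi a).aestronglyMeasurable)]
    simpa using this
  calc _ = ∫ ω, ∑ a, f a (traj (Z i) t ω) (traj (Z j) t ω) * same (traj (A i j) t ω) a ∂P := by
        refine integral_congr_ae (ae_of_all _ fun ω => ?_)
        simp [same]
    _ = ∑ a, ∫ p, f a p.1 p.2 * edgeLaw B₀ B t p.1 p.2 a
        ∂((limLaw γ B₀ B μ₀ ν t).prod (limLaw γ B₀ B μ₀ ν t)) := by
        rw [integral_finsetSum]
        · exact Finset.sum_congr rfl fun a _ => h1 a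
        · exact fun a _ => integrable_bounded (M := M)
            (((hf a).comp ((hT i).prodMk (hT j))).mul (measurable_same (hTA i j) a)) fun ω =>
            abs_mul_le_of_mem_Icc (hM _ _ _) (same_mem _ _)
    _ = _ := by
        rw [← integral_finsetSum _ fun a _ => hfi a,
          integral_prod _ (integrable_finsetSum _ fun a _ => hfi a)]
        simp only [pairMean, smul_eq_mul, mul_comm]

end LimitProcess

/-! ### Empirical measures and convergence in probability -/

section InProbability

variable {Ω S : Type*} [MeasurableSpace Ω] {P : Measure Ω}

/-- The sets that `X m` hits with probability tending to one. -/
def inProb (P : Measure Ω) (X : ℕ → Ω → S) : Filter S where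
  sets := {U | Tendsto (fun m => P {ω | X m ω ∉ U}) atTop (𝓝 0)}
  univ_sets := by simp
  sets_of_superset {U V} hU hUV := tendsto_of_tendsto_of_tendsto_of_le_of_le tendsto_const_nhds hU
    (fun _ => zero_le) fun m => measure_mono fun ω hω h => hω (hUV h)
  inter_sets {U V} hU hV := by
    have h := Tendsto.add (show Tendsto (fun m => P {ω | X m ω ∉ U}) atTop (𝓝 0) from hU)
      (show Tendsto (fun m => P {ω | X m ω ∉ V}) atTop (𝓝 0) from hV)
    rw [add_zero] at h
    refine tendsto_of_tendsto_of_tendsto_of_le_of_le tendsto_const_nhds h (fun _ => zero_le)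
      fun m => (measure_mono fun ω hω => ?_).trans (measure_union_le _ _)
    by_contra hn
    simp only [Set.mem_union, Set.mem_ofPred_eq, not_or, not_not] at hn
    exact hω ⟨hn.1, hn.2⟩

theorem mem_inProb {X : ℕ → Ω → S} {U : Set S} :
    U ∈ inProb P X ↔ Tendsto (fun m => P {ω | X m ω ∉ U}) atTop (𝓝 0) := Iff.rfl

/-- As the sets hit with probability tending to one form a filter, convergence in probability in the
weak topology can be tested on one bounded continuous function at a time. -/
theorem tendstoInProbConst_iff [TopologicalSpace S] {X : ℕ → Ω → S} {c : S} :
    TendstoInProbConst P X c ↔ inProb P X ≤ 𝓝 c := Iff.rfl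

theorem tendsto_inProb_zero [IsProbabilityMeasure P] {X : ℕ → Ω → S} {g : S → ℝ}
    (hi : ∀ m, Integrable (fun ω => g (X m ω)) P)
    (h : Tendsto (fun m => ∫ ω, |g (X m ω)| ∂P) atTop (𝓝 0)) :
    Tendsto g (inProb P X) (𝓝 0) := by
  refine Metric.tendsto_nhds.2 fun ε hε => ?_
  change _ ∈ inProb P X
  rw [mem_inProb]
  have h' : Tendsto (fun m => ENNReal.ofReal (ε⁻¹ * ∫ ω, |g (X m ω)| ∂P)) atTop (𝓝 0) := by
    simpa using ENNReal.tendsto_ofReal (h.const_mul ε⁻¹)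
  refine tendsto_of_tendsto_of_tendsto_of_le_of_le tendsto_const_nhds h' (fun _ => zero_le)
    fun m => ?_
  have hM := mul_meas_ge_le_integral_of_nonneg (ae_of_all P fun ω => abs_nonneg (g (X m ω)))
    (hi m).abs ε
  have e : {ω | X m ω ∉ {x | dist (g x) 0 < ε}} = {ω | ε ≤ |g (X m ω)|} := by
    ext ω
    simp
  rw [e, ← ENNReal.ofReal_toReal (measure_ne_top P _)]
  refine ENNReal.ofReal_le_ofReal ?_
  rw [le_inv_mul_iff₀ hε]
  exact hM

/-- Bounded convergence in probability: split at the level ε/2 and use the bound M on the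
exceptional event. -/
theorem tendsto_integral_dist_of_inProb [IsProbabilityMeasure P] {T : Type*}
    {X Y : ℕ → Ω → T} {F : T → ℝ} {M : ℝ} (hM : ∀ x y, |F x - F y| ≤ M)
    (hi : ∀ m, Measurable fun ω => F (X m ω) - F (Y m ω))
    (h : Tendsto (fun p : T × T => F p.1 - F p.2) (inProb P fun m ω => (X m ω, Y m ω)) (𝓝 0)) :
    Tendsto (fun m => ∫ ω, |F (X m ω) - F (Y m ω)| ∂P) atTop (𝓝 0) := by
  have hint : ∀ m, Integrable (fun ω => |F (X m ω) - F (Y m ω)|) P := fun m =>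
    integrable_bounded (M := M) (hi m).abs fun ω => by
      rw [abs_abs]
      exact hM _ _
  refine tendsto_zero_of_forall_eventually_le (fun m => integral_nonneg fun ω => abs_nonneg _)
    fun ε hε => ?_
  have hM0 : 0 ≤ M := by
    obtain ⟨ω⟩ := nonempty_of_isProbabilityMeasure P
    exact (abs_nonneg _).trans (hM (X 0 ω) (Y 0 ω))
  have h1 : Tendsto (fun m => P {ω | ε / 2 ≤ |F (X m ω) - F (Y m ω)|}) atTop (𝓝 0) := by
    have h2 := Metric.tendsto_nhds.1 h (ε / 2) (by positivity)
    refine (mem_inProb.1 h2).congr fun m => ?_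
    congr 1
    ext ω
    simp
  have h2 : Tendsto (fun m => M * P.real {ω | ε / 2 ≤ |F (X m ω) - F (Y m ω)|}) atTop (𝓝 0) := by
    have := ((ENNReal.tendsto_toReal ENNReal.zero_ne_top).comp h1).const_mul M
    simpa [Function.comp_def, measureReal_def] using this
  filter_upwards [h2.eventually_lt_const (by positivity : 0 < ε / 2)] with m hm
  have hs : MeasurableSet {ω | ε / 2 ≤ |F (X m ω) - F (Y m ω)|} :=
    measurableSet_le measurable_const (hi m).abs
  calc ∫ ω, |F (X m ω) - F (Y m ω)| ∂P
      ≤ ∫ ω, (ε / 2 + {ω | ε / 2 ≤ |F (X m ω) - F (Y m ω)|}.indicator (fun _ => M) ω) ∂P := by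
        refine integral_mono (hint m) ((integrable_const _).add ((integrable_const M).indicator hs))
          fun ω => ?_
        by_cases hω : ε / 2 ≤ |F (X m ω) - F (Y m ω)|
        · rw [Set.indicator_of_mem (by exact hω)]
          linarith [hM (X m ω) (Y m ω)]
        · rw [Set.indicator_of_notMem (by exact hω)]
          linarith
    _ = ε / 2 + M * P.real {ω | ε / 2 ≤ |F (X m ω) - F (Y m ω)|} := by
        rw [integral_add (integrable_const _) ((integrable_const M).indicator hs),
          integral_indicator_const _ hs]
        simp [mul_comm]
    _ ≤ ε := by linarith

end InProbability

theorem integral_empirical {S : Type*} [MeasurableSpace S] {n : ℕ} [NeZero n] (x : Fin n → S)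
    {f : S → ℝ} (hf : Measurable f) :
    ∫ y, f y ∂(empirical x : Measure S) = (n : ℝ)⁻¹ * ∑ j, f (x j) := by
  change ∫ y, f y ∂((n : ℝ≥0∞)⁻¹ • ∑ j, Measure.dirac (x j)) = _
  rw [integral_smul_measure, integral_finsetSum_measure fun j _ =>
    integrable_dirac' hf.stronglyMeasurable (by simp)]
  simp [integral_dirac' _ _ hf.stronglyMeasurable]

section EmpiricalLimit

variable {Ω : Type*} [MeasurableSpace Ω] {P : Measure Ω} [IsProbabilityMeasure P] {d : ℕ} {γ : ℝ}
  {B₀ : Opinion d → Opinion d → ℝ} {B : Bool → Opinion d → Opinion d → ℝ}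
  {Z : (n : ℕ) → Fin n → ℕ → Ω → Opinion d}
  {A : (n : ℕ) → Fin n → Fin n → ℕ → Ω → Bool} {μ₀ ν : Measure (Opinion d)}
  [IsProbabilityMeasure μ₀] [IsProbabilityMeasure ν] {t : ℕ}

/-- The law of large numbers for functions of the second trajectory alone, for which `pairMean` is
the constant integral; agent 0 serves as an arbitrary reference agent. -/
theorem Chaos.tendsto_empirical (hB : IsInteraction B₀ B) (hμ₀ : μ₀ ≪ volume) (hν : ν ≪ volume)
    (hch : Chaos P γ B₀ B μ₀ ν Z A t)
    (hZ : ∀ n i t, Measurable (Z n i t)) (hA : ∀ n i j t, Measurable (A n i j t))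
    (c : ProbabilityMeasure (Traj (Opinion d) t)) (hc : (c : Measure _) = limLaw γ B₀ B μ₀ ν t) :
    TendstoInProbConst P
      (fun m ω => empirical fun j : Fin (m + 1) => traj (Z (m + 1) j) t ω) c := by
  have := isProbabilityMeasure_limLaw (γ := γ) (μ₀ := μ₀) (ν := ν) hB t
  rw [tendstoInProbConst_iff]
  refine tendsto_id'.1 ?_
  refine ProbabilityMeasure.tendsto_iff_forall_integral_tendsto.2 fun f => ?_
  have hmean : ∀ x, pairMean B₀ B t (limLaw γ B₀ B μ₀ ν t) (fun _ _ y => f y) x =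
      ∫ y, f y ∂(c : Measure _) := fun x => by
    simp [pairMean, ← Finset.sum_mul, sum_edgeLaw, hc]
  obtain ⟨h1, h2⟩ := hch.tendsto_lln_norm hB hμ₀ hν hZ hA (f := fun _ _ y => f y)
    (fun a => f.continuous.measurable.comp measurable_snd) (fun a x y => f.norm_coe_le_norm y)
    (fun a => ae_of_all _ fun p => (f.continuous.comp continuous_snd).continuousAt) fun m => 0
  have e : ∀ m ω, ∫ y, f y ∂((empirical fun j : Fin (m + 1) => traj (Z (m + 1) j) t ω :
      ProbabilityMeasure _) : Measure (Traj (Opinion d) t)) - ∫ y, f y ∂(c : Measure _) =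
      ((m : ℝ) + 1)⁻¹ • ∑ j, f (traj (Z (m + 1) j) t ω) - ∫ y, f y ∂(c : Measure _) := by
    intro m ω
    rw [integral_empirical _ f.continuous.measurable]
    simp
  simp only [hmean, ← e] at h1 h2
  refine tendsto_sub_nhds_zero_iff.1 (tendsto_inProb_zero h1 ?_)
  exact h2

end EmpiricalLimit

/-! ### A countable family of functions that determines weak convergence -/

section Determining

variable {S : Type*} [TopologicalSpace S] [SecondCountableTopology S] [HasOuterApproxClosed S]
  [MeasurableSpace S] [OpensMeasurableSpace S]

/-- Take the continuous outer approximations of the complements of finite unions of basic open sets;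
there are countably many. A closed set is a decreasing limit of such complements, so convergence of
these integrals implies the limsup criterion of the portmanteau theorem for closed sets. -/
theorem exists_determining_family : ∃ f : ℕ → BoundedContinuousFunction S ℝ,
    IsInducing fun (μ : ProbabilityMeasure S) q => ∫ x, f q x ∂(μ : Measure S) := by
  let ι := Finset (TopologicalSpace.countableBasis S) × ℕ
  have hclosed : ∀ u : Finset (TopologicalSpace.countableBasis S),
      IsClosed (⋃ b ∈ u, (b : Set S))ᶜ := fun u => (isOpen_biUnion fun b _ =>
    TopologicalSpace.isOpen_of_mem_countableBasis b.2).isClosed_compl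
  let g : ι → BoundedContinuousFunction S ℝ := fun c =>
    BoundedContinuousFunction.comp _ (LipschitzWith.subtype_val {x : ℝ | 0 ≤ x})
      ((hclosed c.1).apprSeq c.2)
  have hg : ∀ (c : ι) (μ : ProbabilityMeasure S), ∫⁻ x, (hclosed c.1).apprSeq c.2 x ∂(μ : Measure S) =
      ENNReal.ofReal (∫ x, g c x ∂(μ : Measure S)) := by
    intro c μ
    rw [ofReal_integral_eq_lintegral_ofReal ((g c).integrable _) (ae_of_all _ fun x =>
      NNReal.coe_nonneg _)]
    exact lintegral_congr fun x => ENNReal.ofReal_coe_nnreal.symm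
  have hι : Nonempty ι := ⟨(∅, 0)⟩
  obtain ⟨e, he⟩ := exists_surjective_nat ι
  refine ⟨fun q => g (e q), isInducing_iff_nhds.2 fun μ => le_antisymm ?_ ?_⟩
  · refine map_le_iff_le_comap.1 (tendsto_pi_nhds.2 fun q => ?_)
    exact ProbabilityMeasure.tendsto_iff_forall_integral_tendsto.1 tendsto_id (g (e q))
  · refine tendsto_id'.1 (tendsto_of_forall_isClosed_limsup_le' fun F hF => ?_)
    refine le_of_forall_gt fun r hr => ?_
    classical
    let V : Finset (TopologicalSpace.countableBasis S) →
        Finset (TopologicalSpace.countableBasis S) := fun u =>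
      Finset.filter (fun b : TopologicalSpace.countableBasis S => (b : Set S) ⊆ Fᶜ) u
    -- Only the basic sets disjoint from `F` are removed, so each `C u` contains `F`, and the `C u`
    -- decrease to `F` along the finite sets u.
    let C : Finset (TopologicalSpace.countableBasis S) → Set S := fun u =>
      (⋃ b ∈ V u, (b : Set S))ᶜ
    have hFC : ∀ u, F ⊆ C u := fun u x hx hxu => by
      simp only [Set.mem_iUnion] at hxu
      obtain ⟨b, hb, hxb⟩ := hxu
      exact (Finset.mem_filter.1 hb).2 hxb hx
    have hC : ⋂ u, C u = F := by
      refine Set.Subset.antisymm (fun x hx => ?_) (Set.subset_iInter hFC)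
      by_contra hxF
      obtain ⟨b, hb, hxb, hbF⟩ := (TopologicalSpace.isBasis_countableBasis S).exists_subset_of_mem_open
        (show x ∈ Fᶜ from hxF) hF.isOpen_compl
      refine Set.mem_iInter.1 hx {⟨b, hb⟩} ?_
      simp only [Set.mem_iUnion]
      exact ⟨⟨b, hb⟩, by simpa [V] using hbF, hxb⟩
    have hanti : Antitone C := fun u v huv => Set.compl_subset_compl.2
      (Set.biUnion_subset_biUnion_left fun b hb => by
        exact Finset.filter_subset_filter _ huv hb)
    have h1 := tendsto_measure_iInter_atTop (μ := (μ : Measure S)) (s := C)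
      (fun u => (hclosed (V u)).measurableSet.nullMeasurableSet) hanti ⟨∅, measure_ne_top _ _⟩
    rw [hC] at h1
    obtain ⟨u, hu⟩ := (h1.eventually_lt_const hr).exists
    let u' := V u
    obtain ⟨n, hn⟩ := ((HasOuterApproxClosed.tendsto_lintegral_apprSeq (hclosed u')
      (μ : Measure S)).eventually_lt_const hu).exists
    obtain ⟨q, hq⟩ := he (u', n)
    have h2 : Tendsto (fun ν : ProbabilityMeasure S => ∫ x, g (u', n) x ∂(ν : Measure S))
        (comap (fun (μ : ProbabilityMeasure S) q => ∫ x, g (e q) x ∂(μ : Measure S))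
          (𝓝 fun q => ∫ x, g (e q) x ∂(μ : Measure S)))
        (𝓝 (∫ x, g (u', n) x ∂(μ : Measure S))) := by
      rw [← hq]
      exact ((continuous_apply q : Continuous fun v : ℕ → ℝ => v q).tendsto _).comp tendsto_comap
    have h3 := ENNReal.tendsto_ofReal h2
    simp only [← hg] at h3
    obtain ⟨r', hr1, hr2⟩ := exists_between hn
    refine lt_of_le_of_lt (limsup_le_of_le (by isBoundedDefault) ?_) hr2
    filter_upwards [h3.eventually_lt_const hr1] with ν hν
    exact (measure_mono (hFC u)).trans
      ((HasOuterApproxClosed.measure_le_lintegral (hclosed u') (ν : Measure S) n).trans hν.le)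

end Determining

/-! ### The limiting conditional law of a pair -/

section PairLaw

variable {d t : ℕ} {B₀ : Opinion d → Opinion d → ℝ} {B : Bool → Opinion d → Opinion d → ℝ}

/-- The law of `(x, Y, A)`, where `Y` has law `μ` and, given `Y`, the edge path `A` between `x` and
`Y` has law `edgeLaw`. -/
noncomputable def pairLaw (B₀ : Opinion d → Opinion d → ℝ) (B : Bool → Opinion d → Opinion d → ℝ)
    (t : ℕ) (μ : Measure (Traj (Opinion d) t)) (x : Traj (Opinion d) t) : Measure (PairTraj d t) :=
  ∑ a, (μ.withDensity fun y => ENNReal.ofReal (edgeLaw B₀ B t x y a)).map fun y => (x, y, a)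

theorem isProbabilityMeasure_pairLaw (hB : IsInteraction B₀ B) (μ : Measure (Traj (Opinion d) t))
    [IsProbabilityMeasure μ] (x : Traj (Opinion d) t) :
    IsProbabilityMeasure (pairLaw B₀ B t μ x) := by
  have hm : ∀ a, Measurable fun y => ENNReal.ofReal (edgeLaw B₀ B t x y a) := fun a =>
    ((measurable_edgeLaw hB t a).comp measurable_prodMk_left).ennreal_ofReal
  constructor
  simp only [pairLaw, Measure.finsetSum_apply]
  have e : ∀ a, ((μ.withDensity fun y => ENNReal.ofReal (edgeLaw B₀ B t x y a)).map
      fun y => ((x, y, a) : PairTraj d t)) Set.univ =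
      ∫⁻ y, ENNReal.ofReal (edgeLaw B₀ B t x y a) ∂μ := fun a => by
    rw [Measure.map_apply (by fun_prop) MeasurableSet.univ, Set.preimage_univ,
      withDensity_apply _ MeasurableSet.univ, Measure.restrict_univ]
  simp only [e]
  rw [← lintegral_finsetSum _ fun a _ => hm a]
  simp only [← ENNReal.ofReal_sum_of_nonneg fun a _ => (edgeLaw_mem hB t x _ a).1, sum_edgeLaw]
  simp

theorem integral_pairLaw (hB : IsInteraction B₀ B) (μ : Measure (Traj (Opinion d) t))
    [IsProbabilityMeasure μ] {f : PairTraj d t → ℝ} (hf : Measurable f) {M : ℝ}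
    (hM : ∀ s, |f s| ≤ M) (x : Traj (Opinion d) t) :
    ∫ s, f s ∂pairLaw B₀ B t μ x = pairMean B₀ B t μ (fun a x y => f (x, y, a)) x := by
  have := isProbabilityMeasure_pairLaw hB μ x
  have hm : ∀ a, Measurable fun y => edgeLaw B₀ B t x y a := fun a =>
    (measurable_edgeLaw hB t a).comp measurable_prodMk_left
  have hfm : ∀ a, Measurable fun y => f (x, y, a) := fun a => hf.comp (by fun_prop)
  have hfi : Integrable f (pairLaw B₀ B t μ x) := integrable_bounded hf hM
  have hfa := hfi
  rw [pairLaw, integrable_finsetSum_measure] at hfa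
  rw [pairLaw, integral_finsetSum_measure fun a ha => hfa a ha]
  rw [pairMean, integral_finsetSum]
  · refine Finset.sum_congr rfl fun a _ => ?_
    rw [integral_map (by fun_prop) hf.aestronglyMeasurable,
      integral_withDensity_eq_integral_toReal_smul (hm a).ennreal_ofReal
        (ae_of_all _ fun y => ENNReal.ofReal_lt_top)]
    refine integral_congr_ae (ae_of_all _ fun y => ?_)
    simp only [ENNReal.toReal_ofReal (edgeLaw_mem hB t x y a).1]
  · intro a _
    refine integrable_bounded (M := M) ((hm a).smul (hfm a)) fun y => ?_
    rw [smul_eq_mul, mul_comm]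
    exact abs_mul_le_of_mem_Icc (hM _) (edgeLaw_mem hB t x y a)

theorem pairLaw_apply (hB : IsInteraction B₀ B) (μ : Measure (Traj (Opinion d) t))
    [IsProbabilityMeasure μ] {s : Set (PairTraj d t)} (hs : MeasurableSet s)
    (x : Traj (Opinion d) t) : pairLaw B₀ B t μ x s =
      ENNReal.ofReal (pairMean B₀ B t μ (fun a x y => s.indicator (fun _ => (1 : ℝ)) (x, y, a)) x) := by
  have := isProbabilityMeasure_pairLaw hB μ x
  rw [← integral_pairLaw hB μ (M := 1) (measurable_const.indicator hs) (fun y => by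
    by_cases hy : y ∈ s <;> simp [hy]), integral_indicator_const _ hs]
  simp

/-- `pairLaw` as a Markov kernel. -/
noncomputable def pairKernel (hB : IsInteraction B₀ B) (μ : Measure (Traj (Opinion d) t))
    [IsProbabilityMeasure μ] : Kernel (Traj (Opinion d) t) (PairTraj d t) where
  toFun := pairLaw B₀ B t μ
  measurable' := Measure.measurable_of_measurable_coe _ fun s hs => by
    simp only [pairLaw_apply hB μ hs]
    exact (measurable_pairMean hB fun a => (measurable_const.indicator hs).comp
      (by fun_prop)).ennreal_ofReal

theorem pairKernel_apply (hB : IsInteraction B₀ B) (μ : Measure (Traj (Opinion d) t))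
    [IsProbabilityMeasure μ] (x : Traj (Opinion d) t) :
    pairKernel hB μ x = pairLaw B₀ B t μ x := rfl

theorem isMarkovKernel_pairKernel (hB : IsInteraction B₀ B) (μ : Measure (Traj (Opinion d) t))
    [IsProbabilityMeasure μ] : IsMarkovKernel (pairKernel hB μ) :=
  ⟨fun x => isProbabilityMeasure_pairLaw hB μ x⟩

variable {Ω : Type*} [MeasurableSpace Ω] {P : Measure Ω} [IsProbabilityMeasure P] {γ : ℝ} {n : ℕ}
  {ξ Z : Fin n → ℕ → Ω → Opinion d} {A : Fin n → Fin n → ℕ → Ω → Bool} {μ₀ ν : Measure (Opinion d)}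
  [IsProbabilityMeasure μ₀] [IsProbabilityMeasure ν]

/-- The trajectory of i occurs twice because the conditional law concerns a triple that contains the
conditioning variable. Equality on rectangles suffices, and there it is `HasLimitLaw.integral_pair`
for a product of indicators. -/
theorem HasLimitLaw.map_pair_eq_compProd (hB : IsInteraction B₀ B)
    (hZ : ∀ i t, Measurable (Z i t)) (hA : ∀ i j t, Measurable (A i j t))
    (h : HasLimitLaw P γ B₀ B μ₀ ν Z A t) [IsProbabilityMeasure (limLaw γ B₀ B μ₀ ν t)]
    {i j : Fin n} (hij : i ≠ j) :
    P.map (fun ω => (traj (Z i) t ω, traj (Z i) t ω, traj (Z j) t ω, traj (A i j) t ω)) =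
      limLaw γ B₀ B μ₀ ν t ⊗ₘ pairKernel hB (limLaw γ B₀ B μ₀ ν t) := by
  have := isMarkovKernel_pairKernel hB (limLaw γ B₀ B μ₀ ν t)
  have hT : ∀ i, Measurable (traj (Z i) t) := fun i => measurable_traj (hZ i) t
  have hTA : ∀ i j, Measurable (traj (A i j) t) := fun i j => measurable_traj (hA i j) t
  have hm : Measurable fun ω => (traj (Z i) t ω, traj (Z i) t ω, traj (Z j) t ω,
      traj (A i j) t ω) := (hT i).prodMk ((hT i).prodMk ((hT j).prodMk (hTA i j)))
  have := Measure.isProbabilityMeasure_map (μ := P) hm.aemeasurable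
  refine Measure.ext_prod fun {s u} hs hu => ?_
  rw [Measure.compProd_apply_prod hs hu]
  simp only [pairKernel_apply, pairLaw_apply hB _ hu]
  let f : Traj Bool t → Traj (Opinion d) t → Traj (Opinion d) t → ℝ := fun a x y =>
    s.indicator (fun _ => (1 : ℝ)) x * u.indicator (fun _ => (1 : ℝ)) (x, y, a)
  have hind : ∀ (S : Set (PairTraj d t)) (y : PairTraj d t),
      S.indicator (fun _ => (1 : ℝ)) y ∈ Set.Icc (0 : ℝ) 1 := fun S y => by
    by_cases hy : y ∈ S <;> simp [hy]
  have hfb : ∀ a x y, |f a x y| ≤ 1 := fun a x y => by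
    refine abs_mul_le_of_mem_Icc ?_ (hind u (x, y, a))
    by_cases hx : x ∈ s <;> simp [hx]
  have hfm : ∀ a, Measurable fun p : Traj (Opinion d) t × Traj (Opinion d) t => f a p.1 p.2 :=
    fun a => ((measurable_const.indicator hs).comp measurable_fst).mul
      ((measurable_const.indicator hu).comp (by fun_prop))
  have hpair := h.integral_pair hB hZ hA hij hfm hfb
  have h1 : ∀ x, pairMean B₀ B t (limLaw γ B₀ B μ₀ ν t) f x = s.indicator (fun x =>
      pairMean B₀ B t (limLaw γ B₀ B μ₀ ν t)
        (fun a x y => u.indicator (fun _ => (1 : ℝ)) (x, y, a)) x) x := by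
    intro x
    by_cases hx : x ∈ s <;> simp [pairMean, f, hx]
  have hg : Measurable (pairMean B₀ B t (limLaw γ B₀ B μ₀ ν t)
      (fun a x y => u.indicator (fun _ => (1 : ℝ)) (x, y, a))) :=
    measurable_pairMean hB fun a => (measurable_const.indicator hu).comp (by fun_prop)
  have hgb : ∀ x, |pairMean B₀ B t (limLaw γ B₀ B μ₀ ν t)
      (fun a x y => u.indicator (fun _ => (1 : ℝ)) (x, y, a)) x| ≤ 1 := fun x =>
    norm_pairMean_le (M := 1) hB (fun a x y => by
      rw [Real.norm_eq_abs, abs_of_nonneg (hind u (x, y, a)).1]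
      exact (hind u (x, y, a)).2) x
  have hg0 : ∀ x, 0 ≤ pairMean B₀ B t (limLaw γ B₀ B μ₀ ν t)
      (fun a x y => u.indicator (fun _ => (1 : ℝ)) (x, y, a)) x := fun x =>
    integral_nonneg fun y => Finset.sum_nonneg fun a _ =>
      mul_nonneg (edgeLaw_mem hB t x y a).1 (hind u _).1
  rw [← ofReal_integral_eq_lintegral_ofReal (integrable_bounded hg hgb).integrableOn
    (ae_of_all _ hg0), ← integral_indicator hs]
  simp only [h1] at hpair
  rw [← hpair, Measure.map_apply hm (hs.prod hu), ← ofReal_measureReal,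
    ← integral_indicator_one (hm (hs.prod hu))]
  congr 1
  refine integral_congr_ae (ae_of_all _ fun ω => ?_)
  by_cases hx : traj (Z i) t ω ∈ s <;>
    by_cases hy : (traj (Z i) t ω, traj (Z j) t ω, traj (A i j) t ω) ∈ u <;>
    simp [f, hx, hy]

/-- Conditional distributions are unique almost everywhere and depend only on the joint law, so `Z'`
and `A'` need not come from the process itself. -/
theorem HasLimitLaw.condDistrib_ae_eq (hB : IsInteraction B₀ B)
    (hZ : ∀ i t, Measurable (Z i t)) (hA : ∀ i j t, Measurable (A i j t))
    (h : HasLimitLaw P γ B₀ B μ₀ ν Z A t) {i j l : Fin n} (hij : i ≠ j)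
    {Z' : Ω → Traj (Opinion d) t} {A' : Ω → Traj Bool t}
    (hid : IdentDistrib (fun ω => (traj (Z l) t ω, Z' ω, A' ω))
      (fun ω => (traj (Z i) t ω, traj (Z j) t ω, traj (A i j) t ω)) P P) :
    ∀ᵐ ω ∂P, condDistrib (fun ω => (traj (Z l) t ω, Z' ω, A' ω)) (traj (Z l) t) P
      (traj (Z l) t ω) = pairLaw B₀ B t (limLaw γ B₀ B μ₀ ν t) (traj (Z l) t ω) := by
  have := isProbabilityMeasure_limLaw (γ := γ) (μ₀ := μ₀) (ν := ν) hB t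
  have := isMarkovKernel_pairKernel hB (limLaw γ B₀ B μ₀ ν t)
  have hmap : P.map (fun ω => (traj (Z l) t ω, traj (Z l) t ω, Z' ω, A' ω)) =
      P.map (traj (Z l) t) ⊗ₘ pairKernel hB (limLaw γ B₀ B μ₀ ν t) := by
    rw [h.map_traj hB hZ l, ← h.map_pair_eq_compProd hB hZ hA hij]
    exact (hid.comp (u := fun p : PairTraj d t => (p.1, p)) (by fun_prop)).map_eq
  exact ae_of_ae_map (measurable_traj (hZ l) t).aemeasurable
    (condDistrib_ae_eq_of_measure_eq_compProd (traj (Z l) t) hid.aemeasurable_fst hmap)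

end PairLaw

/-! ### Convergence in law of neighbourhood empirical measures -/

/-- The Borel σ-algebra of an induced topology is the pulled back one. Borel measurability of random
probability measures thus reduces to countably many real integrals. -/
theorem measurable_borel_of_isInducing {Ω T U : Type*} [MeasurableSpace Ω] [TopologicalSpace T]
    [TopologicalSpace U] [MeasurableSpace U] [BorelSpace U] {f : T → U} (hf : IsInducing f)
    {X : Ω → T} (h : Measurable fun ω => f (X ω)) : Measurable[_, borel T] X := by
  have e : borel T = MeasurableSpace.comap f ‹MeasurableSpace U› := by
    rw [BorelSpace.measurable_eq (α := U), ← borel_comap, ← hf.eq_induced]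
  rw [e]
  exact measurable_comap_iff.2 h

/-- Bounded Lipschitz functions determine convergence in law. The limit is allowed a measurable
version `Y'`, since the conditional law agrees with the explicit kernel only almost surely. -/
theorem tendstoInLaw_of_lipschitz {Ω Ω' T : Type*} [MeasurableSpace Ω] [MeasurableSpace Ω']
    [PseudoMetricSpace T] {P : Measure Ω} [IsProbabilityMeasure P] {P' : Measure Ω'}
    [IsProbabilityMeasure P'] {X : ℕ → Ω → T} {Y Y' : Ω' → T}
    (hX : ∀ m, Measurable[_, borel T] (X m)) (hY' : Measurable[_, borel T] Y')
    (hY : Y =ᵐ[P'] Y')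
    (h : ∀ F : T → ℝ, (∃ M, ∀ x y, dist (F x) (F y) ≤ M) → (∃ K, LipschitzWith K F) →
      Tendsto (fun m => ∫ ω, F (X m ω) ∂P) atTop (𝓝 (∫ ω, F (Y' ω) ∂P'))) :
    TendstoInLaw P P' X Y := by
  unfold TendstoInLaw
  let _ : MeasurableSpace T := borel T
  have : BorelSpace T := ⟨rfl⟩
  have hYm : AEMeasurable Y P' := ⟨Y', hY', hY⟩
  refine ⟨fun m => (hX m).aemeasurable, hYm, tendsto_iff_forall_lipschitz_integral_tendsto.2
    fun F hF hL => ?_⟩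
  obtain ⟨K, hK⟩ := hL
  have hFm := hK.continuous.measurable
  have h1 := h F hF ⟨K, hK⟩
  have e : ∫ ω, F (Y' ω) ∂P' = ∫ ω, F (Y ω) ∂P' := integral_congr_ae (hY.fun_comp F).symm
  rw [e] at h1
  refine (h1.congr fun m => ?_).trans_eq ?_
  · exact (integral_map (hX m).aemeasurable hFm.aestronglyMeasurable).symm
  · congr 1
    exact (integral_map hYm hFm.aestronglyMeasurable).symm

section InducedMetric

variable {T : Type*} [TopologicalSpace T] {Φ : T → ℕ → ℝ}

/-- A pseudometric for the topology induced by countably many real functions. -/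
@[reducible] noncomputable def inducedMetric (hΦ : IsInducing Φ) : PseudoMetricSpace T :=
  (PseudoMetricSpace.induced Φ (PiCountable.pseudoMetricSpace (F := fun _ : ℕ => ℝ))).replaceTopology
    hΦ.eq_induced

/-- The uniformity of a countable product is tested coordinatewise. -/
theorem tendsto_dist_inducedMetric (hΦ : IsInducing Φ) {L : Filter (T × T)}
    (h : ∀ q, Tendsto (fun p : T × T => Φ p.1 q - Φ p.2 q) L (𝓝 0)) :
    Tendsto (fun p : T × T => (inducedMetric hΦ).dist p.1 p.2) L (𝓝 0) := by
  have h1 : Tendsto (fun p : T × T => (Φ p.1, Φ p.2)) L (uniformity (ℕ → ℝ)) := by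
    rw [Pi.uniformity]
    refine tendsto_iInf.2 fun q => tendsto_comap_iff.2
      (tendsto_uniformity_iff_dist_tendsto_zero.2 ?_)
    simpa [Real.dist_eq, Function.comp_def] using (h q).abs
  let _ : PseudoMetricSpace (ℕ → ℝ) := PiCountable.pseudoMetricSpace
  exact (tendsto_uniformity_iff_dist_tendsto_zero (α := ℕ → ℝ)
    (f := fun p : T × T => (Φ p.1, Φ p.2))).1 h1

end InducedMetric

section NeighbourhoodLaw

variable {Ω : Type*} [MeasurableSpace Ω] {P : Measure Ω} [IsProbabilityMeasure P] {d : ℕ} {γ : ℝ}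
  {B₀ : Opinion d → Opinion d → ℝ} {B : Bool → Opinion d → Opinion d → ℝ}
  {Z : (n : ℕ) → Fin n → ℕ → Ω → Opinion d}
  {A : (n : ℕ) → Fin n → Fin n → ℕ → Ω → Bool} {μ₀ ν : Measure (Opinion d)}
  [IsProbabilityMeasure μ₀] [IsProbabilityMeasure ν] {t : ℕ}

/-- The trajectory of the agent `i` and the empirical measure of its trajectory, those of the other
agents, and its edge paths. -/
noncomputable def neighbourhood {n : ℕ} [NeZero n] (Z : Fin n → ℕ → Ω → Opinion d)
    (A : Fin n → Fin n → ℕ → Ω → Bool) (t : ℕ) (i : Fin n) (ω : Ω) :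
    Traj (Opinion d) t × ProbabilityMeasure (PairTraj d t) :=
  (traj (Z i) t ω, empirical fun j => (traj (Z i) t ω, traj (Z j) t ω, traj (A i j) t ω))

/-- The limit of `neighbourhood` for an agent with trajectory `z`. -/
noncomputable def limitNeighbourhood (hB : IsInteraction B₀ B) (μ : Measure (Traj (Opinion d) t))
    [IsProbabilityMeasure μ] (z : Traj (Opinion d) t) :
    Traj (Opinion d) t × ProbabilityMeasure (PairTraj d t) :=
  (z, ⟨pairLaw B₀ B t μ z, isProbabilityMeasure_pairLaw hB μ z⟩)

theorem measurable_borel_prod {f : ℕ → BoundedContinuousFunction (PairTraj d t) ℝ}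
    (hf : IsInducing fun (μ : ProbabilityMeasure (PairTraj d t)) q =>
      ∫ x, f q x ∂(μ : Measure (PairTraj d t))) {Ω : Type*} [MeasurableSpace Ω]
    {X : Ω → Traj (Opinion d) t × ProbabilityMeasure (PairTraj d t)}
    (h1 : Measurable fun ω => (X ω).1)
    (h2 : ∀ q, Measurable fun ω => ∫ x, f q x ∂((X ω).2 : Measure (PairTraj d t))) :
    Measurable[_, borel _] X :=
  measurable_borel_of_isInducing (IsInducing.id.prodMap hf)
    (h1.prodMk (measurable_pi_lambda _ h2))

theorem measurable_borel_neighbourhood {f : ℕ → BoundedContinuousFunction (PairTraj d t) ℝ}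
    (hf : IsInducing fun (μ : ProbabilityMeasure (PairTraj d t)) q =>
      ∫ x, f q x ∂(μ : Measure (PairTraj d t))) {n : ℕ} [NeZero n]
    {Z : Fin n → ℕ → Ω → Opinion d} {A : Fin n → Fin n → ℕ → Ω → Bool}
    (hZ : ∀ i t, Measurable (Z i t)) (hA : ∀ i j t, Measurable (A i j t)) (i : Fin n) :
    Measurable[_, borel _] (neighbourhood Z A t i) := by
  refine measurable_borel_prod hf (measurable_traj (hZ i) t) fun q => ?_
  simp only [neighbourhood, integral_empirical _ (f q).continuous.measurable]
  exact (Finset.measurable_sum _ fun j _ => (f q).continuous.measurable.comp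
    ((measurable_traj (hZ i) t).prodMk ((measurable_traj (hZ j) t).prodMk
      (measurable_traj (hA i j) t)))).const_mul _

theorem measurable_borel_limitNeighbourhood
    {f : ℕ → BoundedContinuousFunction (PairTraj d t) ℝ}
    (hf : IsInducing fun (μ : ProbabilityMeasure (PairTraj d t)) q =>
      ∫ x, f q x ∂(μ : Measure (PairTraj d t))) (hB : IsInteraction B₀ B)
    (μ : Measure (Traj (Opinion d) t)) [IsProbabilityMeasure μ] :
    Measurable[_, borel _] (limitNeighbourhood hB μ) := by
  refine measurable_borel_prod hf measurable_id fun q => ?_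
  have e : (fun z => ∫ x, f q x ∂((limitNeighbourhood hB μ z).2 : Measure (PairTraj d t))) =
      pairMean B₀ B t μ fun a x y => f q (x, y, a) := funext fun z =>
    integral_pairLaw hB μ (f q).continuous.measurable (f q).norm_coe_le_norm z
  rw [e]
  exact measurable_pairMean hB fun a => (f q).continuous.measurable.comp (by fun_prop)

/-- A Slutsky argument. The neighbourhood `X` and the limiting neighbourhood `W` evaluated at the
agent's actual trajectory are close in probability by the law of large numbers for each `f q`.
Moreover `W` is an almost everywhere continuous function of a trajectory that converges in law.
Assumption `hFu` is uniform continuity of `F`, phrased through the determining integrals instead of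
a metric on measures. -/
theorem Chaos.tendsto_integral_neighbourhood
    {f : ℕ → BoundedContinuousFunction (PairTraj d t) ℝ}
    (hf : IsInducing fun (μ : ProbabilityMeasure (PairTraj d t)) q =>
      ∫ x, f q x ∂(μ : Measure (PairTraj d t)))
    (hB : IsInteraction B₀ B) (hμ₀ : μ₀ ≪ volume) (hν : ν ≪ volume)
    (hch : Chaos P γ B₀ B μ₀ ν Z A t)
    (hZ : ∀ n i t, Measurable (Z n i t)) (hA : ∀ n i j t, Measurable (A n i j t))
    [IsProbabilityMeasure (limLaw γ B₀ B μ₀ ν t)]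
    {F : Traj (Opinion d) t × ProbabilityMeasure (PairTraj d t) → ℝ} {M : ℝ}
    (hFM : ∀ x y, dist (F x) (F y) ≤ M) (hFc : Continuous F)
    (hFu : ∀ L : Filter ((Traj (Opinion d) t × ProbabilityMeasure (PairTraj d t)) ×
        (Traj (Opinion d) t × ProbabilityMeasure (PairTraj d t))),
      Tendsto (fun p => dist p.1.1 p.2.1) L (𝓝 0) →
      (∀ q, Tendsto (fun p => ∫ x, f q x ∂(p.1.2 : Measure (PairTraj d t)) -
        ∫ x, f q x ∂(p.2.2 : Measure (PairTraj d t))) L (𝓝 0)) →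
      Tendsto (fun p => F p.1 - F p.2) L (𝓝 0)) (i : (m : ℕ) → Fin (m + 1)) :
    Tendsto (fun m => ∫ ω, F (neighbourhood (Z (m + 1)) (A (m + 1)) t (i m) ω) ∂P) atTop
      (𝓝 (∫ z, F (limitNeighbourhood hB (limLaw γ B₀ B μ₀ ν t) z) ∂limLaw γ B₀ B μ₀ ν t)) := by
  set μ := limLaw γ B₀ B μ₀ ν t with hμ
  let T := Traj (Opinion d) t × ProbabilityMeasure (PairTraj d t)
  have hT : ∀ n i, Measurable (traj (Z n i) t) := fun n i => measurable_traj (hZ n i) t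
  let κ : Traj (Opinion d) t → T := limitNeighbourhood hB μ
  let X : ℕ → Ω → T := fun m => neighbourhood (Z (m + 1)) (A (m + 1)) t (i m)
  let W : ℕ → Ω → T := fun m ω => κ (traj (Z (m + 1) (i m)) t ω)
  have hFm : Measurable[borel T, _] F := hFc.borel_measurable
  have hXm : ∀ m, Measurable fun ω => F (X m ω) := fun m =>
    hFm.comp (measurable_borel_neighbourhood hf (hZ _) (hA _) (i m))
  have hκm : Measurable fun z => F (κ z) := hFm.comp (measurable_borel_limitNeighbourhood hf hB μ)
  have hWm : ∀ m, Measurable fun ω => F (W m ω) := fun m => hκm.comp (hT _ _)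
  obtain ⟨z₀⟩ := nonempty_of_isProbabilityMeasure μ
  have hFb : ∀ x, |F x| ≤ M + |F (κ z₀)| := fun x => by
    have := hFM x (κ z₀)
    rw [Real.dist_eq] at this
    have := abs_sub_abs_le_abs_sub (F x) (F (κ z₀))
    linarith
  have hκint : ∀ q z, ∫ x, f q x ∂((κ z).2 : Measure (PairTraj d t)) =
      pairMean B₀ B t μ (fun a x y => f q (x, y, a)) z := fun q z =>
    integral_pairLaw hB μ (f q).continuous.measurable (f q).norm_coe_le_norm z
  have hfqm : ∀ q a, Continuous fun p : Traj (Opinion d) t × Traj (Opinion d) t =>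
      f q (p.1, p.2, a) := fun q a => (f q).continuous.comp (by fun_prop)
  -- Countability of the family is essential: one null set of trajectories serves all `f q`.
  have hκc : ∀ᵐ z ∂μ, ContinuousAt (fun z => F (κ z)) z := by
    have h : ∀ᵐ z ∂μ, ∀ q,
        ContinuousAt (pairMean B₀ B t μ fun a x y => f q (x, y, a)) z :=
      ae_all_iff.2 fun q => ae_continuousAt_pairMean hB hμ₀ hν (fun a => (hfqm q a).measurable)
        (integrable_const ‖f q‖) (fun a x y => (f q).norm_coe_le_norm _)
        fun a => ae_of_all _ fun p => (hfqm q a).continuousAt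
    filter_upwards [h] with z hz
    refine hFc.continuousAt.comp (continuousAt_id.prodMk (hf.continuousAt_iff.2 ?_))
    refine continuousAt_pi.2 fun q => ?_
    exact (hz q).congr (Eventually.of_forall fun z' => (hκint q z').symm)
  have hlim := hch.tendsto_integral_single hB hκm (fun z => hFb _) hκc i
  have hpair : Tendsto (fun m => ∫ ω, |F (X m ω) - F (W m ω)| ∂P) atTop (𝓝 0) := by
    refine tendsto_integral_dist_of_inProb hFM (fun m => (hXm m).sub (hWm m)) (hFu _ ?_ ?_)
    · refine tendsto_inProb_zero (g := fun p : T × T => dist p.1.1 p.2.1) ?_ ?_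
      · intro m
        simp [X, W, κ, neighbourhood, limitNeighbourhood]
      · simp [X, W, κ, neighbourhood, limitNeighbourhood]
    · intro q
      obtain ⟨h1, h2⟩ := hch.tendsto_lln_norm hB hμ₀ hν hZ hA
        (f := fun a x y => f q (x, y, a)) (fun a => (hfqm q a).measurable)
        (fun a x y => (f q).norm_coe_le_norm _)
        (fun a => ae_of_all _ fun p => (hfqm q a).continuousAt) i
      have e : ∀ m ω, ∫ x, f q x ∂((X m ω).2 : Measure (PairTraj d t)) -
          ∫ x, f q x ∂((W m ω).2 : Measure (PairTraj d t)) =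
          ((m : ℝ) + 1)⁻¹ • ∑ j, f q (traj (Z (m + 1) (i m)) t ω, traj (Z (m + 1) j) t ω,
            traj (A (m + 1) (i m) j) t ω) -
          pairMean B₀ B t μ (fun a x y => f q (x, y, a)) (traj (Z (m + 1) (i m)) t ω) := by
        intro m ω
        simp only [W, hκint]
        simp only [X, neighbourhood, integral_empirical _ (f q).continuous.measurable]
        simp
      exact tendsto_inProb_zero (g := fun p : T × T => ∫ x, f q x ∂(p.1.2 : Measure (PairTraj d t)) -
        ∫ x, f q x ∂(p.2.2 : Measure (PairTraj d t)))
        (fun m => (h1 m).congr (ae_of_all _ fun ω => (e m ω).symm))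
        (h2.congr fun m => integral_congr_ae (ae_of_all _ fun ω => congrArg abs (e m ω).symm))
  have hXi : ∀ m, Integrable (fun ω => F (X m ω)) P := fun m =>
    integrable_bounded (hXm m) fun ω => hFb _
  have hWi : ∀ m, Integrable (fun ω => F (W m ω)) P := fun m =>
    integrable_bounded (hWm m) fun ω => hFb _
  have hdiff : Tendsto (fun m => ∫ ω, F (X m ω) ∂P - ∫ ω, F (W m ω) ∂P) atTop (𝓝 0) := by
    refine squeeze_zero_norm (fun m => ?_) hpair
    rw [← integral_sub (hXi m) (hWi m)]
    exact norm_integral_le_integral_norm _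
  have hsum := hdiff.add hlim
  simp only [zero_add] at hsum
  exact hsum.congr fun m => sub_add_cancel _ _

end NeighbourhoodLaw

/-! ### The main theorem -/

section Main

variable {Ω : Type*} [MeasurableSpace Ω] {P : Measure Ω} [IsProbabilityMeasure P] {d : ℕ} {γ : ℝ}
  {B₀ : Opinion d → Opinion d → ℝ} {B : Bool → Opinion d → Opinion d → ℝ}
  {Z : (n : ℕ) → Fin n → ℕ → Ω → Opinion d}
  {A : (n : ℕ) → Fin n → Fin n → ℕ → Ω → Bool} {μ₀ ν : Measure (Opinion d)}
  [IsProbabilityMeasure μ₀] [IsProbabilityMeasure ν] {t : ℕ}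

theorem Chaos.tendstoInLaw_neighbourhood (hB : IsInteraction B₀ B) (hμ₀ : μ₀ ≪ volume)
    (hν : ν ≪ volume) (hch : Chaos P γ B₀ B μ₀ ν Z A t)
    (hZ : ∀ n i t, Measurable (Z n i t)) (hA : ∀ n i j t, Measurable (A n i j t))
    [IsProbabilityMeasure (limLaw γ B₀ B μ₀ ν t)]
    {Ω' : Type*} [MeasurableSpace Ω'] {P' : Measure Ω'} [IsProbabilityMeasure P']
    {x : Ω' → Traj (Opinion d) t} (hx : Measurable x) (hlaw : P'.map x = limLaw γ B₀ B μ₀ ν t)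
    {Y : Ω' → Traj (Opinion d) t × ProbabilityMeasure (PairTraj d t)}
    (hY : Y =ᵐ[P'] fun ω => limitNeighbourhood hB (limLaw γ B₀ B μ₀ ν t) (x ω)) (i : ℕ) :
    TendstoInLaw P P' (fun m => neighbourhood (Z (m + i + 1)) (A (m + i + 1)) t ⟨i, by omega⟩)
      Y := by
  obtain ⟨f, hf⟩ := exists_determining_family (S := PairTraj d t)
  let _ : PseudoMetricSpace (ProbabilityMeasure (PairTraj d t)) := inducedMetric hf
  have hκm := measurable_borel_limitNeighbourhood hf hB (limLaw γ B₀ B μ₀ ν t)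
  refine tendstoInLaw_of_lipschitz (fun m => measurable_borel_neighbourhood hf (hZ _) (hA _) _)
    (hκm.comp hx) hY fun F ⟨M, hM⟩ ⟨K, hK⟩ => ?_
  -- Chaos needs an agent in every system. The default 0 is used only in systems too small to
  -- contain agent i, and these disappear under the shift by i.
  let j : (m : ℕ) → Fin (m + 1) := fun m => if h : i < m + 1 then ⟨i, h⟩ else 0
  have h := hch.tendsto_integral_neighbourhood hf hB hμ₀ hν hZ hA hM hK.continuous
    (fun L h1 h2 => ?_) j
  · let G := fun z => F (limitNeighbourhood hB (limLaw γ B₀ B μ₀ ν t) z)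
    have hG : Measurable G := hK.continuous.borel_measurable.comp hκm
    have e : ∫ z, G z ∂limLaw γ B₀ B μ₀ ν t = ∫ ω, G (x ω) ∂P' :=
      (congrArg (fun m => ∫ z, G z ∂m) hlaw.symm).trans
        (integral_map hx.aemeasurable hG.aestronglyMeasurable)
    change Tendsto _ _ (𝓝 (∫ z, G z ∂limLaw γ B₀ B μ₀ ν t)) at h
    rw [e] at h
    refine (h.comp (tendsto_add_atTop_nat i)).congr fun m => ?_
    have hj : j (m + i) = ⟨i, by omega⟩ := dif_pos _
    simp only [Function.comp_apply, hj]
  · have hd := tendsto_dist_inducedMetric hf (L := L.map fun p : (Traj (Opinion d) t ×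
      ProbabilityMeasure (PairTraj d t)) × (Traj (Opinion d) t ×
        ProbabilityMeasure (PairTraj d t)) => (p.1.2, p.2.2)) fun q => tendsto_map'_iff.2 (h2 q)
    have hd' := (h1.max (tendsto_map'_iff.1 hd)).const_mul (K : ℝ)
    simp only [max_self, mul_zero] at hd'
    refine squeeze_zero_norm (fun p => ?_) hd'
    rw [← dist_eq_norm]
    exact hK.dist_le_mul p.1 p.2

end Main

/-- The systems have m + 1 agents for the empirical measure to be defined, and m + i + 1 agents in
the second claim for agent i, counted from 0, to exist. The limiting process lives on a probability
space of its own, with k + 2 agents so that the pair 0, 1 is available. -/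
theorem mainTheorem2 {d : ℕ} {Ω : Type*} [MeasurableSpace Ω] (P : Measure Ω)
    [IsProbabilityMeasure P]
    (γ : ℝ) (hγ : γ ∈ Set.Ioo (0 : ℝ) 1)
    (B₀ : Opinion d → Opinion d → ℝ) (B : Bool → Opinion d → Opinion d → ℝ)
    (hB : IsInteraction B₀ B)
    (ξ : ℕ → ℕ → Ω → Opinion d) (Z : (n : ℕ) → Fin n → ℕ → Ω → Opinion d)
    (A : (n : ℕ) → Fin n → Fin n → ℕ → Ω → Bool)
    (μ₀ : Measure (Opinion d)) [IsProbabilityMeasure μ₀]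
    (hsys : IsParticleSystem P γ B₀ B ξ Z A)
    (hinit : IsInitial P (fun n i => Z n i 0) μ₀)
    (hbds : HasBounds P B₀ B ξ (fun n i => Z n i 0))
    {Ω' : Type*} [MeasurableSpace Ω'] (P' : Measure Ω') [IsProbabilityMeasure P'] {k : ℕ}
    (ξl Zl : Fin (k + 2) → ℕ → Ω' → Opinion d) (Al : Fin (k + 2) → Fin (k + 2) → ℕ → Ω' → Bool)
    (hlim : IsLimitProcess P' γ B₀ B μ₀ (P.map (ξ 0 0)) ξl Zl Al)
    (t : ℕ) :
    TendstoInProbConst P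
      (fun m ω => empirical fun j : Fin (m + 1) => traj (Z (m + 1) j) t ω)
      (law P' (traj (Zl 0) t) (measurable_traj (hlim.measurable_opinion 0) t)) ∧
    ∀ (i : Fin (k + 2)) (Z' : Ω' → Traj (Opinion d) t) (A' : Ω' → Traj Bool t),
      IdentDistrib (fun ω => (traj (Zl i) t ω, Z' ω, A' ω))
        (fun ω => (traj (Zl 0) t ω, traj (Zl 1) t ω, traj (Al 0 1) t ω)) P' P' →
      TendstoInLaw P P'
        (fun m ω =>
          (traj (Z (m + i + 1) ⟨i, by omega⟩) t ω,
            empirical fun j : Fin (m + i + 1) =>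
              (traj (Z (m + i + 1) ⟨i, by omega⟩) t ω, traj (Z (m + i + 1) j) t ω,
                traj (A (m + i + 1) ⟨i, by omega⟩ j) t ω)))
        (fun ω =>
          (traj (Zl i) t ω,
            condLaw P' (fun ω' => (traj (Zl i) t ω', Z' ω', A' ω')) (traj (Zl i) t) ω)) := by
  have := Measure.isProbabilityMeasure_map (μ := P) (hsys.measurable_noise 0 0).aemeasurable
  have := isProbabilityMeasure_limLaw (γ := γ) (μ₀ := μ₀) (ν := P.map (ξ 0 0)) hB t
  have hch := chaos hγ hB hsys hinit hbds rfl t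
  have hlaw := hasLimitLaw hB hlim t
  have hA : ∀ n i j t, Measurable (A n i j t) := fun n => (hsys.network n).measurable
  refine ⟨hch.tendsto_empirical hB hinit.ac hsys.noise_ac hsys.measurable_opinion hA _
    (hlaw.map_traj hB hlim.measurable_opinion 0), fun i Z' A' hid => ?_⟩
  refine hch.tendstoInLaw_neighbourhood hB hinit.ac hsys.noise_ac hsys.measurable_opinion hA
    (measurable_traj (hlim.measurable_opinion i) t) (hlaw.map_traj hB hlim.measurable_opinion i)
    ?_ i
  filter_upwards [hlaw.condDistrib_ae_eq hB hlim.measurable_opinion hlim.network.measurable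
    (i := 0) (j := 1) (l := i) (by simp) hid] with ω h
  exact Prod.ext rfl (Subtype.ext h)
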